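/- **Setting.** Let $\omega>0$ be diophantine (there are $\kappa,\tau>0$ with $|q\omega-p|\ge\kappa|q|^{-\tau}$ for all integers $p$ and $q\ne0$), and let $\Omega_0=\sqrt{1+2\omega}$. For $2\pi$-periodic functions $u(t,\theta)$ with the symmetries $u(t,\theta)=u(t,-\theta)=\bar u(-t,\theta)$ put $$f(u;\Omega)=L(\Omega)u+\omega\frac{\bar u^2}{1+\bar u},\qquad L(\Omega)u=-i\Omega u_t-u_{\theta\theta}+\omega(u+\bar u),\qquad \langle u_1,u_2\rangle=\frac1{(2\pi)^2}\int_{\mathbb T^2}u_1\bar u_2\,dt\,d\theta .$$ Let $\Lambda=\mathbb N^+\times\mathbb N\times\{1,-1\}\cup\{0\}\times\mathbb N\times\{1\}$. Let $(e_x)_{x\in\Lambda}$ be the orthonormal eigenbasis of $L(\Omega_0)$: $e_{0,0,1}=1$, $e_{0,k,1}=\sqrt2\cos k\theta$ for $k\ge1$, and for $j\ge1$ $$e_{j,k,l}=c_k(a\cos jt+ib\sin jt)\cos k\theta,\qquad c_0=\sqrt2,\quad c_k=2\ (k\ge1),$$ where $(a,b)$ is the normalization to unit length of $(\omega+l\sqrt{j^2\Omega_0^2+\omega^2},\;j\Omega_0)$.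 Put $N=\{(1,1,-1)\}$, $v(r)=r\,e_{1,1,-1}$ (which spans $\ker L(\Omega_0)$), and $P_Au=\sum_{x\in A}\langle u,e_x\rangle e_x$. Fix $s>1$ and $\sigma_0>0$. With $|(j,k)|=\sqrt{j^2+k^2}$ and $\langle(j,k)\rangle=\sqrt{1+j^2+k^2}$, the space $h_\sigma$ consists of the symmetric $u$ with $$\|u\|_\sigma^2=\sum_{(j,k,l)\in\Lambda}\langle u,e_{j,k,l}\rangle^2e^{2\sigma|(j,k)|}\langle(j,k)\rangle^{2s}<\infty .$$ For a matrix $G$ indexed by sites, $\|G\|_\sigma$ is the maximum of $\sup_x\sum_y|G(x,y)|e^{\sigma|x-y|}\langle x-y\rangle^s$ and $\sup_y\sum_x|G(x,y)|e^{\sigma|x-y|}\langle x-y\rangle^s$, where $x-y$ denotes the difference of the $(j,k)$-components. Let $L_0>0$, $\beta>3/2$, $L_n=2^nL_0$, $d_n=L_n^{-\beta}$ and $B_n=\{(j,k,l)\in\Lambda\setminus N:\ j+k<L_n\}$. Let $\gamma_n>0$ $(n\ge1)$ satisfy $\sum_{n\ge1}2\gamma_n=\sigma_0/2$ and, for some $\ell>0$,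 $$\sup_{n\ge1}\ \gamma_n^{-2}\,e^{-\gamma_n\ell\sqrt{L_n}}/d_n<\infty ,$$ and put $\sigma_n=\sigma_{n-1}-2\gamma_n$. Let $C>0$. **Theorem.** There is $\delta>0$, depending only on $\omega$ and $L_0$, and there are $\rho,r_0>0$, depending on all the data above, such that the following holds. Let $\mathcal R=\{(r,\Omega):0\le r<r_0,\ |\Omega-\Omega_0|<\delta\}$. 1. For every $(r,\Omega)\in\mathcal R$ there is exactly one $w_0=w_0(r,\Omega)$ in the range of $P_{B_0}$ with $\|w_0\|_{\sigma_0}<\rho$ and $P_{B_0}f(v(r)+w_0;\Omega)=0$. 2. For $n\ge1$ let $$w_n=w_{n-1}-G_{B_n}P_{B_n}f(v(r)+w_{n-1};\Omega),\qquad G_{B_n}=\bigl(P_{B_n}\partial_wf(v(r)+w_{n-1};\Omega)P_{B_n}\bigr)^{-1}.$$ Let $\mathcal N_n\subseteq\mathcal R$ $(n\ge1)$ be sets such that for all $n\ge1$ and $(r,\Omega)\in\mathcal N_n$ the inverse $G_{B_n}$ exists and satisfies the tame estimate $$\|G_{B_n}\|_{\sigma_n}\le C\gamma_n^{-2}\frac1{d_n}.$$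 Then, for every $(r,\Omega)\in\mathcal N=\bigcap_{n\ge1}\mathcal N_n$, the iterates $w_n(r,\Omega)$ converge in $h_{\sigma_0/2}$ to some $w(r,\Omega)\in h_{\sigma_0/2}$ with $P_Nw=0$ and $|v(r)+w|<1$ everywhere, and $w$ solves the range equation $$P_{\Lambda\setminus N}f(v(r)+w(r,\Omega);\Omega)=0 .$$ Moreover $w$ is Whitney smooth in $(r,\Omega)$ over $\mathcal N$: it is the restriction to $\mathcal N$ of a $C^\infty$ map from $\mathbb R^2$ to $h_{\sigma_0/2}$. -/

import Mathlib

open scoped Matrix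

noncomputable section

namespace VortexFilament

/-- Complex functions `u t θ` of time `t` and space `θ`. Functions on the torus are represented by
functions that are `2π`-periodic in both variables. -/
abbrev Fn := ℝ → ℝ → ℂ

/-- The lattice `Λ = ℕ⁺ × ℕ × {1, -1} ∪ {0} × ℕ × {1}` of sites `(j, k, l)`. -/
abbrev Site := {x : ℕ × ℕ × ℤˣ // x.1 = 0 → x.2.2 = 1}

def Site.j (x : Site) : ℕ := x.1.1
def Site.k (x : Site) : ℕ := x.1.2.1
def Site.l (x : Site) : ℤˣ := x.1.2.2

/-- The kernel site `(1, 1, -1)`; the set `N` is the singleton of this site. -/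
def siteN : Site := ⟨(1, 1, -1), by decide⟩

/-- There are `κ, τ > 0` with `|q ω - p| ≥ κ / |q| ^ τ` for all integers `p` and `q ≠ 0`. -/
def IsDiophantine (ω : ℝ) : Prop :=
  ∃ κ > 0, ∃ τ > 0, ∀ p q : ℤ, q ≠ 0 → κ / |(q : ℝ)| ^ (τ : ℝ) ≤ |(q : ℝ) * ω - (p : ℝ)|

/-- The bifurcation frequency `Ω₀ = √(1 + 2ω)`. -/
def Omega0 (ω : ℝ) : ℝ := √(1 + 2 * ω)

/-- The square root `√(j²Ω² + ω²)`. -/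
def rad (ω Ω : ℝ) (x : Site) : ℝ := √((x.j : ℝ) ^ 2 * Ω ^ 2 + ω ^ 2)

/-- The norm `√2 (ω² + j²Ω² + l ω √(j²Ω² + ω²)) ^ (1/2)` of the vector
`(ω + l √(j²Ω² + ω²), jΩ)`. -/
def vecNorm (ω Ω : ℝ) (x : Site) : ℝ :=
  √2 * √(ω ^ 2 + (x.j : ℝ) ^ 2 * Ω ^ 2 + ((x.l : ℤ) : ℝ) * ω * rad ω Ω x)

def vecA (ω Ω : ℝ) (x : Site) : ℝ := (ω + ((x.l : ℤ) : ℝ) * rad ω Ω x) / vecNorm ω Ω x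

def vecB (ω Ω : ℝ) (x : Site) : ℝ := (x.j : ℝ) * Ω / vecNorm ω Ω x

/-- The factor making `e_{j,k,l}` a unit vector: `1` for `j = k = 0`, `√2` if exactly one of
`j`, `k` vanishes, and `2` otherwise. -/
def amp (x : Site) : ℝ := (if x.j = 0 then 1 else √2) * (if x.k = 0 then 1 else √2)

/-- The orthonormal eigenfunctions of `L(Ω)` on the symmetric functions. For `j = 0` (and `ω > 0`)
this is `amp x * cos (k θ)`. -/
def e (ω Ω : ℝ) (x : Site) : Fn := fun t θ =>
  (amp x : ℂ) * ((vecA ω Ω x * Real.cos (x.j * t) : ℝ)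
      + Complex.I * (vecB ω Ω x * Real.sin (x.j * t) : ℝ)) * (Real.cos (x.k * θ) : ℝ)

/-- The basis at the bifurcation frequency `Ω₀`. -/
def e0 (ω : ℝ) (x : Site) : Fn := e ω (Omega0 ω) x

/-- `⟨u, v⟩ = (2π)⁻² ∫ u v̄ dt dθ`. -/
def ip (u v : Fn) : ℂ :=
  1 / (2 * (Real.pi : ℂ)) ^ 2 *
    ∫ t in (0 : ℝ)..2 * Real.pi, ∫ θ in (0 : ℝ)..2 * Real.pi,
      u t θ * (starRingEnd ℂ) (v t θ)

/-- The coefficient `⟨u, e_x⟩`. It is real for functions with the symmetries `IsSym`. -/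
def coef (ω : ℝ) (u : Fn) (x : Site) : ℝ := (ip u (e0 ω x)).re

/-- Continuous `2π`-periodic functions with `u(t,θ) = u(t,-θ) = ū(-t,θ)`. -/
structure IsSym (u : Fn) : Prop where
  cont : Continuous fun q : ℝ × ℝ => u q.1 q.2
  per_t : ∀ t θ, u (t + 2 * Real.pi) θ = u t θ
  per_θ : ∀ t θ, u t (θ + 2 * Real.pi) = u t θ
  even_θ : ∀ t θ, u t (-θ) = u t θ
  rev : ∀ t θ, (starRingEnd ℂ) (u (-t) θ) = u t θ

/-- `|(a, b)|`. -/
def len (a b : ℝ) : ℝ := √(a ^ 2 + b ^ 2)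

/-- `⟨(a, b)⟩ = √(1 + a² + b²)`. -/
def bracket (a b : ℝ) : ℝ := √(1 + a ^ 2 + b ^ 2)

/-- The weight `e^{σ|(a,b)|} ⟨(a,b)⟩^s`. -/
def wt (s σ a b : ℝ) : ℝ := Real.exp (σ * len a b) * bracket a b ^ s

/-- `u ∈ h_σ`. For `s > 1`, `σ ≥ 0` every class in `h_σ` has a unique continuous
representative, and that is the function used here. -/
def MemH (ω s σ : ℝ) (u : Fn) : Prop :=
  IsSym u ∧ Summable fun x : Site => coef ω u x ^ 2 * wt s σ x.j x.k ^ 2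

/-- The norm `‖u‖_σ`. -/
def normH (ω s σ : ℝ) (u : Fn) : ℝ := √(∑' x : Site, coef ω u x ^ 2 * wt s σ x.j x.k ^ 2)

/-- The projection `P_A` for a finite set `A` of sites. -/
def proj (ω : ℝ) (A : Finset Site) (u : Fn) : Fn := fun t θ =>
  ∑ x ∈ A, (coef ω u x : ℂ) * e0 ω x t θ

/-- `L(Ω)u = -iΩ u_t - u_θθ + ω(u + ū)`. -/
def linOp (ω Ω : ℝ) (u : Fn) : Fn := fun t θ =>
  -Complex.I * Ω * deriv (fun t' => u t' θ) t - iteratedDeriv 2 (fun θ' => u t θ') θ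
    + ω * (u t θ + (starRingEnd ℂ) (u t θ))

/-- `f(u;Ω) = L(Ω)u + ω ū² / (1 + ū)`. -/
def f (ω Ω : ℝ) (u : Fn) : Fn := fun t θ =>
  linOp ω Ω u t θ + ω * ((starRingEnd ℂ) (u t θ) ^ 2 / (1 + (starRingEnd ℂ) (u t θ)))

/-- The linearization of `f` at `u` in the direction `h`, namely
`L(Ω)h + ω (2ū + ū²) / (1 + ū)² h̄`. -/
def df (ω Ω : ℝ) (u h : Fn) : Fn := fun t θ =>
  linOp ω Ω h t θ + ω * ((2 * (starRingEnd ℂ) (u t θ) + (starRingEnd ℂ) (u t θ) ^ 2)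
    / (1 + (starRingEnd ℂ) (u t θ)) ^ 2 * (starRingEnd ℂ) (h t θ))

/-- `df ω Ω u h` is the directional derivative of `f` at `u`. -/
theorem hasDerivAt_f {ω Ω : ℝ} {u h : Fn} {t θ : ℝ}
    (hut : DifferentiableAt ℝ (fun t' => u t' θ) t) (hht : DifferentiableAt ℝ (fun t' => h t' θ) t)
    (huθ : ContDiff ℝ 2 fun θ' => u t θ') (hhθ : ContDiff ℝ 2 fun θ' => h t θ')
    (hne : 1 + (starRingEnd ℂ) (u t θ) ≠ 0) :
    HasDerivAt (fun ε : ℝ => f ω Ω (fun t' θ' => u t' θ' + (ε : ℂ) * h t' θ') t θ)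
      (df ω Ω u h t θ) 0 := by
  have hlin : ∀ ε : ℝ, linOp ω Ω (fun t' θ' => u t' θ' + (ε : ℂ) * h t' θ') t θ
      = linOp ω Ω u t θ + (ε : ℂ) * linOp ω Ω h t θ := by
    intro ε
    have h1 : deriv (fun t' => u t' θ + (ε : ℂ) * h t' θ) t
        = deriv (fun t' => u t' θ) t + (ε : ℂ) * deriv (fun t' => h t' θ) t := by
      rw [deriv_fun_add hut (hht.const_mul _), deriv_const_mul _ hht]
    have h2 : iteratedDeriv 2 (fun θ' => u t θ' + (ε : ℂ) * h t θ') θ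
        = iteratedDeriv 2 (fun θ' => u t θ') θ
          + (ε : ℂ) * iteratedDeriv 2 (fun θ' => h t θ') θ := by
      rw [iteratedDeriv_fun_add huθ.contDiffAt (contDiff_const.mul hhθ).contDiffAt,
        iteratedDeriv_const_mul_field]
    simp only [linOp, h1, h2, map_add, map_mul, Complex.conj_ofReal]
    ring
  have hε : HasDerivAt (fun ε : ℝ => (ε : ℂ)) 1 0 := Complex.ofRealCLM.hasDerivAt
  have hz : HasDerivAt (fun ε : ℝ => (starRingEnd ℂ) (u t θ + (ε : ℂ) * h t θ))
      ((starRingEnd ℂ) (h t θ)) 0 := by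
    have := (hε.mul_const ((starRingEnd ℂ) (h t θ))).const_add ((starRingEnd ℂ) (u t θ))
    simpa [map_add, map_mul] using this
  have hq := (((hz.pow 2).div (hz.const_add 1) (by simpa using hne)).const_mul (ω : ℂ))
  have hL := (hε.mul_const (linOp ω Ω h t θ)).const_add (linOp ω Ω u t θ)
  have hsum := hL.add hq
  refine (hsum.congr_deriv ?_).congr_of_eventuallyEq (Filter.Eventually.of_forall fun ε => ?_)
  · simp only [df, Pi.pow_apply, Complex.ofReal_zero, zero_mul, add_zero, one_mul]
    congr 2
    field_simp
    push_cast
    ring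
  · simp only [f, hlin]
    rfl

/-- The kernel element `v(r) = r e_{1,1,-1}` at frequency `Ω₀`. -/
def v (ω r : ℝ) : Fn := fun t θ => (r : ℂ) * e0 ω siteN t θ

open Classical in
/-- The ball `{(j,k,l) ∈ Λ \ N : j + k < R}`. -/
def ball (R : ℝ) : Finset Site :=
  ((Finset.range ⌈R⌉₊ ×ˢ Finset.range ⌈R⌉₊ ×ˢ (Finset.univ : Finset ℤˣ)).subtype
    (fun x : ℕ × ℕ × ℤˣ => x.1 = 0 → x.2.2 = 1)).filter
      fun x => x ≠ siteN ∧ (x.j : ℝ) + (x.k : ℝ) < R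

theorem mem_ball {R : ℝ} {x : Site} :
    x ∈ ball R ↔ x ≠ siteN ∧ (x.j : ℝ) + (x.k : ℝ) < R := by
  unfold ball
  simp only [Finset.mem_filter, Finset.mem_subtype, Finset.mem_product, Finset.mem_range,
    Finset.mem_univ, and_true, and_iff_right_iff_imp]
  rintro ⟨-, h⟩
  have h1 : (0 : ℝ) ≤ (x.j : ℝ) := Nat.cast_nonneg _
  have h2 : (0 : ℝ) ≤ (x.k : ℝ) := Nat.cast_nonneg _
  exact ⟨Nat.lt_ceil.2 (show (x.j : ℝ) < R by linarith),
    Nat.lt_ceil.2 (show (x.k : ℝ) < R by linarith)⟩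

/-- The matrix of `P_B ∂_w f(u) P_B` in the basis `e_x`, `x ∈ B`. -/
def jac (ω Ω : ℝ) (u : Fn) (B : Finset Site) : Matrix B B ℝ :=
  Matrix.of fun x y => coef ω (df ω Ω u (e0 ω y)) x

/-- The norm `‖G‖_σ` of a matrix over a finite set of sites: the larger one of
`sup_x ∑_y |G(x,y)| e^{σ|x-y|} ⟨x-y⟩^s` and `sup_y ∑_x |G(x,y)| e^{σ|x-y|} ⟨x-y⟩^s`. -/
def matNorm (s σ : ℝ) {B : Finset Site} (G : Matrix B B ℝ) : ℝ :=
  max (⨆ x : B, ∑ y : B, |G x y| *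
        wt s σ ((x.1.j : ℝ) - (y.1.j : ℝ)) ((x.1.k : ℝ) - (y.1.k : ℝ)))
      (⨆ y : B, ∑ x : B, |G x y| *
        wt s σ ((x.1.j : ℝ) - (y.1.j : ℝ)) ((x.1.k : ℝ) - (y.1.k : ℝ)))

/-- `L_n = 2^n L₀`. -/
def scale (L0 : ℝ) (n : ℕ) : ℝ := 2 ^ n * L0

/-- `d_n = L_n^{-β}`. -/
def dseq (L0 β : ℝ) (n : ℕ) : ℝ := scale L0 n ^ (-β)

/-- `σ_n = σ_{n-1} - 2γ_n`. -/
def sig (σ0 : ℝ) (γ : ℕ → ℝ) : ℕ → ℝ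
  | 0 => σ0
  | n + 1 => sig σ0 γ n - 2 * γ (n + 1)

/-- One Newton step `w - G_B P_B f(v(r) + w; Ω)` at the parameter `p = (r, Ω)`, where
`G_B` is the inverse of `P_B ∂_w f(v(r) + w; Ω) P_B`. -/
def newton (ω : ℝ) (B : Finset Site) (p : ℝ × ℝ) (w : Fn) : Fn := fun t θ =>
  w t θ - ∑ x : B,
    ((((jac ω p.2 (v ω p.1 + w) B)⁻¹ *ᵥ
      fun y : B => coef ω (f ω p.2 (v ω p.1 + w)) y) x : ℝ) : ℂ) * e0 ω x t θ

/-- The iterates `w_n(r, Ω)`, started at the initial approximation `w0`. -/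
def iter (ω L0 : ℝ) (w0 : ℝ × ℝ → Fn) : ℕ → ℝ × ℝ → Fn
  | 0 => w0
  | n + 1 => fun p => newton ω (ball (scale L0 (n + 1))) p (iter ω L0 w0 n p)

/-- The parameters `(r, Ω)` with `0 ≤ r < r₀` and `|Ω - Ω₀| < δ`. -/
def params (ω r0 δ : ℝ) : Set (ℝ × ℝ) := {p | 0 ≤ p.1 ∧ p.1 < r0 ∧ |p.2 - Omega0 ω| < δ}

/-- `w` lies in the range of `P_{B₀}`, has norm `‖w‖_{σ₀} < ρ`, and solves
`P_{B₀} f(v(r) + w; Ω) = 0`. -/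
structure IsInitial (ω L0 s σ0 ρ : ℝ) (p : ℝ × ℝ) (w : Fn) : Prop where
  range : proj ω (ball L0) w = w
  small : normH ω s σ0 w < ρ
  eqn : proj ω (ball L0) (f ω p.2 (v ω p.1 + w)) = 0

/-- The estimate `‖G_{B_n}‖_{σ_n} ≤ C γ_n⁻² / d_n` at the parameter `p`, where `G_{B_n}` is the
inverse (which is part of the assertion) of `P_{B_n} ∂_w f(v + w_{n-1}) P_{B_n}`. -/
def TameInverse (ω L0 s σ0 β C : ℝ) (γ : ℕ → ℝ) (w0 : ℝ × ℝ → Fn) (n : ℕ) (p : ℝ × ℝ) : Prop :=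
  let H := jac ω p.2 (v ω p.1 + iter ω L0 w0 (n - 1) p) (ball (scale L0 n))
  IsUnit H.det ∧ matNorm s (sig σ0 γ n) H⁻¹ ≤ C * ((γ n ^ 2)⁻¹ / dseq L0 β n)

/-- The range equation `P_{Λ\N} f(v(r) + w; Ω) = 0`: all components at sites outside `N` vanish. -/
def RangeEquation (ω : ℝ) (p : ℝ × ℝ) (w : Fn) : Prop :=
  ∀ x : Site, x ≠ siteN → coef ω (f ω p.2 (v ω p.1 + w)) x = 0

/-- Whitney smoothness over `K` of a family of elements of `h_σ`: it is the restriction to `K` of a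
`C^∞` map from the plane to `h_σ`. Here `h_σ` is identified isometrically with `ℓ²(Λ)` by the
weighted coefficients. -/
def WhitneySmoothOn (ω s σ : ℝ) (K : Set (ℝ × ℝ)) (w : ℝ × ℝ → Fn) : Prop :=
  ∃ W : ℝ × ℝ → lp (fun _ : Site => ℝ) 2, ContDiff ℝ (⊤ : ℕ∞) W ∧
    ∀ p ∈ K, ∀ x : Site, W p x = coef ω (w p) x * wt s σ x.j x.k

end VortexFilament

end

/-! A symmetric function has real coefficients `c_x`, and then `ū = ∑ c_x ē_x` is linear in them.
Letting `c_x`, `r` and `Ω` be complex in these formulas turns the equation into a holomorphic system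
`Fc` with Jacobian `Jc`, which agrees with the original one at real arguments.

Multiplication by `ē_x` acts on weighted absolutely summable Fourier coefficients with norm at most
`4 e^{σ|x|}`. In this operator algebra `ū²/(1+ū) = ū - 1 + (1+ū)⁻¹` is given by a Neumann resolvent.
This yields the quadratic Taylor remainder and the Lipschitz bound for the Jacobian, with nonlinear
constants independent of the truncation (`norm_Fc_remainder_le`, `norm_Jc_sub_le`).

On the smallest ball the linear part at `Ω₀` is diagonal. A vanishing eigenvalue forces `2(j²-k²)ω =
k⁴-j²`, which the diophantine condition rules out off the kernel site (`lam_ne_zero`). A contraction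
then solves the equation there, and the solution depends holomorphically on the parameters
(`exists_initial`).

The Newton increments, measured by `∑ |c_x| e^{σ_n|x|}`, have size `η τ_n` with `τ_n =
exp(-a(4/3)^n)`. The residual on the next ball has two sources. Inside the old ball it is quadratic
in the last increment. Outside, the drop from `σ_n` to `σ_{n+1}` gains `e^{-2γ_{n+1}|x|}` with `|x|
≥ L_n/2`. The growth condition forces `γ_n√L_n ≥ c > 0` (`exists_gamma_lower`), so this gain is at
least `exp(c'√L_{n+1})`. The base `4/3` lies below both `√2`, the rate of `√L_n`, and `2`, the rate
of quadratic convergence. The inverse bounds, the number of sites and the polynomial weights grow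
only exponentially in `n`, and the surplus absorbs them (`NewtonData.resid_succ`,
`NewtonData.step_le`, `NewtonData.good_succ`).

The tame estimate is known only at real parameters. By perturbation it extends to a complex
neighbourhood of radius `ε_n = exp(-D₁(n+1)²)` (`NewtonData.inverse_succ`), so every increment is
holomorphic there. Cutting the increments off and applying Cauchy estimates costs `ε_n^{-k}` for `k`
derivatives, which `τ_n` still beats; the extended series converges in `C^∞`
(`exists_smooth_extension`). At a fixed site the coefficient of `f` is Lipschitz in `ℓ¹`
(`exists_abs_coef_f_sub_le`), and the residuals tend to zero there, so the limit solves the range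
equation (`NewtonData.conclusion`). -/

noncomputable section

/-! ### Weighted Fourier sequences and their evaluation on the torus. -/

namespace VortexFilament

/-! ### Exponential weights -/

theorem len_eq_norm (a b : ℝ) : len a b = ‖(⟨a, b⟩ : ℂ)‖ := by
  rw [len, Complex.norm_def, Complex.normSq_mk, sq, sq]

theorem len_nonneg (a b : ℝ) : 0 ≤ len a b := Real.sqrt_nonneg _

theorem len_add_le (a b c d : ℝ) : len (a + c) (b + d) ≤ len a b + len c d := by
  have : (⟨a + c, b + d⟩ : ℂ) = ⟨a, b⟩ + ⟨c, d⟩ := rfl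
  simp only [len_eq_norm, this]
  exact norm_add_le _ _

/-- The weight `e^{σ|m|}` of a Fourier mode. -/
def mw (σ : ℝ) (m : ℤ × ℤ) : ℝ := Real.exp (σ * len m.1 m.2)

theorem mw_pos (σ : ℝ) (m : ℤ × ℤ) : 0 < mw σ m := Real.exp_pos _

theorem mw_ne (σ : ℝ) (m : ℤ × ℤ) : mw σ m ≠ 0 := (mw_pos σ m).ne'

theorem mw_zero (σ : ℝ) : mw σ 0 = 1 := by simp [mw, len]

theorem one_le_mw {σ : ℝ} (hσ : 0 ≤ σ) (m : ℤ × ℤ) : 1 ≤ mw σ m :=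
  Real.one_le_exp (mul_nonneg hσ (len_nonneg _ _))

theorem mw_add_le {σ : ℝ} (hσ : 0 ≤ σ) (m n : ℤ × ℤ) : mw σ (m + n) ≤ mw σ m * mw σ n := by
  rw [mw, mw, mw, ← Real.exp_add, ← mul_add]
  refine Real.exp_le_exp.2 (mul_le_mul_of_nonneg_left ?_ hσ)
  have := len_add_le m.1 m.2 n.1 n.2
  simpa using this

/-- This quotient is the factor by which multiplication by the mode `m` rescales a weighted Fourier
coefficient; the bound becomes the operator norm bound for `shift`. -/
theorem mw_div_le {σ : ℝ} (hσ : 0 ≤ σ) (m n : ℤ × ℤ) : mw σ n / mw σ (n - m) ≤ mw σ m := by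
  rw [div_le_iff₀ (mw_pos _ _)]
  simpa using mw_add_le hσ m (n - m)

/-! ### Summable sequences and weighted shifts -/

/-- The summable sequences on `ℤ²`. For the weight `σ`, the sequence `b` stands for the Fourier
coefficients `b m / e^{σ|m|}`. -/
abbrev Seq : Type := lp (fun _ : ℤ × ℤ => ℂ) 1

theorem Seq.summable_norm (b : Seq) : Summable fun n => ‖b n‖ := by
  have := lp.memℓp b
  rw [memℓp_gen_iff (by simp)] at this
  simpa using this

theorem Seq.norm_eq (b : Seq) : ‖b‖ = ∑' n, ‖b n‖ := by
  rw [lp.norm_eq_tsum_rpow (by simp)]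
  simp

theorem Seq.memℓp_of_summable {b : ℤ × ℤ → ℂ} (h : Summable fun n => ‖b n‖) : Memℓp b 1 := by
  rw [memℓp_gen_iff (by simp)]
  simpa using h

theorem Seq.norm_apply_le (b : Seq) (n : ℤ × ℤ) : ‖b n‖ ≤ ‖b‖ :=
  lp.norm_apply_le_norm (by simp) b n

theorem shift_term_le {σ : ℝ} (hσ : 0 ≤ σ) (m : ℤ × ℤ) (b : Seq) (n : ℤ × ℤ) :
    ‖((mw σ n / mw σ (n - m) : ℝ) : ℂ) * b (n - m)‖ ≤ mw σ m * ‖b (n - m)‖ := by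
  rw [norm_mul, Complex.norm_real, Real.norm_of_nonneg (div_pos (mw_pos _ _) (mw_pos _ _)).le]
  exact mul_le_mul_of_nonneg_right (mw_div_le hσ m n) (norm_nonneg _)

theorem summable_shift_bound (c : ℝ) (m : ℤ × ℤ) (b : Seq) :
    Summable fun n => c * ‖b (n - m)‖ :=
  (((Equiv.subRight m).summable_iff).2 b.summable_norm).mul_left c

/-- Multiplication by the Fourier mode `m`, acting on weighted coefficients. -/
def shift (σ : {σ : ℝ // 0 ≤ σ}) (m : ℤ × ℤ) : Seq →L[ℂ] Seq :=
  LinearMap.mkContinuous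
    { toFun := fun b => ⟨fun n => ((mw σ n / mw σ (n - m) : ℝ) : ℂ) * b (n - m),
        Seq.memℓp_of_summable ((summable_shift_bound _ m b).of_nonneg_of_le
          (fun _ => norm_nonneg _) (shift_term_le σ.2 m b))⟩
      map_add' := fun a b => by
        ext n
        simp only [lp.coeFn_add, Pi.add_apply]
        ring
      map_smul' := fun c b => by
        ext n
        simp only [lp.coeFn_smul, Pi.smul_apply, smul_eq_mul, RingHom.id_apply]
        ring }
    (mw σ m) fun b => by
      rw [Seq.norm_eq, Seq.norm_eq, ← (Equiv.subRight m).tsum_eq (fun n => ‖b n‖), ← tsum_mul_left]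
      exact Summable.tsum_le_tsum (shift_term_le σ.2 m b)
        ((summable_shift_bound _ m b).of_nonneg_of_le (fun _ => norm_nonneg _)
          (shift_term_le σ.2 m b)) (summable_shift_bound _ m b)

theorem shift_apply (σ : {σ : ℝ // 0 ≤ σ}) (m n : ℤ × ℤ) (b : Seq) :
    shift σ m b n = ((mw σ n / mw σ (n - m) : ℝ) : ℂ) * b (n - m) := rfl

theorem norm_shift_le (σ : {σ : ℝ // 0 ≤ σ}) (m : ℤ × ℤ) : ‖shift σ m‖ ≤ mw σ m :=
  LinearMap.mkContinuous_norm_le _ (mw_pos _ _).le _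

theorem shift_mul_shift (σ : {σ : ℝ // 0 ≤ σ}) (m n : ℤ × ℤ) :
    shift σ m * shift σ n = shift σ (m + n) := by
  ext b k
  simp only [mul_apply_eq_comp, shift_apply, sub_sub, ← mul_assoc]
  rw [← Complex.ofReal_mul, div_mul_div_cancel₀ (mw_ne _ _)]

/-- Commutativity passes to all multiplication operators built from shifts; the Taylor remainder in
`norm_res_remainder_le` depends on it. -/
theorem commute_shift (σ : {σ : ℝ // 0 ≤ σ}) (m n : ℤ × ℤ) :
    Commute (shift σ m) (shift σ n) := by
  rw [Commute, SemiconjBy, shift_mul_shift, shift_mul_shift, add_comm]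

/-- The unit of convolution. -/
def deltaZero : Seq := lp.single 1 (0 : ℤ × ℤ) (1 : ℂ)

theorem norm_deltaZero : ‖deltaZero‖ = 1 := by
  rw [deltaZero, lp.norm_single (by simp)]
  simp

/-! ### Evaluation on the torus -/

/-- The exponential `e^{i(m₁t + m₂θ)}`. -/
def mode (m : ℤ × ℤ) : Fn := fun t θ => Complex.exp (((m.1 * t + m.2 * θ : ℝ) : ℂ) * Complex.I)

theorem norm_mode (m : ℤ × ℤ) (t θ : ℝ) : ‖mode m t θ‖ = 1 := Complex.norm_exp_ofReal_mul_I _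

theorem mode_add (m n : ℤ × ℤ) (t θ : ℝ) : mode (m + n) t θ = mode m t θ * mode n t θ := by
  rw [mode, mode, mode, ← Complex.exp_add]
  congr 1
  push_cast [Prod.fst_add, Prod.snd_add]
  ring

theorem mode_zero (t θ : ℝ) : mode 0 t θ = 1 := by simp [mode]

theorem norm_eval_term_le {σ : ℝ} (hσ : 0 ≤ σ) (b : Seq) (t θ : ℝ) (n : ℤ × ℤ) :
    ‖b n / (mw σ n : ℂ) * mode n t θ‖ ≤ ‖b n‖ := by
  rw [norm_mul, norm_mode, mul_one, norm_div, Complex.norm_real,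
    Real.norm_of_nonneg (mw_pos _ _).le]
  exact div_le_self (norm_nonneg _) (one_le_mw hσ n)

theorem summable_eval {σ : ℝ} (hσ : 0 ≤ σ) (b : Seq) (t θ : ℝ) :
    Summable fun n => b n / (mw σ n : ℂ) * mode n t θ :=
  Summable.of_norm_bounded b.summable_norm (norm_eval_term_le hσ b t θ)

/-- The value at `(t, θ)` of the function with weighted Fourier coefficients `b`. -/
def evalAt (σ : {σ : ℝ // 0 ≤ σ}) (t θ : ℝ) : Seq →ₗ[ℂ] ℂ where
  toFun b := ∑' n, b n / (mw σ n : ℂ) * mode n t θ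
  map_add' a b := by
    rw [← (summable_eval σ.2 a t θ).tsum_add (summable_eval σ.2 b t θ)]
    refine tsum_congr fun n => ?_
    simp only [lp.coeFn_add, Pi.add_apply]
    ring
  map_smul' c b := by
    rw [RingHom.id_apply, smul_eq_mul, ← tsum_mul_left]
    refine tsum_congr fun n => ?_
    simp only [lp.coeFn_smul, Pi.smul_apply, smul_eq_mul]
    ring

theorem evalAt_apply (σ : {σ : ℝ // 0 ≤ σ}) (t θ : ℝ) (b : Seq) :
    evalAt σ t θ b = ∑' n, b n / (mw σ n : ℂ) * mode n t θ := rfl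

/-- Evaluation turns the operators into pointwise multiplication. This is how operator identities
become identities between functions. -/
theorem evalAt_shift (σ : {σ : ℝ // 0 ≤ σ}) (t θ : ℝ) (m : ℤ × ℤ) (b : Seq) :
    evalAt σ t θ (shift σ m b) = mode m t θ * evalAt σ t θ b := by
  rw [evalAt_apply, evalAt_apply, ← tsum_mul_left,
    ← (Equiv.subRight m).tsum_eq (fun n => mode m t θ * (b n / (mw σ n : ℂ) * mode n t θ))]
  refine tsum_congr fun n => ?_
  have h1 : ((mw σ n : ℝ) : ℂ) ≠ 0 := by exact_mod_cast mw_ne _ _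
  have h2 : ((mw σ (n - m) : ℝ) : ℂ) ≠ 0 := by exact_mod_cast mw_ne _ _
  have h3 : mode n t θ = mode m t θ * mode (n - m) t θ := by rw [← mode_add]; congr 1; abel
  simp only [shift_apply, Equiv.subRight_apply, h3]
  push_cast
  field_simp

theorem evalAt_deltaZero (σ : {σ : ℝ // 0 ≤ σ}) (t θ : ℝ) : evalAt σ t θ deltaZero = 1 := by
  rw [evalAt_apply, tsum_eq_single 0]
  · simp [deltaZero, mw_zero, mode_zero]
  · intro n hn
    simp [deltaZero, hn]

end VortexFilament

end

/-! ### Torus averages and the eigenvectors at `Ω₀`. -/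

noncomputable section

namespace VortexFilament

/-! ### Averages over the torus -/

/-- The average of a function over the torus. -/
def avg (g : Fn) : ℂ :=
  1 / (2 * (Real.pi : ℂ)) ^ 2 *
    ∫ t in (0 : ℝ)..2 * Real.pi, ∫ θ in (0 : ℝ)..2 * Real.pi, g t θ

/-- Joint continuity of a function of `t` and `θ`. -/
def JointCont (g : Fn) : Prop := Continuous fun q : ℝ × ℝ => g q.1 q.2

theorem ip_eq_avg (u v : Fn) : ip u v = avg fun t θ => u t θ * (starRingEnd ℂ) (v t θ) := rfl

theorem JointCont.continuous_snd {g : Fn} (hg : JointCont g) (t : ℝ) : Continuous (g t) :=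
  Continuous.comp (f := fun θ : ℝ => (t, θ)) hg (by fun_prop)

theorem JointCont.continuous_integral {g : Fn} (hg : JointCont g) :
    Continuous fun t => ∫ θ in (0 : ℝ)..2 * Real.pi, g t θ :=
  intervalIntegral.continuous_parametric_intervalIntegral_of_continuous' hg _ _

theorem JointCont.mul {g h : Fn} (hg : JointCont g) (hh : JointCont h) :
    JointCont fun t θ => g t θ * h t θ := Continuous.mul hg hh

theorem JointCont.conj {g : Fn} (hg : JointCont g) :
    JointCont fun t θ => (starRingEnd ℂ) (g t θ) := Complex.continuous_conj.comp hg

theorem norm_integral_inner_le {g : Fn} {C : ℝ} (h : ∀ t θ, ‖g t θ‖ ≤ C) (t : ℝ) :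
    ‖∫ θ in (0 : ℝ)..2 * Real.pi, g t θ‖ ≤ C * (2 * Real.pi) := by
  have := intervalIntegral.norm_integral_le_of_norm_le_const (a := 0) (b := 2 * Real.pi)
    (f := g t) (C := C) fun θ _ => h t θ
  rwa [sub_zero, abs_of_pos Real.two_pi_pos] at this

theorem norm_avg_le {g : Fn} {C : ℝ} (h : ∀ t θ, ‖g t θ‖ ≤ C) : ‖avg g‖ ≤ C := by
  have h1 := intervalIntegral.norm_integral_le_of_norm_le_const (a := 0) (b := 2 * Real.pi)
    (f := fun t => ∫ θ in (0 : ℝ)..2 * Real.pi, g t θ) (C := C * (2 * Real.pi))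
    fun t _ => norm_integral_inner_le h t
  rw [sub_zero, abs_of_pos Real.two_pi_pos] at h1
  rw [avg, norm_mul]
  have h2 : ‖(1 / (2 * (Real.pi : ℂ)) ^ 2)‖ = 1 / (2 * Real.pi) ^ 2 := by
    simp [abs_of_pos Real.pi_pos]
  rw [h2, one_div_mul_eq_div, div_le_iff₀ (by positivity)]
  calc _ ≤ _ := h1
    _ = _ := by ring

/-- Dominated convergence is applied twice, to the inner and to the outer integral, with the
constants `C i` as majorants. -/
theorem hasSum_avg {ι : Type*} [Countable ι] {g : ι → Fn} {C : ι → ℝ}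
    (hg : ∀ i, JointCont (g i)) (hC : Summable C) (hb : ∀ i t θ, ‖g i t θ‖ ≤ C i) :
    HasSum (fun i => avg (g i)) (avg fun t θ => ∑' i, g i t θ) := by
  refine HasSum.mul_left _ ?_
  refine intervalIntegral.hasSum_integral_of_dominated_convergence
    (fun i _ => C i * (2 * Real.pi)) (fun i => (hg i).continuous_integral.aestronglyMeasurable)
    (fun i => Filter.Eventually.of_forall fun t _ => norm_integral_inner_le (hb i) t)
    (Filter.Eventually.of_forall fun t _ => hC.mul_right _) ?_
    (Filter.Eventually.of_forall fun t _ => ?_)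
  · simp
  · refine intervalIntegral.hasSum_integral_of_dominated_convergence
      (fun i _ => C i) (fun i => ((hg i).continuous_snd t).aestronglyMeasurable)
      (fun i => Filter.Eventually.of_forall fun θ _ => hb i t θ)
      (Filter.Eventually.of_forall fun θ _ => hC) (by simp)
      (Filter.Eventually.of_forall fun θ _ => ?_)
    exact (Summable.of_norm_bounded hC fun i => hb i t θ).hasSum

theorem avg_const_mul (c : ℂ) (g : Fn) : avg (fun t θ => c * g t θ) = c * avg g := by
  simp only [avg, intervalIntegral.integral_const_mul]
  ring

theorem JointCont.integrable_inner {g : Fn} (hg : JointCont g) (t : ℝ) :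
    IntervalIntegrable (g t) MeasureTheory.volume 0 (2 * Real.pi) :=
  (hg.continuous_snd t).intervalIntegrable _ _

theorem avg_sum {ι : Type*} (s : Finset ι) {g : ι → Fn} (hg : ∀ i, JointCont (g i)) :
    avg (fun t θ => ∑ i ∈ s, g i t θ) = ∑ i ∈ s, avg (g i) := by
  simp only [avg, ← Finset.mul_sum]
  congr 1
  rw [← intervalIntegral.integral_finsetSum
    fun i _ => (hg i).continuous_integral.intervalIntegrable _ _]
  refine intervalIntegral.integral_congr fun t _ => ?_
  exact intervalIntegral.integral_finsetSum fun i _ => (hg i).integrable_inner t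

theorem avg_add {g h : Fn} (hg : JointCont g) (hh : JointCont h) :
    avg (fun t θ => g t θ + h t θ) = avg g + avg h := by
  simp only [avg, ← mul_add]
  congr 1
  rw [← intervalIntegral.integral_add (hg.continuous_integral.intervalIntegrable _ _)
    (hh.continuous_integral.intervalIntegrable _ _)]
  refine intervalIntegral.integral_congr fun t _ => ?_
  exact intervalIntegral.integral_add (hg.integrable_inner t) (hh.integrable_inner t)

theorem integral_exp_int_mul (a : ℤ) :
    ∫ t in (0 : ℝ)..2 * Real.pi, Complex.exp ((a : ℂ) * Complex.I * t)
      = if a = 0 then 2 * (Real.pi : ℂ) else 0 := by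
  split_ifs with h
  · simp [h]
  · have hc : (a : ℂ) * Complex.I ≠ 0 := by simp [h]
    rw [integral_exp_mul_complex hc]
    have : (a : ℂ) * Complex.I * ((2 * Real.pi : ℝ) : ℂ) = a * (2 * Real.pi * Complex.I) := by
      push_cast; ring
    rw [this, Complex.exp_int_mul_two_pi_mul_I]
    simp

theorem mode_eq_mul (m : ℤ × ℤ) (t θ : ℝ) :
    mode m t θ = Complex.exp ((m.1 : ℂ) * Complex.I * t) * Complex.exp ((m.2 : ℂ) * Complex.I * θ) := by
  rw [mode, ← Complex.exp_add]
  congr 1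
  push_cast
  ring

theorem avg_mode (m : ℤ × ℤ) : avg (mode m) = if m = 0 then 1 else 0 := by
  simp only [avg, mode_eq_mul, intervalIntegral.integral_const_mul,
    intervalIntegral.integral_mul_const, integral_exp_int_mul]
  have hp : (Real.pi : ℂ) ≠ 0 := by exact_mod_cast Real.pi_ne_zero
  have hm : m = 0 ↔ m.1 = 0 ∧ m.2 = 0 := Prod.ext_iff
  by_cases h1 : m.1 = 0 <;> by_cases h2 : m.2 = 0 <;> simp [h1, h2, hm]
  field_simp

theorem jointCont_mode (m : ℤ × ℤ) : JointCont (mode m) := by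
  unfold JointCont mode
  fun_prop

theorem conj_mode (m : ℤ × ℤ) (t θ : ℝ) : (starRingEnd ℂ) (mode m t θ) = mode (-m) t θ := by
  rw [mode, mode, ← Complex.exp_conj]
  congr 1
  simp only [map_mul, Complex.conj_ofReal, Complex.conj_I, Prod.fst_neg, Prod.snd_neg]
  push_cast
  ring

/-! ### The eigenbasis -/

variable {ω : ℝ}

theorem Omega0_pos (hω : 0 < ω) : 0 < Omega0 ω := Real.sqrt_pos.2 (by linarith)

theorem sq_Omega0 (hω : 0 < ω) : Omega0 ω ^ 2 = 1 + 2 * ω := Real.sq_sqrt (by linarith)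

theorem Site.l_eq_one_or (x : Site) : x.l = 1 ∨ x.l = -1 := Int.units_eq_one_or _

theorem Site.l_of_j_eq_zero (x : Site) (h : x.j = 0) : x.l = 1 := x.2 h

theorem Site.ext {x y : Site} (h1 : x.j = y.j) (h2 : x.k = y.k) (h3 : x.l = y.l) : x = y :=
  Subtype.ext (Prod.ext h1 (Prod.ext h2 h3))

theorem Site.l_sq (x : Site) : (((x.l : ℤ) : ℝ)) ^ 2 = 1 := by
  rcases x.l_eq_one_or with h | h <;> simp [h]

theorem sq_rad (Ω : ℝ) (x : Site) : rad ω Ω x ^ 2 = (x.j : ℝ) ^ 2 * Ω ^ 2 + ω ^ 2 :=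
  Real.sq_sqrt (by positivity)

theorem rad_of_j_eq_zero (hω : 0 < ω) (Ω : ℝ) {x : Site} (h : x.j = 0) : rad ω Ω x = ω := by
  simp [rad, h, Real.sqrt_sq hω.le]

/-- The numerator `ω + l √(j²Ω² + ω²)` of the first component, the part of the eigenvalue that
does not depend on `k`. -/
def mu (ω Ω : ℝ) (x : Site) : ℝ := ω + ((x.l : ℤ) : ℝ) * rad ω Ω x

/-- On the real amplitudes `(a, b)` the part of `L(Ω)` that does not involve `k` is the symmetric
matrix with rows `(2ω, jΩ)` and `(jΩ, 0)`. This is its characteristic equation. -/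
theorem sq_mu (Ω : ℝ) (x : Site) : mu ω Ω x ^ 2 = 2 * ω * mu ω Ω x + (x.j * Ω) ^ 2 := by
  have h1 := sq_rad (ω := ω) Ω x
  have h2 := x.l_sq
  have h3 : mu ω Ω x ^ 2 = ω ^ 2 + 2 * ω * (((x.l : ℤ) : ℝ) * rad ω Ω x)
      + ((x.l : ℤ) : ℝ) ^ 2 * rad ω Ω x ^ 2 := by rw [mu]; ring
  rw [h3, h1, h2, mu]
  ring

/-- For `j = 0` the sign `l = -1` would give the zero vector; `Λ` admits only `l = 1` there, and
then `μ = 2ω`. -/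
theorem normSq_pos (hω : 0 < ω) {Ω : ℝ} (hΩ : 0 < Ω) (x : Site) :
    0 < mu ω Ω x ^ 2 + (x.j * Ω) ^ 2 := by
  rcases Nat.eq_zero_or_pos x.j with h | h
  · have : mu ω Ω x = 2 * ω := by
      rw [mu, rad_of_j_eq_zero hω Ω h, x.l_of_j_eq_zero h]
      push_cast
      ring
    rw [this]
    positivity
  · positivity

theorem sq_vecNorm (Ω : ℝ) (x : Site) : vecNorm ω Ω x ^ 2 = mu ω Ω x ^ 2 + (x.j * Ω) ^ 2 := by
  have h0 : mu ω Ω x ^ 2 + (x.j * Ω) ^ 2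
      = 2 * (ω ^ 2 + (x.j : ℝ) ^ 2 * Ω ^ 2 + ((x.l : ℤ) : ℝ) * ω * rad ω Ω x) := by
    rw [sq_mu, mu]
    ring
  have h1 : 0 ≤ ω ^ 2 + (x.j : ℝ) ^ 2 * Ω ^ 2 + ((x.l : ℤ) : ℝ) * ω * rad ω Ω x := by
    have : 0 ≤ mu ω Ω x ^ 2 + (x.j * Ω) ^ 2 := by positivity
    linarith
  rw [vecNorm, mul_pow, Real.sq_sqrt h1, Real.sq_sqrt zero_le_two, h0]

theorem vecNorm_pos (hω : 0 < ω) {Ω : ℝ} (hΩ : 0 < Ω) (x : Site) : 0 < vecNorm ω Ω x := by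
  have h := normSq_pos hω hΩ x
  rw [← sq_vecNorm] at h
  exact lt_of_le_of_ne (by unfold vecNorm; positivity) fun h0 => by simp [← h0] at h

/-- The components of the normalized eigenvectors at `Ω₀`. -/
def vA (ω : ℝ) (x : Site) : ℝ := vecA ω (Omega0 ω) x

def vB (ω : ℝ) (x : Site) : ℝ := vecB ω (Omega0 ω) x

theorem sq_vA_add_sq_vB (hω : 0 < ω) (x : Site) : vA ω x ^ 2 + vB ω x ^ 2 = 1 := by
  have h := vecNorm_pos hω (Omega0_pos hω) x
  rw [vA, vB, vecA, vecB, div_pow, div_pow, ← add_div, div_eq_one_iff_eq (pow_ne_zero 2 h.ne'),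
    sq_vecNorm]
  rfl

theorem abs_vA_le (hω : 0 < ω) (x : Site) : |vA ω x| ≤ 1 :=
  (sq_le_one_iff_abs_le_one _).1 (by nlinarith [sq_vA_add_sq_vB hω x, sq_nonneg (vB ω x)])

theorem abs_vB_le (hω : 0 < ω) (x : Site) : |vB ω x| ≤ 1 :=
  (sq_le_one_iff_abs_le_one _).1 (by nlinarith [sq_vA_add_sq_vB hω x, sq_nonneg (vA ω x)])

theorem vB_of_j_eq_zero {x : Site} (h : x.j = 0) : vB ω x = 0 := by simp [vB, vecB, h]

/-- Two sites with the same modes but different `l` have orthogonal eigenvectors. -/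
theorem vA_mul_add_vB_mul {x y : Site} (hj : x.j = y.j) (hl : x.l ≠ y.l) :
    vA ω x * vA ω y + vB ω x * vB ω y = 0 := by
  have hr : rad ω (Omega0 ω) y = rad ω (Omega0 ω) x := by rw [rad, rad, hj]
  have h1 : ((y.l : ℤ) : ℝ) = -((x.l : ℤ) : ℝ) := by
    rcases x.l_eq_one_or with h | h <;> rcases y.l_eq_one_or with h' | h' <;>
      simp_all
  have h2 := sq_rad (ω := ω) (Omega0 ω) x
  have h3 := x.l_sq
  rw [vA, vA, vB, vB, vecA, vecA, vecB, vecB, hr, h1, ← hj, div_mul_div_comm, div_mul_div_comm,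
    ← add_div]
  refine div_eq_zero_iff.2 (Or.inl ?_)
  have : (ω + ((x.l : ℤ) : ℝ) * rad ω (Omega0 ω) x) * (ω + -((x.l : ℤ) : ℝ) * rad ω (Omega0 ω) x)
      = ω ^ 2 - ((x.l : ℤ) : ℝ) ^ 2 * rad ω (Omega0 ω) x ^ 2 := by ring
  rw [this, h2, h3]
  ring

/-- Clearing the normalization leaves the characteristic equation `sq_mu`. The second row of the
eigenvector equation, `mu_mul_vB`, holds by the very form of the vector. -/
theorem mu_mul_vA (hω : 0 < ω) (x : Site) :
    mu ω (Omega0 ω) x * vA ω x = 2 * ω * vA ω x + x.j * Omega0 ω * vB ω x := by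
  have h := (vecNorm_pos hω (Omega0_pos hω) x).ne'
  rw [vA, vB, vecA, vecB]
  field_simp
  have := sq_mu (ω := ω) (Omega0 ω) x
  rw [mu] at this ⊢
  linear_combination this

theorem mu_mul_vB (x : Site) :
    mu ω (Omega0 ω) x * vB ω x = x.j * Omega0 ω * vA ω x := by
  rw [vA, vB, vecA, vecB, mu]
  ring

theorem amp_pos (x : Site) : 0 < amp x := by
  unfold amp
  split_ifs <;> positivity

theorem amp_le_two (x : Site) : amp x ≤ 2 := by
  have h2 : √2 * √2 = (2 : ℝ) := Real.mul_self_sqrt (by norm_num)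
  have h3 : (0 : ℝ) ≤ √2 := Real.sqrt_nonneg _
  unfold amp
  split_ifs <;> nlinarith

/-- Pairs of signs index the Fourier modes of an eigenfunction. -/
abbrev Sgn := ℤˣ × ℤˣ

/-- The four modes coincide in pairs when `j` or `k` vanishes. Sums over signs then count a mode
with multiplicity. -/
def smode (x : Site) (s : Sgn) : ℤ × ℤ := ((s.1 : ℤ) * x.j, (s.2 : ℤ) * x.k)

/-- The function `amp x * (a cos jt + i b sin jt) cos kθ`. -/
def trig (x : Site) (a b : ℝ) : Fn := fun t θ =>
  (amp x : ℂ) * ((a * Real.cos (x.j * t) : ℝ)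
      + Complex.I * (b * Real.sin (x.j * t) : ℝ)) * (Real.cos (x.k * θ) : ℝ)

theorem e0_eq_trig (ω : ℝ) (x : Site) : e0 ω x = trig x (vA ω x) (vB ω x) := rfl

/-- The Fourier coefficients of `trig x a b`. -/
def tcf (x : Site) (a b : ℝ) (s : Sgn) : ℝ := amp x * (a + ((s.1 : ℤ) : ℝ) * b) / 4

theorem sum_sgn {M : Type*} [AddCommMonoid M] (g : Sgn → M) :
    ∑ s, g s = g (1, 1) + g (1, -1) + (g (-1, 1) + g (-1, -1)) := by
  have h : ∀ g : ℤˣ → M, ∑ s, g s = g 1 + g (-1) := fun g => by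
    rw [UnitsInt.univ, Finset.sum_pair (by decide)]
  rw [Fintype.sum_prod_type, h, h, h]

theorem trig_eq_sum (x : Site) (a b : ℝ) (t θ : ℝ) :
    trig x a b t θ = ∑ s, (tcf x a b s : ℂ) * mode (smode x s) t θ := by
  have h1 : ((Real.cos (x.j * t) : ℝ) : ℂ) = (Complex.exp ((x.j * t : ℂ) * Complex.I)
      + Complex.exp (-(x.j * t : ℂ) * Complex.I)) / 2 := by
    rw [Complex.ofReal_cos, Complex.cos]; push_cast; rfl
  have h2 : ((Real.sin (x.j * t) : ℝ) : ℂ) = (Complex.exp (-(x.j * t : ℂ) * Complex.I)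
      - Complex.exp ((x.j * t : ℂ) * Complex.I)) * Complex.I / 2 := by
    rw [Complex.ofReal_sin, Complex.sin]; push_cast; rfl
  have h3 : ((Real.cos (x.k * θ) : ℝ) : ℂ) = (Complex.exp ((x.k * θ : ℂ) * Complex.I)
      + Complex.exp (-(x.k * θ : ℂ) * Complex.I)) / 2 := by
    rw [Complex.ofReal_cos, Complex.cos]; push_cast; rfl
  have hm : ∀ s : Sgn, mode (smode x s) t θ = Complex.exp (((s.1 : ℤ) : ℂ) * (x.j * t : ℂ) * Complex.I)
      * Complex.exp (((s.2 : ℤ) : ℂ) * (x.k * θ : ℂ) * Complex.I) := by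
    intro s
    rw [mode_eq_mul, smode]
    push_cast
    congr 2 <;> ring
  rw [sum_sgn]
  simp only [hm, tcf, trig]
  push_cast
  simp only [one_mul, neg_mul] at *
  rw [← Complex.ofReal_natCast, ← Complex.ofReal_natCast] at *
  push_cast at *
  rw [h1, h2, h3]
  have hI := Complex.I_mul_I
  linear_combination (exp := 1) ((amp x : ℂ) * (b : ℂ) * (Complex.exp (-((x.j : ℂ) * t * Complex.I))
      - Complex.exp ((x.j : ℂ) * t * Complex.I)) / 2 * (Complex.exp ((x.k * θ : ℂ) * Complex.I)
      + Complex.exp (-((x.k * θ : ℂ) * Complex.I))) / 2) * hI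

end VortexFilament

end

/-! ### Orthonormality of the eigenbasis and the matrix of `L(Ω)`. -/

noncomputable section

namespace VortexFilament

variable {ω : ℝ}

theorem abs_sgn (s : ℤˣ) : |((s : ℤ) : ℝ)| = 1 := by
  rcases Int.units_eq_one_or s with h | h <;> simp [h]

theorem abs_tcf_le (x : Site) {a b : ℝ} (s : Sgn) : |tcf x a b s| ≤ (|a| + |b|) / 2 := by
  have h1 : |a + ((s.1 : ℤ) : ℝ) * b| ≤ |a| + |b| := by
    refine (abs_add_le _ _).trans ?_
    rw [abs_mul, abs_sgn, one_mul]
  have h2 := amp_le_two x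
  have h3 := amp_pos x
  rw [tcf, abs_div, abs_mul, abs_of_pos h3, abs_of_pos (by norm_num : (0 : ℝ) < 4)]
  have : amp x * |a + ((s.1 : ℤ) : ℝ) * b| ≤ 2 * (|a| + |b|) :=
    mul_le_mul h2 h1 (abs_nonneg _) zero_le_two
  linarith

theorem jointCont_trig (x : Site) (a b : ℝ) : JointCont (trig x a b) := by
  unfold JointCont trig
  fun_prop

theorem norm_trig_le (x : Site) (a b t θ : ℝ) : ‖trig x a b t θ‖ ≤ 2 * (|a| + |b|) := by
  rw [trig_eq_sum]
  refine (norm_sum_le _ _).trans ?_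
  calc _ ≤ ∑ _s : Sgn, (|a| + |b|) / 2 := Finset.sum_le_sum fun s _ => by
        rw [norm_mul, norm_mode, mul_one, Complex.norm_real, Real.norm_eq_abs]
        exact abs_tcf_le x s
    _ = _ := by
        rw [sum_sgn]
        ring

theorem jointCont_e0 (x : Site) : JointCont (e0 ω x) := jointCont_trig _ _ _

theorem norm_e0_le (hω : 0 < ω) (x : Site) (t θ : ℝ) : ‖e0 ω x t θ‖ ≤ 4 := by
  refine (norm_trig_le _ _ _ _ _).trans ?_
  have h1 : |vecA ω (Omega0 ω) x| ≤ 1 := abs_vA_le hω x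
  have h2 : |vecB ω (Omega0 ω) x| ≤ 1 := abs_vB_le hω x
  linarith

/-- The Fourier coefficients of `e_x`. -/
def cf (ω : ℝ) (x : Site) (s : Sgn) : ℝ := tcf x (vA ω x) (vB ω x) s

theorem abs_cf_le (hω : 0 < ω) (x : Site) (s : Sgn) : |cf ω x s| ≤ 1 := by
  refine (abs_tcf_le x s).trans ?_
  linarith [abs_vA_le hω x, abs_vB_le hω x]

theorem conj_e0 (x : Site) (t θ : ℝ) : (starRingEnd ℂ) (e0 ω x t θ)
    = ∑ s, (cf ω x s : ℂ) * mode (-smode x s) t θ := by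
  rw [e0_eq_trig, trig_eq_sum, map_sum]
  refine Finset.sum_congr rfl fun s _ => ?_
  rw [map_mul, Complex.conj_ofReal, conj_mode]
  rfl

theorem ip_mode_e0 (m : ℤ × ℤ) (x : Site) :
    ip (mode m) (e0 ω x) = ∑ s, if m = smode x s then (cf ω x s : ℂ) else 0 := by
  rw [ip_eq_avg]
  have : (fun t θ => mode m t θ * (starRingEnd ℂ) (e0 ω x t θ))
      = fun t θ => ∑ s, (cf ω x s : ℂ) * mode (m - smode x s) t θ := by
    funext t θ
    rw [conj_e0, Finset.mul_sum]
    refine Finset.sum_congr rfl fun s _ => ?_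
    rw [sub_eq_add_neg, mode_add]
    ring
  rw [this, avg_sum]
  · refine Finset.sum_congr rfl fun s _ => ?_
    rw [avg_const_mul, avg_mode]
    simp only [sub_eq_zero, mul_ite, mul_one, mul_zero]
  · intro s
    exact Continuous.mul continuous_const (jointCont_mode _)

theorem ip_sum_left {ι : Type*} (s : Finset ι) (c : ι → ℂ) {g : ι → Fn}
    (hg : ∀ i, JointCont (g i)) (x : Site) :
    ip (fun t θ => ∑ i ∈ s, c i * g i t θ) (e0 ω x) = ∑ i ∈ s, c i * ip (g i) (e0 ω x) := by
  simp only [ip_eq_avg, ← avg_const_mul]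
  rw [← avg_sum]
  · congr 1
    funext t θ
    rw [Finset.sum_mul]
    exact Finset.sum_congr rfl fun i _ => by ring
  · intro i
    exact Continuous.mul continuous_const ((hg i).mul (jointCont_e0 x).conj)

theorem smode_eq_iff {x y : Site} {s s' : Sgn} :
    smode y s' = smode x s ↔ ((s'.1 : ℤ) * y.j = (s.1 : ℤ) * x.j) ∧
      ((s'.2 : ℤ) * y.k = (s.2 : ℤ) * x.k) := Prod.ext_iff

theorem eq_of_sgn_mul_eq {a b : ℕ} {s s' : ℤˣ} (h : (s : ℤ) * a = (s' : ℤ) * b) : a = b := by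
  have := congrArg Int.natAbs h
  simpa [Int.natAbs_mul] using this

theorem ip_trig_e0 (x y : Site) (a b : ℝ) :
    ip (trig y a b) (e0 ω x)
      = if x.j = y.j ∧ x.k = y.k then ((a * vA ω x + b * vB ω x : ℝ) : ℂ) else 0 := by
  have h0 : trig y a b = fun t θ => ∑ s, (tcf y a b s : ℂ) * mode (smode y s) t θ := by
    funext t θ
    exact trig_eq_sum y a b t θ
  rw [h0, ip_sum_left _ _ fun s => jointCont_mode _]
  simp only [ip_mode_e0]
  split_ifs with h
  · obtain ⟨hj, hk⟩ := h
    have h2 : √2 * √2 = (2 : ℝ) := Real.mul_self_sqrt (by norm_num)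
    have ha : amp y = amp x := by rw [amp, amp, hj, hk]
    have key : ∑ s, tcf y a b s * (∑ s', if smode y s = smode x s' then cf ω x s' else 0)
        = a * vA ω x + b * vB ω x := by
      simp only [sum_sgn, smode_eq_iff, ← hj, ← hk, cf, tcf, ha]
      -- Modes of different signs coincide when `j = 0` or `k = 0`, and `amp` compensates for the
      -- multiplicity, so each case has its own count. For `j = 0` the factor `vB ω x` is zero.
      by_cases hj0 : x.j = 0 <;> by_cases hk0 : x.k = 0 <;>
        simp [hj0, hk0, self_eq_neg, neg_eq_self, amp] <;>
        try rw [vB_of_j_eq_zero hj0]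
      · ring
      · linear_combination (a * vA ω x / 2) * h2
      · linear_combination ((a * vA ω x + b * vB ω x) / 2) * h2
      · ring
    rw [← key]
    push_cast
    simp only [apply_ite Complex.ofReal, Complex.ofReal_zero]
  · refine Finset.sum_eq_zero fun s _ => ?_
    rw [Finset.sum_eq_zero, mul_zero]
    intro s' _
    rw [if_neg]
    intro he
    rw [smode_eq_iff] at he
    exact h ⟨(eq_of_sgn_mul_eq he.1).symm, (eq_of_sgn_mul_eq he.2).symm⟩

theorem ip_e0_e0 (hω : 0 < ω) (x y : Site) :
    ip (e0 ω y) (e0 ω x) = if x = y then 1 else 0 := by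
  rw [e0_eq_trig ω y, ip_trig_e0]
  by_cases hxy : x = y
  · subst hxy
    have := sq_vA_add_sq_vB hω x
    rw [if_pos ⟨rfl, rfl⟩, if_pos rfl, ← sq, ← sq, this, Complex.ofReal_one]
  · rw [if_neg hxy]
    split_ifs with h
    · have hl : y.l ≠ x.l := fun hl => hxy (Site.ext h.1 h.2 hl.symm)
      rw [vA_mul_add_vB_mul h.1.symm hl, Complex.ofReal_zero]
    · rfl

/-! ### The linear part -/

/-- The eigenvalues of `L(Ω₀)`. -/
def lam (ω : ℝ) (x : Site) : ℝ := (x.k : ℝ) ^ 2 + mu ω (Omega0 ω) x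

/-- The matrix of the derivative of `L(Ω)` in `Ω`. -/
def cpl (ω : ℝ) (x y : Site) : ℝ :=
  if x.j = y.j ∧ x.k = y.k then y.j * (vB ω y * vA ω x + vA ω y * vB ω x) else 0

/-- The matrix of `L(Ω)` in the basis `e_x`. -/
def Lc (ω : ℝ) (Ω : ℂ) (x y : Site) : ℂ :=
  (if x = y then (lam ω y : ℂ) else 0) + (Ω - Omega0 ω) * cpl ω x y

theorem hasDerivAt_trig_t (x : Site) (a b t θ : ℝ) :
    HasDerivAt (fun t' => trig x a b t' θ) (Complex.I * trig x (x.j * b) (x.j * a) t θ) t := by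
  have h0 : HasDerivAt (fun t' : ℝ => x.j * t') (x.j : ℝ) t := by
    simpa using (hasDerivAt_id t).const_mul (x.j : ℝ)
  have h1 := ((h0.cos.const_mul a).ofReal_comp)
  have h2 := ((h0.sin.const_mul b).ofReal_comp)
  have h3 := (((h1.add (h2.const_mul Complex.I)).const_mul (amp x : ℂ)).mul_const
    ((Real.cos (x.k * θ) : ℝ) : ℂ))
  refine h3.congr_deriv ?_
  rw [trig]
  push_cast
  linear_combination (-(amp x : ℂ) * Complex.sin (x.j * t) * (x.j * a) * Complex.cos (x.k * θ))
    * Complex.I_mul_I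

theorem hasDerivAt_trig_θ (x : Site) (a b t θ : ℝ) :
    HasDerivAt (fun θ' => trig x a b t θ') (-(x.k : ℂ) * ((amp x : ℂ) * ((a * Real.cos (x.j * t) : ℝ)
      + Complex.I * (b * Real.sin (x.j * t) : ℝ)) * (Real.sin (x.k * θ) : ℝ))) θ := by
  have h0 : HasDerivAt (fun t' : ℝ => x.k * t') (x.k : ℝ) θ := by
    simpa using (hasDerivAt_id θ).const_mul (x.k : ℝ)
  have h3 := ((h0.cos.ofReal_comp).const_mul ((amp x : ℂ) * ((a * Real.cos (x.j * t) : ℝ)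
      + Complex.I * (b * Real.sin (x.j * t) : ℝ))))
  refine h3.congr_deriv ?_
  push_cast
  ring

theorem hasDerivAt_trig_θθ (x : Site) (a b t θ : ℝ) :
    HasDerivAt (fun θ' => -(x.k : ℂ) * ((amp x : ℂ) * ((a * Real.cos (x.j * t) : ℝ)
      + Complex.I * (b * Real.sin (x.j * t) : ℝ)) * (Real.sin (x.k * θ') : ℝ)))
      (-(x.k : ℂ) ^ 2 * trig x a b t θ) θ := by
  have h0 : HasDerivAt (fun t' : ℝ => x.k * t') (x.k : ℝ) θ := by
    simpa using (hasDerivAt_id θ).const_mul (x.k : ℝ)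
  have h3 := ((h0.sin.ofReal_comp).const_mul ((amp x : ℂ) * ((a * Real.cos (x.j * t) : ℝ)
      + Complex.I * (b * Real.sin (x.j * t) : ℝ)))).const_mul (-(x.k : ℂ))
  refine h3.congr_deriv ?_
  rw [trig]
  push_cast
  ring

theorem norm_trig_sin_le (x : Site) (a b t θ : ℝ) :
    ‖(amp x : ℂ) * ((a * Real.cos (x.j * t) : ℝ)
      + Complex.I * (b * Real.sin (x.j * t) : ℝ)) * (Real.sin (x.k * θ) : ℝ)‖
        ≤ 2 * (|a| + |b|) := by
  rw [norm_mul, norm_mul, Complex.norm_real, Complex.norm_real, Real.norm_of_nonneg (amp_pos x).le]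
  have h1 : ‖((a * Real.cos (x.j * t) : ℝ) : ℂ) + Complex.I * (b * Real.sin (x.j * t) : ℝ)‖
      ≤ |a| + |b| := by
    refine (norm_add_le _ _).trans ?_
    rw [norm_mul, Complex.norm_I, one_mul, Complex.norm_real, Complex.norm_real, norm_mul, norm_mul]
    exact add_le_add (mul_le_of_le_one_right (abs_nonneg _) (Real.abs_cos_le_one _))
      (mul_le_of_le_one_right (abs_nonneg _) (Real.abs_sin_le_one _))
  calc _ ≤ 2 * (|a| + |b|) * 1 := by
        refine mul_le_mul (mul_le_mul (amp_le_two x) h1 (norm_nonneg _) zero_le_two)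
          (Real.abs_sin_le_one _) (norm_nonneg _) (by positivity)
    _ = _ := mul_one _

theorem iteratedDeriv_two_trig (x : Site) (a b t θ : ℝ) :
    iteratedDeriv 2 (fun θ' => trig x a b t θ') θ = -(x.k : ℂ) ^ 2 * trig x a b t θ := by
  rw [iteratedDeriv_succ, iteratedDeriv_one]
  have : deriv (fun θ' => trig x a b t θ') = _ :=
    funext fun θ' => (hasDerivAt_trig_θ x a b t θ').deriv
  rw [this, (hasDerivAt_trig_θθ x a b t θ).deriv]

theorem conj_trig (x : Site) (a b t θ : ℝ) :
    (starRingEnd ℂ) (trig x a b t θ) = trig x a (-b) t θ := by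
  simp only [trig, map_mul, map_add, Complex.conj_ofReal, Complex.conj_I]
  push_cast
  ring

/-- Conjugation flips the sign of `b`, so `ω(u + ū)` contributes `2ω` to the first amplitude only;
the time derivative exchanges the two amplitudes. -/
theorem linOp_trig (Ω : ℝ) (x : Site) (a b : ℝ) :
    linOp ω Ω (trig x a b) = trig x (Ω * x.j * b + x.k ^ 2 * a + 2 * ω * a)
      (Ω * x.j * a + x.k ^ 2 * b) := by
  funext t θ
  rw [linOp, (hasDerivAt_trig_t x a b t θ).deriv, iteratedDeriv_two_trig, conj_trig]
  simp only [trig]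
  push_cast
  linear_combination (-(Ω : ℂ) * (amp x : ℂ) * (x.j * b * Complex.cos (x.j * t) + Complex.I *
    (x.j * a * Complex.sin (x.j * t))) * Complex.cos (x.k * θ)) * Complex.I_mul_I

/-- At `Ω₀` the eigenvector equations make the matrix diagonal, and the dependence on `Ω` is affine
with slope `cpl`. -/
theorem ip_linOp_e0 (hω : 0 < ω) (Ω : ℝ) (x y : Site) :
    ip (linOp ω Ω (e0 ω y)) (e0 ω x) = Lc ω Ω x y := by
  rw [e0_eq_trig ω y, linOp_trig, ip_trig_e0, Lc, cpl]
  have hA := mu_mul_vA hω y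
  have hB := mu_mul_vB (ω := ω) y
  have hxy := ip_e0_e0 hω x y
  rw [e0_eq_trig ω y, ip_trig_e0] at hxy
  by_cases h : x.j = y.j ∧ x.k = y.k
  · rw [if_pos h] at hxy ⊢
    rw [if_pos h]
    have e1 : (if x = y then (lam ω y : ℂ) else 0)
        = lam ω y * ((vA ω y * vA ω x + vB ω y * vB ω x : ℝ) : ℂ) := by
      rw [hxy]
      split_ifs <;> simp
    rw [e1, lam]
    norm_cast
    linear_combination (-vA ω x) * hA - (vB ω x) * hB
  · rw [if_neg h, if_neg h, if_neg (fun hxy => h ⟨by rw [hxy], by rw [hxy]⟩)]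
    simp

end VortexFilament

end

/-! ### Resolvents and multiplication operators on weighted sequences. -/

noncomputable section

namespace VortexFilament

/-! ### The resolvent in a Banach algebra -/

section Resolvent

variable {R : Type*} [NormedRing R] [CompleteSpace R]

theorem isUnit_one_add_of_norm_le {T : R} (hT : ‖T‖ ≤ 1 / 2) : IsUnit (1 + T) := by
  have := isUnit_one_sub_of_norm_lt_one (x := -T) (by rw [norm_neg]; linarith)
  rwa [sub_neg_eq_add] at this

/-- The resolvent `(1 + T)⁻¹`. -/
def res (T : R) : R := Ring.inverse (1 + T)

theorem one_add_mul_res {T : R} (hT : ‖T‖ ≤ 1 / 2) : (1 + T) * res T = 1 :=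
  Ring.mul_inverse_cancel _ (isUnit_one_add_of_norm_le hT)

theorem res_mul_one_add {T : R} (hT : ‖T‖ ≤ 1 / 2) : res T * (1 + T) = 1 :=
  Ring.inverse_mul_cancel _ (isUnit_one_add_of_norm_le hT)

theorem norm_res_le (h1 : ‖(1 : R)‖ ≤ 1) {T : R} (hT : ‖T‖ ≤ 1 / 2) : ‖res T‖ ≤ 2 := by
  have h2 : res T = 1 - T * res T := by
    have := one_add_mul_res hT
    rw [add_mul, one_mul] at this
    exact eq_sub_of_add_eq this
  have h3 : ‖T * res T‖ ≤ 1 / 2 * ‖res T‖ :=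
    (norm_mul_le _ _).trans (mul_le_mul_of_nonneg_right hT (norm_nonneg _))
  have h4 : ‖res T‖ ≤ 1 + 1 / 2 * ‖res T‖ := by
    calc ‖res T‖ = ‖1 - T * res T‖ := by rw [← h2]
      _ ≤ ‖(1 : R)‖ + ‖T * res T‖ := norm_sub_le _ _
      _ ≤ _ := add_le_add h1 h3
  linarith

theorem commute_res {T S : R} (hT : ‖T‖ ≤ 1 / 2) (h : Commute T S) : Commute (res T) S := by
  have h1 : (1 + T) * S = S * (1 + T) := ((Commute.one_left S).add_left h).eq
  calc res T * S = res T * (S * ((1 + T) * res T)) := by rw [one_add_mul_res hT, mul_one]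
    _ = res T * ((1 + T) * S) * res T := by rw [h1]; simp only [mul_assoc]
    _ = S * res T := by rw [← mul_assoc (res T), res_mul_one_add hT, one_mul]

/-- This is `z - 1 + 1/(1+z) = z²/(1+z)` in the algebra. The left side is convenient to
differentiate, the right side shows quadratic smallness. -/
theorem sub_one_add_res {T : R} (hT : ‖T‖ ≤ 1 / 2) : T - 1 + res T = T * T * res T := by
  have h := one_add_mul_res hT
  have h2 : (T - 1) * ((1 + T) * res T) + res T = T * T * res T := by noncomm_ring
  rwa [h, mul_one] at h2

theorem norm_sub_one_add_res_le (h1 : ‖(1 : R)‖ ≤ 1) {T : R} (hT : ‖T‖ ≤ 1 / 2) :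
    ‖T - 1 + res T‖ ≤ 2 * ‖T‖ ^ 2 := by
  rw [sub_one_add_res hT]
  calc ‖T * T * res T‖ ≤ ‖T‖ * ‖T‖ * ‖res T‖ := norm_mul₃_le
    _ ≤ ‖T‖ * ‖T‖ * 2 := by gcongr; exact norm_res_le h1 hT
    _ = _ := by ring

theorem res_sub_res {T T' : R} (hT : ‖T‖ ≤ 1 / 2) (hT' : ‖T'‖ ≤ 1 / 2) :
    res T' - res T = res T' * (T - T') * res T := by
  have h1 := one_add_mul_res hT
  have h2 := res_mul_one_add hT'
  calc res T' - res T = res T' * ((1 + T) * res T) - res T' * (1 + T') * res T := by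
        rw [h1, h2, mul_one, one_mul]
    _ = _ := by noncomm_ring

theorem norm_res_sub_res_le (h1 : ‖(1 : R)‖ ≤ 1) {T T' : R} (hT : ‖T‖ ≤ 1 / 2)
    (hT' : ‖T'‖ ≤ 1 / 2) : ‖res T' - res T‖ ≤ 4 * ‖T - T'‖ := by
  rw [res_sub_res hT hT']
  calc _ ≤ ‖res T'‖ * ‖T - T'‖ * ‖res T‖ := norm_mul₃_le
    _ ≤ 2 * ‖T - T'‖ * 2 := by
        gcongr
        · exact norm_res_le h1 hT'
        · exact norm_res_le h1 hT
    _ = _ := by ring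

/-- The derivative of `T - 1 + (1+T)⁻¹` in a commuting direction `H` is `(1 - (1+T)⁻²)H`.
Commutation and the resolvent identity reduce the remainder to `-(res (T+H) - res T) H res T`, which
is quadratic because the resolvent is Lipschitz. -/
theorem norm_res_remainder_le (h1 : ‖(1 : R)‖ ≤ 1) {T H : R} (hT : ‖T‖ ≤ 1 / 2)
    (hT' : ‖T + H‖ ≤ 1 / 2) (hc : Commute T H) :
    ‖(T + H - 1 + res (T + H)) - (T - 1 + res T) - (1 - res T * res T) * H‖ ≤ 8 * ‖H‖ ^ 2 := by
  have h2 := res_sub_res hT hT'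
  have h3 := (commute_res hT hc).eq
  have h4 : (T + H - 1 + res (T + H)) - (T - 1 + res T) - (1 - res T * res T) * H
      = -(res (T + H) - res T) * H * res T := by
    have : (T + H - 1 + res (T + H)) - (T - 1 + res T) - (1 - res T * res T) * H
      = (res (T + H) - res T) + res T * (res T * H) := by noncomm_ring
    rw [this, h3]
    nth_rewrite 1 [h2]
    noncomm_ring
  rw [h4]
  have h5 := norm_res_sub_res_le h1 hT hT'
  rw [sub_add_cancel_left, norm_neg] at h5
  calc _ ≤ ‖-(res (T + H) - res T)‖ * ‖H‖ * ‖res T‖ := norm_mul₃_le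
    _ ≤ (4 * ‖H‖) * ‖H‖ * 2 := by
        gcongr
        · rwa [norm_neg]
        · exact norm_res_le h1 hT
    _ = _ := by ring

theorem norm_sq_res_sub_le (h1 : ‖(1 : R)‖ ≤ 1) {T T' : R} (hT : ‖T‖ ≤ 1 / 2)
    (hT' : ‖T'‖ ≤ 1 / 2) :
    ‖(1 - res T * res T) - (1 - res T' * res T')‖ ≤ 16 * ‖T - T'‖ := by
  have h2 : (1 - res T * res T) - (1 - res T' * res T')
      = res T' * (res T' - res T) + (res T' - res T) * res T := by noncomm_ring
  rw [h2]
  have h3 := norm_res_sub_res_le h1 hT hT'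
  calc _ ≤ ‖res T'‖ * ‖res T' - res T‖ + ‖res T' - res T‖ * ‖res T‖ :=
        (norm_add_le _ _).trans (add_le_add (norm_mul_le _ _) (norm_mul_le _ _))
    _ ≤ 2 * (4 * ‖T - T'‖) + (4 * ‖T - T'‖) * 2 := by
        gcongr
        · exact norm_res_le h1 hT'
        · exact norm_res_le h1 hT
    _ = _ := by ring

end Resolvent

/-! ### Multiplication operators -/

variable {ω : ℝ}

/-- The weight of a site. -/
def wS (σ : ℝ) (x : Site) : ℝ := Real.exp (σ * len x.j x.k)

theorem wS_pos (σ : ℝ) (x : Site) : 0 < wS σ x := Real.exp_pos _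

theorem one_le_wS {σ : ℝ} (hσ : 0 ≤ σ) (x : Site) : 1 ≤ wS σ x :=
  Real.one_le_exp (mul_nonneg hσ (len_nonneg _ _))

theorem wS_mono {σ σ' : ℝ} (h : σ ≤ σ') (x : Site) : wS σ x ≤ wS σ' x :=
  Real.exp_le_exp.2 (mul_le_mul_of_nonneg_right h (len_nonneg _ _))

theorem sq_sgn (s : ℤˣ) : (((s : ℤ) : ℝ)) ^ 2 = 1 := by
  rcases Int.units_eq_one_or s with h | h <;> simp [h]

theorem mw_smode (σ : ℝ) (x : Site) (s : Sgn) : mw σ (smode x s) = wS σ x := by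
  rw [mw, wS, smode, len, len]
  push_cast
  rw [mul_pow, mul_pow, sq_sgn, sq_sgn, one_mul, one_mul]

theorem mw_neg (σ : ℝ) (m : ℤ × ℤ) : mw σ (-m) = mw σ m := by
  simp [mw, len]

/-- Weights `σ ≥ 0`. -/
abbrev Wt := {σ : ℝ // 0 ≤ σ}

/-- Multiplication by the conjugate of `e_x`. -/
def Eop (ω : ℝ) (σ : Wt) (x : Site) : Seq →L[ℂ] Seq :=
  ∑ s, (cf ω x s : ℂ) • shift σ (-smode x s)

theorem norm_Eop_le (hω : 0 < ω) (σ : Wt) (x : Site) : ‖Eop ω σ x‖ ≤ 4 * wS σ x := by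
  refine (norm_sum_le _ _).trans ?_
  calc _ ≤ ∑ _s : Sgn, wS σ x := Finset.sum_le_sum fun s _ => by
        rw [norm_smul, Complex.norm_real, Real.norm_eq_abs]
        calc _ ≤ 1 * wS σ x := by
              gcongr
              · exact abs_cf_le hω x s
              · refine (norm_shift_le _ _).trans ?_
                rw [mw_neg, mw_smode]
          _ = _ := one_mul _
    _ = _ := by
        rw [sum_sgn]
        ring

theorem evalAt_Eop (σ : Wt) (x : Site) (b : Seq) (t θ : ℝ) :
    evalAt σ t θ (Eop ω σ x b) = (starRingEnd ℂ) (e0 ω x t θ) * evalAt σ t θ b := by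
  rw [conj_e0, Eop, sum_apply, map_sum, Finset.sum_mul]
  refine Finset.sum_congr rfl fun s _ => ?_
  rw [smul_apply, map_smul, evalAt_shift, smul_eq_mul, mul_assoc]

theorem commute_Eop (σ : Wt) (x y : Site) : Commute (Eop ω σ x) (Eop ω σ y) :=
  Commute.sum_left _ _ _ fun _ _ => Commute.sum_right _ _ _ fun _ _ =>
    ((commute_shift σ _ _).smul_left _).smul_right _

/-- Multiplication by `∑ c_x ē_x`. -/
def Top (ω : ℝ) (σ : Wt) (B : Finset Site) (c : Site → ℂ) : Seq →L[ℂ] Seq :=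
  ∑ x ∈ B, c x • Eop ω σ x

/-- The norm `∑ |c_x| e^{σ|x|}`. -/
def nrm (σ : ℝ) (B : Finset Site) (c : Site → ℂ) : ℝ := ∑ x ∈ B, ‖c x‖ * wS σ x

theorem nrm_nonneg (σ : ℝ) (B : Finset Site) (c : Site → ℂ) : 0 ≤ nrm σ B c :=
  Finset.sum_nonneg fun x _ => mul_nonneg (norm_nonneg _) (wS_pos σ x).le

theorem nrm_mono {σ σ' : ℝ} (h : σ ≤ σ') (B : Finset Site) (c : Site → ℂ) :
    nrm σ B c ≤ nrm σ' B c :=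
  Finset.sum_le_sum fun x _ => mul_le_mul_of_nonneg_left (wS_mono h x) (norm_nonneg _)

theorem nrm_add_le (σ : ℝ) (B : Finset Site) (c h : Site → ℂ) :
    nrm σ B (c + h) ≤ nrm σ B c + nrm σ B h := by
  rw [nrm, nrm, nrm, ← Finset.sum_add_distrib]
  refine Finset.sum_le_sum fun x _ => ?_
  rw [← add_mul]
  exact mul_le_mul_of_nonneg_right (norm_add_le _ _) (wS_pos σ x).le

theorem norm_Top_le (hω : 0 < ω) (σ : Wt) (B : Finset Site) (c : Site → ℂ) :
    ‖Top ω σ B c‖ ≤ 4 * nrm σ B c := by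
  refine (norm_sum_le _ _).trans ?_
  rw [nrm, Finset.mul_sum]
  refine Finset.sum_le_sum fun x _ => ?_
  rw [norm_smul]
  calc _ ≤ ‖c x‖ * (4 * wS σ x) := by gcongr; exact norm_Eop_le hω σ x
    _ = _ := by ring

theorem Top_add (σ : Wt) (B : Finset Site) (c h : Site → ℂ) :
    Top ω σ B (c + h) = Top ω σ B c + Top ω σ B h := by
  simp only [Top, Pi.add_apply, add_smul, Finset.sum_add_distrib]

theorem Top_sub (σ : Wt) (B : Finset Site) (c h : Site → ℂ) :
    Top ω σ B (c - h) = Top ω σ B c - Top ω σ B h := by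
  simp only [Top, Pi.sub_apply, sub_smul, Finset.sum_sub_distrib]

theorem commute_Top (σ : Wt) (B : Finset Site) (c h : Site → ℂ) :
    Commute (Top ω σ B c) (Top ω σ B h) :=
  Commute.sum_left _ _ _ fun _ _ => Commute.sum_right _ _ _ fun _ _ =>
    ((commute_Eop σ _ _).smul_left _).smul_right _

/-- The function `∑ c_x ē_x`, the conjugate of `∑ c_x e_x` for real `c`. -/
def ubar (ω : ℝ) (B : Finset Site) (c : Site → ℂ) : Fn := fun t θ =>
  ∑ x ∈ B, c x * (starRingEnd ℂ) (e0 ω x t θ)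

theorem evalAt_Top (σ : Wt) (B : Finset Site) (c : Site → ℂ) (b : Seq) (t θ : ℝ) :
    evalAt σ t θ (Top ω σ B c b) = ubar ω B c t θ * evalAt σ t θ b := by
  rw [Top, ubar, sum_apply, map_sum, Finset.sum_mul]
  refine Finset.sum_congr rfl fun s _ => ?_
  rw [smul_apply, map_smul, evalAt_Eop, smul_eq_mul, mul_assoc]

theorem norm_one_op_le : ‖(1 : Seq →L[ℂ] Seq)‖ ≤ 1 := ContinuousLinearMap.norm_id_le

/-- Evaluating `(1+T) res T = 1` at a point gives the quotient formula. Applied to `deltaZero`,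
whose value is `1`, it also shows that the denominator cannot vanish. -/
theorem evalAt_res {σ : Wt} {B : Finset Site} {c : Site → ℂ} (h : ‖Top ω σ B c‖ ≤ 1 / 2)
    (b : Seq) (t θ : ℝ) :
    1 + ubar ω B c t θ ≠ 0 ∧
      evalAt σ t θ (res (Top ω σ B c) b) = evalAt σ t θ b / (1 + ubar ω B c t θ) := by
  have key : ∀ b, (1 + ubar ω B c t θ) * evalAt σ t θ (res (Top ω σ B c) b) = evalAt σ t θ b := by
    intro b
    have h1 := congrArg (fun A : Seq →L[ℂ] Seq => evalAt σ t θ (A b)) (one_add_mul_res h)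
    simp only [mul_apply_eq_comp, add_apply, one_apply_eq_self,
      map_add, evalAt_Top] at h1
    rw [← h1]
    ring
  have h0 : 1 + ubar ω B c t θ ≠ 0 := by
    intro h0
    have := key deltaZero
    rw [h0, zero_mul, evalAt_deltaZero] at this
    exact zero_ne_one this
  exact ⟨h0, by rw [← key b, mul_div_cancel_left₀ _ h0]⟩

/-! ### Coefficients -/

/-- The coefficient at the site `x` of a sequence of weighted Fourier coefficients. -/
def coefX (ω : ℝ) (σ : Wt) (x : Site) : Seq →ₗ[ℂ] ℂ where
  toFun b := ∑ s, (cf ω x s : ℂ) * (b (smode x s) / wS σ x)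
  map_add' a b := by
    rw [← Finset.sum_add_distrib]
    refine Finset.sum_congr rfl fun s _ => ?_
    simp only [lp.coeFn_add, Pi.add_apply]
    ring
  map_smul' c b := by
    rw [RingHom.id_apply, smul_eq_mul, Finset.mul_sum]
    refine Finset.sum_congr rfl fun s _ => ?_
    simp only [lp.coeFn_smul, Pi.smul_apply, smul_eq_mul]
    ring

theorem coefX_apply (σ : Wt) (x : Site) (b : Seq) :
    coefX ω σ x b = ∑ s, (cf ω x s : ℂ) * (b (smode x s) / wS σ x) := rfl

theorem norm_coefX_le (hω : 0 < ω) (σ : Wt) (x : Site) (b : Seq) :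
    ‖coefX ω σ x b‖ * wS σ x ≤ 4 * ‖b‖ := by
  rw [← le_div_iff₀ (wS_pos _ _), coefX_apply]
  refine (norm_sum_le _ _).trans ?_
  calc _ ≤ ∑ _s : Sgn, ‖b‖ / wS σ x := Finset.sum_le_sum fun s _ => by
        rw [norm_mul, norm_div, Complex.norm_real, Complex.norm_real, Real.norm_eq_abs,
          Real.norm_of_nonneg (wS_pos _ _).le]
        calc _ ≤ 1 * (‖b‖ / wS σ x) := by
              have := wS_pos σ x
              gcongr
              · exact abs_cf_le hω x s
              · exact b.norm_apply_le _
          _ = _ := one_mul _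
    _ = _ := by
        rw [sum_sgn]
        ring

theorem norm_coefX_le' (hω : 0 < ω) (σ : Wt) (x : Site) (b : Seq) :
    ‖coefX ω σ x b‖ ≤ 4 * ‖b‖ :=
  (le_mul_of_one_le_right (norm_nonneg _) (one_le_wS σ.2 x)).trans (norm_coefX_le hω σ x b)

theorem ip_evalAt (hω : 0 < ω) (σ : Wt) (b : Seq) (x : Site) :
    ip (fun t θ => evalAt σ t θ b) (e0 ω x) = coefX ω σ x b := by
  have h1 := hasSum_avg (g := fun n t θ => b n / (mw σ n : ℂ) * (mode n t θ *
    (starRingEnd ℂ) (e0 ω x t θ))) (C := fun n => ‖b n‖ * 4)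
    (fun n => Continuous.mul continuous_const ((jointCont_mode n).mul (jointCont_e0 x).conj))
    (b.summable_norm.mul_right 4) (fun n t θ => by
      rw [← mul_assoc, norm_mul, RCLike.norm_conj]
      exact mul_le_mul (norm_eval_term_le σ.2 b t θ n) (norm_e0_le hω x t θ) (norm_nonneg _)
        (norm_nonneg _))
  have h2 : ip (fun t θ => evalAt σ t θ b) (e0 ω x) = avg fun t θ => ∑' n, b n / (mw σ n : ℂ) *
      (mode n t θ * (starRingEnd ℂ) (e0 ω x t θ)) := by
    rw [ip_eq_avg]
    congr 1
    funext t θ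
    rw [evalAt_apply, ← tsum_mul_right]
    exact tsum_congr fun n => by ring
  rw [h2, ← h1.tsum_eq]
  have h3 : ∀ n, avg (fun t θ => b n / (mw σ n : ℂ) * (mode n t θ *
      (starRingEnd ℂ) (e0 ω x t θ)))
      = ∑ s, (if n = smode x s then (cf ω x s : ℂ) * (b n / mw σ n) else 0) := by
    intro n
    rw [avg_const_mul, ← ip_eq_avg, ip_mode_e0, Finset.mul_sum]
    refine Finset.sum_congr rfl fun s _ => ?_
    split_ifs <;> ring
  simp only [h3]
  rw [Summable.tsum_finsetSum, coefX_apply]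
  · refine Finset.sum_congr rfl fun s _ => ?_
    rw [tsum_ite_eq, mw_smode]
  · intro s _
    exact summable_of_ne_finset_zero (s := {smode x s}) fun n hn => if_neg (by simpa using hn)

end VortexFilament

end

/-! ### The holomorphic system: Taylor remainder, Lipschitz bound and smoothness. -/

noncomputable section

namespace VortexFilament

variable {ω : ℝ}

/-! ### The complexified equation -/

/-- The coefficients of `ū² / (1 + ū)`. -/
def Phi (ω : ℝ) (B : Finset Site) (c : Site → ℂ) (x : Site) : ℂ :=
  ip (fun t θ => ubar ω B c t θ ^ 2 / (1 + ubar ω B c t θ)) (e0 ω x)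

/-- The matrix of the derivative of `ū² / (1 + ū)`. -/
def Jphi (ω : ℝ) (B : Finset Site) (c : Site → ℂ) (x y : Site) : ℂ :=
  ip (fun t θ => (2 * ubar ω B c t θ + ubar ω B c t θ ^ 2) / (1 + ubar ω B c t θ) ^ 2
    * (starRingEnd ℂ) (e0 ω y t θ)) (e0 ω x)

/-- The coefficients of `f`, as holomorphic functions of the frequency and the coefficients. -/
def Fc (ω : ℝ) (B : Finset Site) (Ω : ℂ) (c : Site → ℂ) (x : Site) : ℂ :=
  ∑ y ∈ B, Lc ω Ω x y * c y + ω * Phi ω B c x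

/-- The Jacobian matrix of `Fc`. -/
def Jc (ω : ℝ) (B : Finset Site) (Ω : ℂ) (c : Site → ℂ) (x y : Site) : ℂ :=
  Lc ω Ω x y + ω * Jphi ω B c x y

theorem norm_Top_le_half (hω : 0 < ω) {σ : Wt} {B : Finset Site} {c : Site → ℂ}
    (h : nrm σ B c ≤ 1 / 8) : ‖Top ω σ B c‖ ≤ 1 / 2 :=
  (norm_Top_le hω σ B c).trans (by linarith)

/-- The identity `z²/(1+z) = z - 1 + 1/(1+z)` is realized by operators applied to `deltaZero`. The
left side does not involve `σ`, so the same coefficient may be estimated with any weight for which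
`nrm σ B c` is small. -/
theorem Phi_eq (hω : 0 < ω) {σ : Wt} {B : Finset Site} {c : Site → ℂ}
    (h : nrm σ B c ≤ 1 / 8) (x : Site) :
    Phi ω B c x = coefX ω σ x ((Top ω σ B c - 1 + res (Top ω σ B c)) deltaZero) := by
  have h' := norm_Top_le_half hω h
  rw [← ip_evalAt hω, Phi]
  congr 1
  funext t θ
  obtain ⟨h0, h1⟩ := evalAt_res h' deltaZero t θ
  have h2 : (Top ω σ B c - 1 + res (Top ω σ B c)) deltaZero
      = Top ω σ B c deltaZero - deltaZero + res (Top ω σ B c) deltaZero := rfl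
  rw [h2, map_add, map_sub, evalAt_Top, h1, evalAt_deltaZero]
  field_simp
  ring

/-- The operator form rests on `(2z + z²)/(1+z)² = 1 - (1+z)⁻²`. -/
theorem Jphi_eq (hω : 0 < ω) {σ : Wt} {B : Finset Site} {c : Site → ℂ}
    (h : nrm σ B c ≤ 1 / 8) (x y : Site) :
    Jphi ω B c x y = coefX ω σ x
      ((1 - res (Top ω σ B c) * res (Top ω σ B c)) (Eop ω σ y deltaZero)) := by
  have h' := norm_Top_le_half hω h
  rw [← ip_evalAt hω, Jphi]
  congr 1
  funext t θ
  have h2 : (1 - res (Top ω σ B c) * res (Top ω σ B c)) (Eop ω σ y deltaZero)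
      = Eop ω σ y deltaZero - res (Top ω σ B c) (res (Top ω σ B c) (Eop ω σ y deltaZero)) := rfl
  obtain ⟨h0, h1⟩ := evalAt_res h' (Eop ω σ y deltaZero) t θ
  rw [h2, map_sub, (evalAt_res h' _ t θ).2, h1, evalAt_Eop, evalAt_deltaZero]
  field_simp
  ring

theorem sum_Jphi_mul (hω : 0 < ω) {σ : Wt} {B : Finset Site} {c : Site → ℂ}
    (h : nrm σ B c ≤ 1 / 8) (x : Site) (k : Site → ℂ) :
    ∑ y ∈ B, Jphi ω B c x y * k y = coefX ω σ x
      (((1 - res (Top ω σ B c) * res (Top ω σ B c)) * Top ω σ B k) deltaZero) := by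
  have h2 : ((1 - res (Top ω σ B c) * res (Top ω σ B c)) * Top ω σ B k) deltaZero
      = ∑ y ∈ B, k y • (1 - res (Top ω σ B c) * res (Top ω σ B c)) (Eop ω σ y deltaZero) := by
    have h3 : Top ω σ B k deltaZero = ∑ y ∈ B, (k y • Eop ω σ y) deltaZero := sum_apply _ _ _
    rw [mul_apply_eq_comp, h3, map_sum]
    exact Finset.sum_congr rfl fun y _ => by rw [smul_apply, map_smul]
  rw [h2, map_sum]
  refine Finset.sum_congr rfl fun y _ => ?_
  rw [map_smul, smul_eq_mul, Jphi_eq hω h, mul_comm]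

theorem norm_coefX_op_le (hω : 0 < ω) (σ : Wt) (x : Site) (A : Seq →L[ℂ] Seq) :
    ‖coefX ω σ x (A deltaZero)‖ * wS σ x ≤ 4 * ‖A‖ := by
  refine (norm_coefX_le hω σ x _).trans ?_
  have := A.le_opNorm deltaZero
  rw [norm_deltaZero, mul_one] at this
  linarith

/-- The constant is `4 · 2 · 4²`: the coefficient functional, the quadratic bound for the resolvent
expression, and `norm_Top_le` squared. -/
theorem norm_Phi_le (hω : 0 < ω) {σ : Wt} {B : Finset Site} {c : Site → ℂ}
    (h : nrm σ B c ≤ 1 / 8) (x : Site) :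
    ‖Phi ω B c x‖ * wS σ x ≤ 128 * nrm σ B c ^ 2 := by
  rw [Phi_eq hω h]
  refine (norm_coefX_op_le hω σ x _).trans ?_
  have h1 := norm_sub_one_add_res_le norm_one_op_le (norm_Top_le_half hω h)
  have h2 := norm_Top_le hω σ B c
  have h3 : ‖Top ω σ B c‖ ^ 2 ≤ (4 * nrm σ B c) ^ 2 := by gcongr
  linarith

theorem cpl_le (hω : 0 < ω) (σ : ℝ) (x y : Site) : |cpl ω x y| * wS σ x ≤ 2 * y.j * wS σ y := by
  rw [cpl]
  split_ifs with h
  · have hw : wS σ x = wS σ y := by rw [wS, wS, h.1, h.2]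
    rw [hw]
    refine mul_le_mul_of_nonneg_right ?_ (wS_pos σ y).le
    rw [abs_mul, Nat.abs_cast, mul_comm]
    refine mul_le_mul_of_nonneg_right ?_ (Nat.cast_nonneg _)
    refine (abs_add_le _ _).trans ?_
    rw [abs_mul, abs_mul]
    have h1 := mul_le_one₀ (abs_vB_le hω y) (abs_nonneg _) (abs_vA_le hω x)
    have h2 := mul_le_one₀ (abs_vA_le hω y) (abs_nonneg _) (abs_vB_le hω x)
    linarith
  · rw [abs_zero, zero_mul]
    have := wS_pos σ y
    positivity

/-- The quadratic remainder of a Newton step. -/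
theorem norm_Fc_remainder_le (hω : 0 < ω) {σ : Wt} {B : Finset Site} {c h : Site → ℂ}
    (hc : nrm σ B c ≤ 1 / 8) (hch : nrm σ B (c + h) ≤ 1 / 8) (Ω : ℂ) (x : Site) :
    ‖Fc ω B Ω (c + h) x - (Fc ω B Ω c x + ∑ y ∈ B, Jc ω B Ω c x y * h y)‖ * wS σ x
      ≤ 512 * ω * nrm σ B h ^ 2 := by
  have e1 : Fc ω B Ω (c + h) x - (Fc ω B Ω c x + ∑ y ∈ B, Jc ω B Ω c x y * h y)
      = ω * (Phi ω B (c + h) x - Phi ω B c x - ∑ y ∈ B, Jphi ω B c x y * h y) := by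
    simp only [Fc, Jc, add_mul, Pi.add_apply, mul_add, Finset.sum_add_distrib, mul_assoc,
      ← Finset.mul_sum]
    ring
  rw [e1, norm_mul, Complex.norm_real, Real.norm_of_nonneg hω.le, Phi_eq hω hc, Phi_eq hω hch,
    sum_Jphi_mul hω hc, ← map_sub, ← map_sub, ← sub_apply, ← sub_apply, Top_add, mul_assoc]
  have hT := norm_Top_le_half hω hc
  have hT' := norm_Top_le_half hω hch
  rw [Top_add] at hT'
  have h1 := norm_res_remainder_le norm_one_op_le hT hT' (commute_Top σ B c h)
  have h2 := norm_Top_le hω σ B h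
  have h3 : ‖Top ω σ B h‖ ^ 2 ≤ (4 * nrm σ B h) ^ 2 := by gcongr
  have h4 := norm_coefX_op_le hω σ x ((Top ω σ B c + Top ω σ B h - 1
    + res (Top ω σ B c + Top ω σ B h)) - (Top ω σ B c - 1 + res (Top ω σ B c))
    - (1 - res (Top ω σ B c) * res (Top ω σ B c)) * Top ω σ B h)
  -- Here `512 = 4 · 8 · 4²`, from the coefficient functional, the resolvent remainder and the bound
  -- for `Top` squared. The linear part of the equation has cancelled.
  calc _ ≤ ω * (512 * nrm σ B h ^ 2) := mul_le_mul_of_nonneg_left (by linarith) hω.le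
    _ = _ := by ring

/-- The Lipschitz estimate for the Jacobian. -/
theorem norm_Jc_sub_le (hω : 0 < ω) {σ : Wt} {B : Finset Site} {c c' : Site → ℂ}
    (hc : nrm σ B c ≤ 1 / 8) (hc' : nrm σ B c' ≤ 1 / 8) {J : ℝ} (hJ : ∀ y ∈ B, (y.j : ℝ) ≤ J)
    (Ω Ω' : ℂ) (h : Site → ℂ) (x : Site) :
    ‖∑ y ∈ B, (Jc ω B Ω c x y - Jc ω B Ω' c' x y) * h y‖ * wS σ x
      ≤ (2 * J * ‖Ω - Ω'‖ + 1024 * ω * nrm σ B (c - c')) * nrm σ B h := by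
  have e1 : ∑ y ∈ B, (Jc ω B Ω c x y - Jc ω B Ω' c' x y) * h y
      = (∑ y ∈ B, (Ω - Ω') * cpl ω x y * h y)
        + ω * (∑ y ∈ B, Jphi ω B c x y * h y - ∑ y ∈ B, Jphi ω B c' x y * h y) := by
    rw [← Finset.sum_sub_distrib, Finset.mul_sum, ← Finset.sum_add_distrib]
    refine Finset.sum_congr rfl fun y _ => ?_
    rw [Jc, Jc, Lc, Lc]
    ring
  have h1 : ‖∑ y ∈ B, (Ω - Ω') * cpl ω x y * h y‖ * wS σ x ≤ 2 * J * ‖Ω - Ω'‖ * nrm σ B h := by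
    have hn : ‖∑ y ∈ B, (Ω - Ω') * cpl ω x y * h y‖
        ≤ ∑ y ∈ B, ‖Ω - Ω'‖ * |cpl ω x y| * ‖h y‖ := by
      refine (norm_sum_le _ _).trans_eq (Finset.sum_congr rfl fun y _ => ?_)
      rw [norm_mul, norm_mul, Complex.norm_real, Real.norm_eq_abs]
    refine (mul_le_mul_of_nonneg_right hn (wS_pos _ _).le).trans ?_
    rw [Finset.sum_mul, nrm, Finset.mul_sum]
    refine Finset.sum_le_sum fun y hy => ?_
    have h2 := cpl_le hω σ x y
    have h3 : 2 * (y.j : ℝ) * wS σ y ≤ 2 * J * wS σ y :=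
      mul_le_mul_of_nonneg_right (by linarith [hJ y hy]) (wS_pos _ _).le
    calc _ = ‖Ω - Ω'‖ * ‖h y‖ * (|cpl ω x y| * wS σ x) := by ring
      _ ≤ ‖Ω - Ω'‖ * ‖h y‖ * (2 * J * wS σ y) := by
          exact mul_le_mul_of_nonneg_left (h2.trans h3) (by positivity)
      _ = _ := by ring
  have h2 : ‖∑ y ∈ B, Jphi ω B c x y * h y - ∑ y ∈ B, Jphi ω B c' x y * h y‖ * wS σ x
      ≤ 1024 * nrm σ B (c - c') * nrm σ B h := by
    rw [sum_Jphi_mul hω hc, sum_Jphi_mul hω hc', ← map_sub, ← sub_apply, ← sub_mul]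
    refine (norm_coefX_op_le hω σ x _).trans ?_
    have h3 := norm_sq_res_sub_le norm_one_op_le (norm_Top_le_half hω hc)
      (norm_Top_le_half hω hc')
    rw [← Top_sub] at h3
    have h4 := norm_Top_le hω σ B (c - c')
    have h5 := norm_Top_le hω σ B h
    -- The factors are the coefficient functional, the Lipschitz constant of `1 - res²`, and the
    -- bound for `Top` in each of `c - c'` and `h`.
    calc _ ≤ 4 * ((16 * (4 * nrm σ B (c - c'))) * (4 * nrm σ B h)) := by
          refine mul_le_mul_of_nonneg_left ((norm_mul_le _ _).trans ?_) (by norm_num)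
          refine mul_le_mul (by linarith) h5 (norm_nonneg _) ?_
          have := nrm_nonneg σ B (c - c')
          positivity
      _ = _ := by ring
  rw [e1]
  calc _ ≤ (‖∑ y ∈ B, (Ω - Ω') * cpl ω x y * h y‖
        + ω * ‖∑ y ∈ B, Jphi ω B c x y * h y - ∑ y ∈ B, Jphi ω B c' x y * h y‖) * wS σ x := by
        refine mul_le_mul_of_nonneg_right ((norm_add_le _ _).trans ?_) (wS_pos _ _).le
        rw [norm_mul (ω : ℂ), Complex.norm_real, Real.norm_of_nonneg hω.le]
    _ = ‖∑ y ∈ B, (Ω - Ω') * cpl ω x y * h y‖ * wS σ x + ω * (‖∑ y ∈ B, Jphi ω B c x y * h y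
        - ∑ y ∈ B, Jphi ω B c' x y * h y‖ * wS σ x) := by ring
    _ ≤ 2 * J * ‖Ω - Ω'‖ * nrm σ B h + ω * (1024 * nrm σ B (c - c') * nrm σ B h) :=
        add_le_add h1 (mul_le_mul_of_nonneg_left h2 hω.le)
    _ = _ := by ring

/-! ### Holomorphic dependence -/

/-- Evaluation of the coefficient at `x` as a functional on operators. -/
def coefOp (ω : ℝ) (hω : 0 < ω) (x : Site) (b : Seq) : (Seq →L[ℂ] Seq) →L[ℂ] ℂ :=
  ((coefX ω ⟨0, le_rfl⟩ x).mkContinuous 4 (norm_coefX_le' hω _ x)).comp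
    (ContinuousLinearMap.apply ℂ Seq b)

section Smooth

variable {E : Type*} [NormedAddCommGroup E] [NormedSpace ℂ E] {n : WithTop ℕ∞} {D : Set E}
  {B : Finset Site} {c : E → Site → ℂ} {Ω : E → ℂ}

theorem contDiffOn_Top (σ : Wt) (hc : ∀ x ∈ B, ContDiffOn ℂ n (fun p => c p x) D) :
    ContDiffOn ℂ n (fun p => Top ω σ B (c p)) D :=
  ContDiffOn.sum fun x hx => (hc x hx).smul contDiffOn_const

theorem contDiffOn_res {T : E → Seq →L[ℂ] Seq} (hT : ContDiffOn ℂ n T D)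
    (h : ∀ p ∈ D, ‖T p‖ ≤ 1 / 2) : ContDiffOn ℂ n (fun p => res (T p)) D := by
  intro p hp
  obtain ⟨u, hu⟩ := isUnit_one_add_of_norm_le (h p hp)
  have h1 : ContDiffAt ℂ n Ring.inverse (1 + T p) := hu ▸ contDiffAt_ringInverse ℂ u
  exact h1.comp_contDiffWithinAt p ((contDiffWithinAt_const (c := 1)).add (hT p hp))

/-- By `Phi_eq` this is a bounded functional of a finite linear combination of fixed operators and
of an inverse in a Banach algebra, all holomorphic. The weight `σ = 0` suffices, since no decay is
claimed. -/
theorem contDiffOn_Phi (hω : 0 < ω) (hc : ∀ x ∈ B, ContDiffOn ℂ n (fun p => c p x) D)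
    (hs : ∀ p ∈ D, nrm 0 B (c p) ≤ 1 / 8) (x : Site) :
    ContDiffOn ℂ n (fun p => Phi ω B (c p) x) D := by
  have hT := contDiffOn_Top (ω := ω) ⟨0, le_rfl⟩ hc
  have hR := contDiffOn_res hT fun p hp => norm_Top_le_half hω (hs p hp)
  refine ((coefOp ω hω x deltaZero).contDiff.comp_contDiffOn
    ((hT.sub (contDiffOn_const (c := 1))).add hR)).congr fun p hp => ?_
  exact Phi_eq hω (σ := ⟨0, le_rfl⟩) (hs p hp) x

theorem contDiffOn_Jphi (hω : 0 < ω) (hc : ∀ x ∈ B, ContDiffOn ℂ n (fun p => c p x) D)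
    (hs : ∀ p ∈ D, nrm 0 B (c p) ≤ 1 / 8) (x y : Site) :
    ContDiffOn ℂ n (fun p => Jphi ω B (c p) x y) D := by
  have hT := contDiffOn_Top (ω := ω) ⟨0, le_rfl⟩ hc
  have hR := contDiffOn_res hT fun p hp => norm_Top_le_half hω (hs p hp)
  refine ((coefOp ω hω x (Eop ω ⟨0, le_rfl⟩ y deltaZero)).contDiff.comp_contDiffOn
    ((contDiffOn_const (c := 1)).sub (hR.mul hR))).congr fun p hp => ?_
  exact Jphi_eq hω (σ := ⟨0, le_rfl⟩) (hs p hp) x y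

theorem contDiffOn_Lc (hΩ : ContDiffOn ℂ n Ω D) (x y : Site) :
    ContDiffOn ℂ n (fun p => Lc ω (Ω p) x y) D := by
  unfold Lc
  exact contDiffOn_const.add ((hΩ.sub contDiffOn_const).mul contDiffOn_const)

theorem contDiffOn_Fc (hω : 0 < ω) (hΩ : ContDiffOn ℂ n Ω D)
    (hc : ∀ x ∈ B, ContDiffOn ℂ n (fun p => c p x) D)
    (hs : ∀ p ∈ D, nrm 0 B (c p) ≤ 1 / 8) (x : Site) :
    ContDiffOn ℂ n (fun p => Fc ω B (Ω p) (c p) x) D :=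
  (ContDiffOn.sum fun y hy => (contDiffOn_Lc hΩ x y).mul (hc y hy)).add
    (contDiffOn_const.mul (contDiffOn_Phi hω hc hs x))

theorem contDiffOn_Jc (hω : 0 < ω) (hΩ : ContDiffOn ℂ n Ω D)
    (hc : ∀ x ∈ B, ContDiffOn ℂ n (fun p => c p x) D)
    (hs : ∀ p ∈ D, nrm 0 B (c p) ≤ 1 / 8) (x y : Site) :
    ContDiffOn ℂ n (fun p => Jc ω B (Ω p) (c p) x y) D :=
  (contDiffOn_Lc hΩ x y).add (contDiffOn_const.mul (contDiffOn_Jphi hω hc hs x y))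

end Smooth

end VortexFilament

end

/-! ### Reality of coefficients and termwise calculus for series in the eigenbasis. -/

noncomputable section

namespace VortexFilament

variable {ω : ℝ}

/-! ### Reality of the coefficients -/

/-- Functions with `g(t,θ) = g(t + 2π,θ) = ḡ(-t,θ)`. -/
structure IsRev (g : Fn) : Prop where
  per : ∀ t θ, g (t + 2 * Real.pi) θ = g t θ
  rev : ∀ t θ, (starRingEnd ℂ) (g (-t) θ) = g t θ

theorem IsRev.mul {g h : Fn} (hg : IsRev g) (hh : IsRev h) : IsRev fun t θ => g t θ * h t θ where
  per t θ := by rw [hg.per, hh.per]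
  rev t θ := by rw [map_mul, hg.rev, hh.rev]

theorem IsRev.conj {g : Fn} (hg : IsRev g) : IsRev fun t θ => (starRingEnd ℂ) (g t θ) where
  per t θ := by rw [hg.per]
  rev t θ := by rw [hg.rev]

theorem IsRev.comp {g : Fn} (hg : IsRev g) {φ : ℂ → ℂ}
    (hφ : ∀ z, (starRingEnd ℂ) (φ z) = φ ((starRingEnd ℂ) z)) : IsRev fun t θ => φ (g t θ) where
  per t θ := by rw [hg.per]
  rev t θ := by rw [hφ, hg.rev]

/-- Conjugation replaces `t` by `-t`, and a periodic function has the same integral over `[-2π, 0]`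
and `[0, 2π]`. -/
theorem IsRev.conj_avg {g : Fn} (hg : IsRev g) : (starRingEnd ℂ) (avg g) = avg g := by
  have h1 : (starRingEnd ℂ) (∫ t in (0 : ℝ)..2 * Real.pi, ∫ θ in (0 : ℝ)..2 * Real.pi, g t θ)
      = ∫ t in (0 : ℝ)..2 * Real.pi, ∫ θ in (0 : ℝ)..2 * Real.pi, g t θ := by
    rw [← intervalIntegral.intervalIntegral_conj]
    simp only [← intervalIntegral.intervalIntegral_conj]
    have h2 : ∀ t θ, (starRingEnd ℂ) (g t θ) = g (-t) θ := fun t θ => by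
      have := hg.rev (-t) θ
      rwa [neg_neg] at this
    simp only [h2]
    rw [intervalIntegral.integral_comp_neg
      (fun t => ∫ θ in (0 : ℝ)..2 * Real.pi, g t θ)]
    have hp : Function.Periodic (fun t => ∫ θ in (0 : ℝ)..2 * Real.pi, g t θ) (2 * Real.pi) :=
      fun t => by simp only [hg.per]
    have := hp.intervalIntegral_add_eq (-(2 * Real.pi)) 0
    simpa using this
  rw [avg, map_mul, h1]
  congr 1
  simp [map_ofNat]

theorem cos_nat_mul_add (n : ℕ) (t : ℝ) : Real.cos (n * (t + 2 * Real.pi)) = Real.cos (n * t) := by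
  rw [mul_add, Real.cos_add_nat_mul_two_pi]

theorem sin_nat_mul_add (n : ℕ) (t : ℝ) : Real.sin (n * (t + 2 * Real.pi)) = Real.sin (n * t) := by
  rw [mul_add, Real.sin_add_nat_mul_two_pi]

theorem isSym_trig (x : Site) (a b : ℝ) : IsSym (trig x a b) where
  cont := jointCont_trig x a b
  per_t t θ := by simp only [trig, cos_nat_mul_add, sin_nat_mul_add]
  per_θ t θ := by simp only [trig, cos_nat_mul_add]
  even_θ t θ := by simp only [trig, mul_neg, Real.cos_neg]
  rev t θ := by
    rw [conj_trig]
    simp only [trig, mul_neg, Real.cos_neg, Real.sin_neg, neg_mul, neg_neg]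

theorem IsSym.isRev {g : Fn} (h : IsSym g) : IsRev g := ⟨h.per_t, h.rev⟩

theorem isRev_e0 (x : Site) : IsRev (e0 ω x) := (isSym_trig _ _ _).isRev

/-- The average is real, so the real part in `coef` discards nothing. -/
theorem IsRev.ip_eq_coef {g : Fn} (hg : IsRev g) (x : Site) : ip g (e0 ω x) = coef ω g x := by
  rw [coef]
  have := (hg.mul (isRev_e0 x).conj).conj_avg (g := fun t θ => g t θ *
    (starRingEnd ℂ) (e0 ω x t θ))
  rw [← ip_eq_avg] at this
  exact (Complex.conj_eq_iff_re.1 this).symm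

/-! ### Series in the eigenbasis -/

/-- The function with coefficients `c`. -/
def synth (ω : ℝ) (c : Site → ℝ) : Fn := fun t θ => ∑' x, (c x : ℂ) * e0 ω x t θ

/-- Coefficients for which `L(Ω)` may be applied termwise. -/
def Decay (c : Site → ℝ) : Prop := Summable fun x : Site => |c x| * (1 + x.j + x.k) ^ 2

theorem one_le_size (x : Site) : (1 : ℝ) ≤ 1 + x.j + x.k := by
  have : (0 : ℝ) ≤ x.j := Nat.cast_nonneg _
  have : (0 : ℝ) ≤ x.k := Nat.cast_nonneg _
  linarith

theorem Decay.summable {c : Site → ℝ} (hc : Decay c) : Summable fun x => |c x| :=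
  hc.of_nonneg_of_le (fun _ => abs_nonneg _) fun x =>
    le_mul_of_one_le_right (abs_nonneg _) (one_le_pow₀ (one_le_size x))

theorem Decay.sub {c d : Site → ℝ} (hc : Decay c) (hd : Decay d) : Decay (c - d) := by
  refine (Summable.add hc hd).of_nonneg_of_le (fun x => by positivity) fun x => ?_
  rw [← add_mul]
  exact mul_le_mul_of_nonneg_right (abs_sub _ _) (by positivity)

theorem decay_of_support {c : Site → ℝ} {B : Finset Site} (h : ∀ x ∉ B, c x = 0) : Decay c :=
  summable_of_ne_finset_zero (s := B) fun x hx => by rw [h x hx, abs_zero, zero_mul]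

theorem norm_mul_e0_le (hω : 0 < ω) (a : ℝ) (x : Site) (t θ : ℝ) :
    ‖(a : ℂ) * e0 ω x t θ‖ ≤ |a| * 4 := by
  rw [norm_mul, Complex.norm_real]
  exact mul_le_mul_of_nonneg_left (norm_e0_le hω x t θ) (abs_nonneg _)

theorem summable_synth (hω : 0 < ω) {c : Site → ℝ} (hc : Summable fun x => |c x|) (t θ : ℝ) :
    Summable fun x => (c x : ℂ) * e0 ω x t θ :=
  Summable.of_norm_bounded (hc.mul_right 4) fun x => norm_mul_e0_le hω _ x t θ

theorem norm_synth_le (hω : 0 < ω) {c : Site → ℝ} (hc : Summable fun x => |c x|) (t θ : ℝ) :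
    ‖synth ω c t θ‖ ≤ 4 * ∑' x, |c x| := by
  refine (tsum_of_norm_bounded (hc.mul_right 4).hasSum fun x => norm_mul_e0_le hω _ x t θ).trans ?_
  rw [tsum_mul_right, mul_comm]

theorem synth_add (hω : 0 < ω) {c d : Site → ℝ} (hc : Summable fun x => |c x|)
    (hd : Summable fun x => |d x|) : synth ω (c + d) = synth ω c + synth ω d := by
  funext t θ
  rw [Pi.add_apply, Pi.add_apply, synth, synth, synth,
    ← (summable_synth hω hc t θ).tsum_add (summable_synth hω hd t θ)]
  refine tsum_congr fun x => ?_
  rw [Pi.add_apply]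
  push_cast
  ring

theorem synth_sub (hω : 0 < ω) {c d : Site → ℝ} (hc : Summable fun x => |c x|)
    (hd : Summable fun x => |d x|) : synth ω (c - d) = synth ω c - synth ω d := by
  funext t θ
  rw [Pi.sub_apply, Pi.sub_apply, synth, synth, synth,
    ← (summable_synth hω hc t θ).tsum_sub (summable_synth hω hd t θ)]
  refine tsum_congr fun x => ?_
  rw [Pi.sub_apply]
  push_cast
  ring

theorem synth_eq_sum {c : Site → ℝ} {B : Finset Site} (h : ∀ x ∉ B, c x = 0) (t θ : ℝ) :
    synth ω c t θ = ∑ x ∈ B, (c x : ℂ) * e0 ω x t θ :=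
  tsum_eq_sum fun x hx => by rw [h x hx, Complex.ofReal_zero, zero_mul]

theorem isSym_synth (hω : 0 < ω) {c : Site → ℝ} (hc : Summable fun x => |c x|) :
    IsSym (synth ω c) where
  cont := continuous_tsum (u := fun x => |c x| * 4)
    (fun x => Continuous.mul continuous_const (jointCont_e0 x)) (hc.mul_right 4)
    fun x q => norm_mul_e0_le hω _ x _ _
  per_t t θ := tsum_congr fun x => by rw [e0_eq_trig, (isSym_trig _ _ _).per_t]
  per_θ t θ := tsum_congr fun x => by rw [e0_eq_trig, (isSym_trig _ _ _).per_θ]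
  even_θ t θ := tsum_congr fun x => by rw [e0_eq_trig, (isSym_trig _ _ _).even_θ]
  rev t θ := by
    rw [synth, synth, Complex.conj_tsum]
    refine tsum_congr fun x => ?_
    rw [map_mul, Complex.conj_ofReal, e0_eq_trig, (isSym_trig _ _ _).rev]

theorem hasSum_ip {g : Site → Fn} {C : Site → ℝ} (hω : 0 < ω) (hg : ∀ y, JointCont (g y))
    (hC : Summable C) (hb : ∀ y t θ, ‖g y t θ‖ ≤ C y) (x : Site) :
    HasSum (fun y => ip (g y) (e0 ω x)) (ip (fun t θ => ∑' y, g y t θ) (e0 ω x)) := by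
  have h := hasSum_avg (g := fun y t θ => g y t θ * (starRingEnd ℂ) (e0 ω x t θ))
    (C := fun y => C y * 4) (fun y => (hg y).mul (jointCont_e0 x).conj) (hC.mul_right 4)
    fun y t θ => by
      rw [norm_mul, RCLike.norm_conj]
      exact mul_le_mul (hb y t θ) (norm_e0_le hω x t θ) (norm_nonneg _)
        ((norm_nonneg _).trans (hb y t θ))
  simp only [tsum_mul_right] at h
  exact h

theorem ip_const_mul (c : ℂ) (g v : Fn) : ip (fun t θ => c * g t θ) v = c * ip g v := by
  rw [ip_eq_avg, ip_eq_avg, ← avg_const_mul]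
  simp only [mul_assoc]

theorem ip_synth (hω : 0 < ω) {c : Site → ℝ} (hc : Summable fun x => |c x|) (x : Site) :
    ip (synth ω c) (e0 ω x) = c x := by
  have h := hasSum_ip hω (g := fun y t θ => (c y : ℂ) * e0 ω y t θ)
    (fun y => Continuous.mul continuous_const (jointCont_e0 y)) (hc.mul_right 4)
    (fun y t θ => norm_mul_e0_le hω _ y t θ) x
  simp only [ip_const_mul, ip_e0_e0 hω] at h
  change HasSum _ (ip (synth ω c) (e0 ω x)) at h
  rw [← h.tsum_eq, tsum_eq_single x]
  · simp
  · intro y hy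
    simp [hy.symm]

theorem coef_synth (hω : 0 < ω) {c : Site → ℝ} (hc : Summable fun x => |c x|) (x : Site) :
    coef ω (synth ω c) x = c x := by
  rw [coef, ip_synth hω hc, Complex.ofReal_re]

theorem size_bounds (x : Site) : (1 : ℝ) ≤ (1 + x.j + x.k) ^ 2 ∧
    (x.j : ℝ) ≤ (1 + x.j + x.k) ^ 2 ∧ (x.k : ℝ) ≤ (1 + x.j + x.k) ^ 2 ∧
    (x.k : ℝ) ^ 2 ≤ (1 + x.j + x.k) ^ 2 := by
  have h1 : (0 : ℝ) ≤ x.j := Nat.cast_nonneg _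
  have h2 : (0 : ℝ) ≤ x.k := Nat.cast_nonneg _
  refine ⟨?_, ?_, ?_, ?_⟩ <;> nlinarith [mul_nonneg h1 h2]

theorem norm_linOp_e0_le (hω : 0 < ω) (Ω : ℝ) (x : Site) (t θ : ℝ) :
    ‖linOp ω Ω (e0 ω x) t θ‖ ≤ 4 * (|Ω| + 1 + ω) * (1 + x.j + x.k) ^ 2 := by
  rw [e0_eq_trig, linOp_trig]
  refine (norm_trig_le _ _ _ _ _).trans ?_
  obtain ⟨h0, h1, -, h3⟩ := size_bounds x
  have hA := abs_vA_le hω x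
  have hB := abs_vB_le hω x
  have e1 : |Ω * x.j * vB ω x + x.k ^ 2 * vA ω x + 2 * ω * vA ω x|
      ≤ |Ω| * x.j + x.k ^ 2 + 2 * ω := by
    refine (abs_add_three _ _ _).trans ?_
    simp only [abs_mul, abs_pow, Nat.abs_cast, abs_two, abs_of_pos hω]
    exact add_le_add_three (mul_le_of_le_one_right (by positivity) hB)
      (mul_le_of_le_one_right (by positivity) hA) (mul_le_of_le_one_right (by positivity) hA)
  have e2 : |Ω * x.j * vA ω x + x.k ^ 2 * vB ω x| ≤ |Ω| * x.j + x.k ^ 2 := by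
    refine (abs_add_le _ _).trans ?_
    simp only [abs_mul, abs_pow, Nat.abs_cast]
    exact add_le_add (mul_le_of_le_one_right (by positivity) hA)
      (mul_le_of_le_one_right (by positivity) hB)
  have e3 : |Ω| * x.j ≤ |Ω| * (1 + x.j + x.k) ^ 2 :=
    mul_le_mul_of_nonneg_left h1 (abs_nonneg _)
  have e4 : ω * 1 ≤ ω * (1 + x.j + x.k) ^ 2 := mul_le_mul_of_nonneg_left h0 hω.le
  linarith

theorem jointCont_linOp_e0 (Ω : ℝ) (x : Site) : JointCont (linOp ω Ω (e0 ω x)) := by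
  rw [e0_eq_trig, linOp_trig]
  exact jointCont_trig _ _ _

theorem mul_size_bound {c : ℝ} {x : Site} {a : ℂ} {C : ℝ}
    (h : ‖a‖ ≤ C * (1 + x.j + x.k) ^ 2) :
    ‖(c : ℂ) * a‖ ≤ |c| * (1 + x.j + x.k) ^ 2 * C := by
  rw [norm_mul, Complex.norm_real, Real.norm_eq_abs, mul_assoc, mul_comm _ C]
  exact mul_le_mul_of_nonneg_left h (abs_nonneg _)

/-- Termwise differentiation is justified by a majorant uniform in `(t, θ)`: the weight `(1+j+k)²`
in `Decay` pays for one derivative in `t` and two in `θ`. -/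
theorem linOp_synth (hω : 0 < ω) (Ω : ℝ) {c : Site → ℝ} (hc : Decay c) (t θ : ℝ) :
    linOp ω Ω (synth ω c) t θ = ∑' x, (c x : ℂ) * linOp ω Ω (e0 ω x) t θ := by
  have hu : Summable fun x : Site => |c x| * (1 + x.j + x.k) ^ 2 * 4 := Summable.mul_right 4 hc
  have hs := summable_synth hω hc.summable
  have hAB : ∀ x, |vA ω x| + |vB ω x| ≤ 2 := fun x => by
    linarith [abs_vA_le hω x, abs_vB_le hω x]
  have b1 : ∀ x t, ‖(c x : ℂ) * (Complex.I * trig x (x.j * vB ω x) (x.j * vA ω x) t θ)‖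
      ≤ |c x| * (1 + x.j + x.k) ^ 2 * 4 := fun x t => mul_size_bound (by
    rw [norm_mul, Complex.norm_I, one_mul]
    refine (norm_trig_le _ _ _ _ _).trans ?_
    rw [abs_mul, abs_mul, Nat.abs_cast]
    obtain ⟨-, h1, -, -⟩ := size_bounds x
    have : (x.j : ℝ) * (|vA ω x| + |vB ω x|) ≤ x.j * 2 :=
      mul_le_mul_of_nonneg_left (hAB x) (Nat.cast_nonneg _)
    linarith)
  have d1 : HasDerivAt (fun t' => synth ω c t' θ)
      (∑' x, (c x : ℂ) * (Complex.I * trig x (x.j * vB ω x) (x.j * vA ω x) t θ)) t :=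
    hasDerivAt_tsum hu (fun x t => (hasDerivAt_trig_t x (vA ω x) (vB ω x) t θ).const_mul (c x : ℂ))
      b1 (hs 0 θ) t
  have b2 : ∀ x θ, ‖(c x : ℂ) * (-(x.k : ℂ) * ((amp x : ℂ) * ((vA ω x * Real.cos (x.j * t) : ℝ)
      + Complex.I * (vB ω x * Real.sin (x.j * t) : ℝ)) * (Real.sin (x.k * θ) : ℝ)))‖
      ≤ |c x| * (1 + x.j + x.k) ^ 2 * 4 := fun x θ => mul_size_bound (by
    rw [norm_mul, norm_neg, Complex.norm_natCast]
    obtain ⟨-, -, h1, -⟩ := size_bounds x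
    have h2 := norm_trig_sin_le x (vA ω x) (vB ω x) t θ
    calc _ ≤ (x.k : ℝ) * (2 * (|vA ω x| + |vB ω x|)) :=
          mul_le_mul_of_nonneg_left h2 (Nat.cast_nonneg _)
      _ ≤ x.k * 4 := mul_le_mul_of_nonneg_left (by linarith [hAB x]) (Nat.cast_nonneg _)
      _ ≤ _ := by linarith)
  have d2 : ∀ θ, HasDerivAt (fun θ' => synth ω c t θ')
      (∑' x, (c x : ℂ) * (-(x.k : ℂ) * ((amp x : ℂ) * ((vA ω x * Real.cos (x.j * t) : ℝ)
      + Complex.I * (vB ω x * Real.sin (x.j * t) : ℝ)) * (Real.sin (x.k * θ) : ℝ)))) θ :=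
    hasDerivAt_tsum hu (fun x θ => (hasDerivAt_trig_θ x (vA ω x) (vB ω x) t θ).const_mul (c x : ℂ))
      b2 (hs t 0)
  have b3 : ∀ x θ, ‖(c x : ℂ) * (-(x.k : ℂ) ^ 2 * trig x (vA ω x) (vB ω x) t θ)‖
      ≤ |c x| * (1 + x.j + x.k) ^ 2 * 4 := fun x θ => mul_size_bound (by
    rw [norm_mul, norm_neg, norm_pow, Complex.norm_natCast]
    obtain ⟨-, -, -, h1⟩ := size_bounds x
    have h2 := norm_trig_le x (vA ω x) (vB ω x) t θ
    calc _ ≤ (x.k : ℝ) ^ 2 * (2 * (|vA ω x| + |vB ω x|)) :=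
          mul_le_mul_of_nonneg_left h2 (by positivity)
      _ ≤ x.k ^ 2 * 4 := mul_le_mul_of_nonneg_left (by linarith [hAB x]) (by positivity)
      _ ≤ _ := by linarith)
  have d3 : HasDerivAt (fun θ => ∑' x, (c x : ℂ) * (-(x.k : ℂ) * ((amp x : ℂ) *
      ((vA ω x * Real.cos (x.j * t) : ℝ) + Complex.I * (vB ω x * Real.sin (x.j * t) : ℝ)) *
      (Real.sin (x.k * θ) : ℝ)))) (∑' x, (c x : ℂ) * (-(x.k : ℂ) ^ 2 * trig x (vA ω x) (vB ω x) t θ))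
      θ :=
    hasDerivAt_tsum hu
      (fun x θ => (hasDerivAt_trig_θθ x (vA ω x) (vB ω x) t θ).const_mul (c x : ℂ))
      b3 (Summable.of_norm_bounded hu fun x => b2 x 0) θ
  have h2 : iteratedDeriv 2 (fun θ' => synth ω c t θ') θ
      = ∑' x, (c x : ℂ) * (-(x.k : ℂ) ^ 2 * trig x (vA ω x) (vB ω x) t θ) := by
    rw [iteratedDeriv_succ, iteratedDeriv_one]
    have : deriv (fun θ' => synth ω c t θ') = _ := funext fun θ' => (d2 θ').deriv
    rw [this, d3.deriv]
  have s1 := (Summable.of_norm_bounded hu fun x => b1 x t).mul_left (-Complex.I * Ω)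
  have s3 := Summable.of_norm_bounded hu fun x => b3 x θ
  have s5 : Summable fun x => (starRingEnd ℂ) ((c x : ℂ) * e0 ω x t θ) :=
    (Complex.conjCLE.summable).2 (hs t θ)
  have s4 : Summable fun x => (ω : ℂ) * ((c x : ℂ) * e0 ω x t θ
      + (starRingEnd ℂ) ((c x : ℂ) * e0 ω x t θ)) :=
    ((hs t θ).add s5).mul_left _
  have e4 : (ω : ℂ) * (synth ω c t θ + (starRingEnd ℂ) (synth ω c t θ))
      = ∑' x, (ω : ℂ) * ((c x : ℂ) * e0 ω x t θ + (starRingEnd ℂ) ((c x : ℂ) * e0 ω x t θ)) := by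
    rw [synth, Complex.conj_tsum, ← (hs t θ).tsum_add s5, tsum_mul_left]
  rw [linOp, d1.deriv, h2, e4, ← tsum_mul_left, ← s1.tsum_sub s3, ← (s1.sub s3).tsum_add s4]
  refine tsum_congr fun x => ?_
  rw [linOp, e0_eq_trig, (hasDerivAt_trig_t x _ _ t θ).deriv, iteratedDeriv_two_trig, map_mul,
    Complex.conj_ofReal]
  ring

theorem linOp_term_le (hω : 0 < ω) (Ω : ℝ) (c : Site → ℝ) (x : Site) (t θ : ℝ) :
    ‖(c x : ℂ) * linOp ω Ω (e0 ω x) t θ‖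
      ≤ |c x| * (1 + x.j + x.k) ^ 2 * (4 * (|Ω| + 1 + ω)) :=
  mul_size_bound (norm_linOp_e0_le hω Ω x t θ)

theorem jointCont_linOp_synth (hω : 0 < ω) (Ω : ℝ) {c : Site → ℝ} (hc : Decay c) :
    JointCont (linOp ω Ω (synth ω c)) := by
  have : linOp ω Ω (synth ω c) = fun t θ => ∑' x, (c x : ℂ) * linOp ω Ω (e0 ω x) t θ := by
    funext t θ
    exact linOp_synth hω Ω hc t θ
  rw [this]
  exact continuous_tsum (fun x => Continuous.mul continuous_const (jointCont_linOp_e0 Ω x))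
    (Summable.mul_right _ hc) fun x q => linOp_term_le hω Ω c x _ _

theorem hasSum_ip_linOp_synth (hω : 0 < ω) (Ω : ℝ) {c : Site → ℝ} (hc : Decay c) (x : Site) :
    HasSum (fun y => Lc ω Ω x y * c y) (ip (linOp ω Ω (synth ω c)) (e0 ω x)) := by
  have : linOp ω Ω (synth ω c) = fun t θ => ∑' x, (c x : ℂ) * linOp ω Ω (e0 ω x) t θ := by
    funext t θ
    exact linOp_synth hω Ω hc t θ
  rw [this]
  have h := hasSum_ip hω (g := fun y t θ => (c y : ℂ) * linOp ω Ω (e0 ω y) t θ)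
    (fun y => Continuous.mul continuous_const (jointCont_linOp_e0 Ω y))
    (Summable.mul_right _ hc) (fun y t θ => linOp_term_le hω Ω c y t θ) x
  simp only [ip_const_mul, ip_linOp_e0 hω] at h
  simpa only [mul_comm] using h

end VortexFilament

end

/-! ### The real equation as the restriction of the holomorphic one; Lipschitz dependence on
coefficients. -/

noncomputable section

namespace VortexFilament

variable {ω : ℝ}

/-! ### The equation for real coefficients -/

/-- The nonlinear part `ū² / (1 + ū)`. -/
def nonlin (u : Fn) : Fn := fun t θ =>
  (starRingEnd ℂ) (u t θ) ^ 2 / (1 + (starRingEnd ℂ) (u t θ))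

theorem one_add_ne_zero {z : ℂ} (hz : ‖z‖ ≤ 1 / 2) : 1 + z ≠ 0 := by
  intro h
  have : z = -1 := by linear_combination h
  rw [this, norm_neg, norm_one] at hz
  norm_num at hz

theorem jointCont_nonlin {u : Fn} (hu : JointCont u) (hs : ∀ t θ, ‖u t θ‖ ≤ 1 / 2) :
    JointCont (nonlin u) :=
  Continuous.div (hu.conj.pow 2) (continuous_const.add hu.conj) fun q =>
    one_add_ne_zero (by rw [RCLike.norm_conj]; exact hs _ _)

theorem isRev_nonlin {u : Fn} (hu : IsRev u) : IsRev (nonlin u) :=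
  hu.conj.comp (φ := fun z => z ^ 2 / (1 + z)) fun z => by simp

theorem isRev_linOp_synth (hω : 0 < ω) (Ω : ℝ) {c : Site → ℝ} (hc : Decay c) :
    IsRev (linOp ω Ω (synth ω c)) where
  per t θ := by
    rw [linOp_synth hω Ω hc, linOp_synth hω Ω hc]
    refine tsum_congr fun x => ?_
    rw [e0_eq_trig, linOp_trig, (isSym_trig _ _ _).per_t]
  rev t θ := by
    rw [linOp_synth hω Ω hc, linOp_synth hω Ω hc, Complex.conj_tsum]
    refine tsum_congr fun x => ?_
    rw [map_mul, Complex.conj_ofReal, e0_eq_trig, linOp_trig, (isSym_trig _ _ _).rev]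

theorem IsRev.add {g h : Fn} (hg : IsRev g) (hh : IsRev h) : IsRev fun t θ => g t θ + h t θ where
  per t θ := by rw [hg.per, hh.per]
  rev t θ := by rw [map_add, hg.rev, hh.rev]

theorem IsRev.const_mul {g : Fn} (hg : IsRev g) (a : ℝ) : IsRev fun t θ => (a : ℂ) * g t θ where
  per t θ := by rw [hg.per]
  rev t θ := by rw [map_mul, hg.rev, Complex.conj_ofReal]

theorem ip_add_const_mul {g h : Fn} (hg : JointCont g) (hh : JointCont h) (a : ℂ) (x : Site) :
    ip (fun t θ => g t θ + a * h t θ) (e0 ω x) = ip g (e0 ω x) + a * ip h (e0 ω x) := by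
  rw [← ip_const_mul, ip_eq_avg, ip_eq_avg, ip_eq_avg, ← avg_add (hg.mul (jointCont_e0 x).conj)
    (JointCont.mul (g := fun t θ => a * h t θ) (Continuous.mul continuous_const hh)
      (jointCont_e0 x).conj)]
  simp only [add_mul]

/-- The coefficients of `f(u)` for a small convergent series `u`. -/
theorem coef_f_synth (hω : 0 < ω) (Ω : ℝ) {c : Site → ℝ} (hc : Decay c)
    (hs : 4 * ∑' x, |c x| ≤ 1 / 2) (x : Site) :
    (coef ω (f ω Ω (synth ω c)) x : ℂ)
      = ip (linOp ω Ω (synth ω c)) (e0 ω x) + ω * ip (nonlin (synth ω c)) (e0 ω x) := by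
  have hu := isSym_synth hω hc.summable
  have hb : ∀ t θ, ‖synth ω c t θ‖ ≤ 1 / 2 := fun t θ => (norm_synth_le hω hc.summable t θ).trans hs
  rw [← ip_add_const_mul (jointCont_linOp_synth hω Ω hc) (jointCont_nonlin hu.cont hb)]
  exact (((isRev_linOp_synth hω Ω hc).add ((isRev_nonlin hu.isRev).const_mul ω)).ip_eq_coef x).symm

theorem nrm_zero_eq (B : Finset Site) (c : Site → ℝ) :
    nrm 0 B (fun x => (c x : ℂ)) = ∑ x ∈ B, |c x| := by
  simp [nrm, wS]

/-- For real coefficients the conjugate depends complex-linearly on them. This allows an equation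
that contains `ū` to be complexified. -/
theorem conj_synth_eq_ubar {c : Site → ℝ} {B : Finset Site} (h : ∀ x ∉ B, c x = 0) (t θ : ℝ) :
    (starRingEnd ℂ) (synth ω c t θ) = ubar ω B (fun x => (c x : ℂ)) t θ := by
  rw [synth_eq_sum h, map_sum, ubar]
  exact Finset.sum_congr rfl fun x _ => by rw [map_mul, Complex.conj_ofReal]

theorem tsum_abs_le {c : Site → ℝ} {B : Finset Site} (h : ∀ x ∉ B, c x = 0)
    (hs : nrm 0 B (fun x => (c x : ℂ)) ≤ 1 / 8) : 4 * ∑' x, |c x| ≤ 1 / 2 := by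
  rw [tsum_eq_sum (s := B) fun x hx => by rw [h x hx, abs_zero], ← nrm_zero_eq]
  linarith

theorem coef_f_eq_Fc (hω : 0 < ω) (Ω : ℝ) {c : Site → ℝ} {B : Finset Site}
    (h : ∀ x ∉ B, c x = 0) (hs : nrm 0 B (fun x => (c x : ℂ)) ≤ 1 / 8) (x : Site) :
    (coef ω (f ω Ω (synth ω c)) x : ℂ) = Fc ω B Ω (fun x => (c x : ℂ)) x := by
  have hd := decay_of_support h
  rw [coef_f_synth hω Ω hd (tsum_abs_le h hs), Fc,
    ← (hasSum_ip_linOp_synth hω Ω hd x).tsum_eq, tsum_eq_sum (s := B) fun y hy => by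
      rw [h y hy, Complex.ofReal_zero, mul_zero]]
  congr 2
  rw [Phi]
  congr 1
  funext t θ
  rw [nonlin, conj_synth_eq_ubar h]

theorem jac_eq_Jc (hω : 0 < ω) (Ω : ℝ) {c : Site → ℝ} {B : Finset Site}
    (h : ∀ x ∉ B, c x = 0) (hs : nrm 0 B (fun x => (c x : ℂ)) ≤ 1 / 8) (x y : Site) :
    (coef ω (df ω Ω (synth ω c) (e0 ω y)) x : ℂ) = Jc ω B Ω (fun x => (c x : ℂ)) x y := by
  have hd := decay_of_support h
  have hu := isSym_synth hω hd.summable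
  have hb : ∀ t θ, ‖synth ω c t θ‖ ≤ 1 / 2 := fun t θ =>
    (norm_synth_le hω hd.summable t θ).trans (tsum_abs_le h hs)
  have hcont : JointCont fun t θ => (2 * (starRingEnd ℂ) (synth ω c t θ)
      + (starRingEnd ℂ) (synth ω c t θ) ^ 2) / (1 + (starRingEnd ℂ) (synth ω c t θ)) ^ 2
        * (starRingEnd ℂ) (e0 ω y t θ) :=
    JointCont.mul (Continuous.div
      ((continuous_const.mul (JointCont.conj hu.cont)).add ((JointCont.conj hu.cont).pow 2))
      ((continuous_const.add (JointCont.conj hu.cont)).pow 2) fun q =>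
        pow_ne_zero 2 (one_add_ne_zero (by rw [RCLike.norm_conj]; exact hb _ _)))
      (jointCont_e0 y).conj
  have hrev : IsRev fun t θ => (2 * (starRingEnd ℂ) (synth ω c t θ)
      + (starRingEnd ℂ) (synth ω c t θ) ^ 2) / (1 + (starRingEnd ℂ) (synth ω c t θ)) ^ 2
        * (starRingEnd ℂ) (e0 ω y t θ) :=
    (hu.isRev.conj.comp (φ := fun z => (2 * z + z ^ 2) / (1 + z) ^ 2)
      fun z => by simp [map_ofNat]).mul (isRev_e0 y).conj
  have hlin : IsRev (linOp ω Ω (e0 ω y)) := by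
    rw [e0_eq_trig, linOp_trig]
    exact (isSym_trig _ _ _).isRev
  have h1 := (hlin.add (hrev.const_mul ω)).ip_eq_coef (ω := ω) x
  rw [ip_add_const_mul (jointCont_linOp_e0 Ω y) hcont, ip_linOp_e0 hω] at h1
  rw [Jc, Jphi]
  simp only [← conj_synth_eq_ubar h]
  exact h1.symm

/-! ### Continuity in the coefficients -/

/-- The difference factors as `(z-w)(1 - (1+z)⁻¹(1+w)⁻¹)`. Both inverses are bounded by `2`, hence
the constant `1 + 2 · 2`. -/
theorem norm_nonlin_sub_le {z w : ℂ} (hz : ‖z‖ ≤ 1 / 2) (hw : ‖w‖ ≤ 1 / 2) :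
    ‖z ^ 2 / (1 + z) - w ^ 2 / (1 + w)‖ ≤ 5 * ‖z - w‖ := by
  have h1 := one_add_ne_zero hz
  have h2 := one_add_ne_zero hw
  have e1 : z ^ 2 / (1 + z) - w ^ 2 / (1 + w) = (z - w) * (1 - (1 + z)⁻¹ * (1 + w)⁻¹) := by
    field_simp
    ring
  have hinv : ∀ {a : ℂ}, ‖a‖ ≤ 1 / 2 → ‖(1 + a)⁻¹‖ ≤ 2 := by
    intro a ha
    rw [norm_inv]
    have h3 : 1 / 2 ≤ ‖1 + a‖ := by
      have := norm_sub_le (1 + a) a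
      rw [add_sub_cancel_right, norm_one] at this
      linarith
    calc _ ≤ (1 / 2 : ℝ)⁻¹ := inv_anti₀ (by norm_num) h3
      _ = 2 := by norm_num
  have h5 : ‖1 - (1 + z)⁻¹ * (1 + w)⁻¹‖ ≤ 5 := by
    refine (norm_sub_le _ _).trans ?_
    rw [norm_one, norm_mul]
    have := mul_le_mul (hinv hz) (hinv hw) (norm_nonneg _) zero_le_two
    linarith
  rw [e1, norm_mul, mul_comm]
  exact mul_le_mul_of_nonneg_right h5 (norm_nonneg _)

theorem norm_Lc_le (hω : 0 < ω) (Ω : ℂ) (x y : Site) :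
    ‖Lc ω Ω x y‖ ≤ |lam ω x| + ‖Ω - Omega0 ω‖ * (2 * x.j) := by
  rw [Lc]
  refine (norm_add_le _ _).trans (add_le_add ?_ ?_)
  · split_ifs with h
    · rw [h, Complex.norm_real, Real.norm_eq_abs]
    · rw [norm_zero]
      exact abs_nonneg _
  · rw [norm_mul, Complex.norm_real, Real.norm_eq_abs]
    refine mul_le_mul_of_nonneg_left ?_ (norm_nonneg _)
    by_cases h : x.j = y.j
    · have := cpl_le hω 0 x y
      simpa [wS, h] using this
    · rw [cpl, if_neg (fun h' => h h'.1), abs_zero]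
      positivity

theorem ip_sub {g h : Fn} (hg : JointCont g) (hh : JointCont h) (x : Site) :
    ip (fun t θ => g t θ - h t θ) (e0 ω x) = ip g (e0 ω x) - ip h (e0 ω x) := by
  have := ip_add_const_mul (ω := ω) hg hh (-1) x
  simpa only [neg_mul, one_mul, ← sub_eq_add_neg] using this

theorem norm_ip_le (hω : 0 < ω) {g : Fn} {C : ℝ} (h : ∀ t θ, ‖g t θ‖ ≤ C) (x : Site) :
    ‖ip g (e0 ω x)‖ ≤ C * 4 := by
  rw [ip_eq_avg]
  refine norm_avg_le fun t θ => ?_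
  rw [norm_mul, RCLike.norm_conj]
  exact mul_le_mul (h t θ) (norm_e0_le hω x t θ) (norm_nonneg _) ((norm_nonneg _).trans (h t θ))

/-- Although `L(Ω)` is unbounded, its row at a fixed site meets only sites with the same `(j,k)` and
has bounded entries. So an `ℓ¹` distance controls each single coefficient, which suffices for
passing to the limit in the range equation. -/
theorem exists_abs_coef_f_sub_le (hω : 0 < ω) (Ω : ℝ) (x : Site) :
    ∃ K : ℝ, ∀ c d : Site → ℝ, Decay c → Decay d → 4 * ∑' x, |c x| ≤ 1 / 2 →
      4 * ∑' x, |d x| ≤ 1 / 2 →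
      |coef ω (f ω Ω (synth ω c)) x - coef ω (f ω Ω (synth ω d)) x| ≤ K * ∑' x, |c x - d x| := by
  refine ⟨|lam ω x| + ‖(Ω : ℂ) - Omega0 ω‖ * (2 * x.j) + ω * (5 * 4 * 4),
    fun c d hc hd hcs hds => ?_⟩
  have hcd := (hc.sub hd).summable
  have hb : ∀ {c : Site → ℝ}, Decay c → 4 * ∑' x, |c x| ≤ 1 / 2 → ∀ t θ, ‖synth ω c t θ‖ ≤ 1 / 2 :=
    fun hc hcs t θ => (norm_synth_le hω hc.summable t θ).trans hcs
  rw [← Real.norm_eq_abs, ← Complex.norm_real, Complex.ofReal_sub, coef_f_synth hω Ω hc hcs,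
    coef_f_synth hω Ω hd hds]
  have h1 : ‖ip (linOp ω Ω (synth ω c)) (e0 ω x) - ip (linOp ω Ω (synth ω d)) (e0 ω x)‖
      ≤ (|lam ω x| + ‖(Ω : ℂ) - Omega0 ω‖ * (2 * x.j)) * ∑' x, |c x - d x| := by
    have hs := (hasSum_ip_linOp_synth hω Ω hc x).sub (hasSum_ip_linOp_synth hω Ω hd x)
    rw [← hs.tsum_eq, ← tsum_mul_left]
    refine tsum_of_norm_bounded (hcd.mul_left _).hasSum fun y => ?_
    rw [← mul_sub, ← Complex.ofReal_sub, norm_mul, Complex.norm_real]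
    exact mul_le_mul_of_nonneg_right (norm_Lc_le hω Ω x y) (norm_nonneg _)
  have h2 : ‖ip (nonlin (synth ω c)) (e0 ω x) - ip (nonlin (synth ω d)) (e0 ω x)‖
      ≤ 5 * (4 * ∑' x, |c x - d x|) * 4 := by
    rw [← ip_sub (jointCont_nonlin (isSym_synth hω hc.summable).cont (hb hc hcs))
      (jointCont_nonlin (isSym_synth hω hd.summable).cont (hb hd hds))]
    refine norm_ip_le hω (fun t θ => ?_) x
    have h3 := norm_nonlin_sub_le (z := (starRingEnd ℂ) (synth ω c t θ))
      (w := (starRingEnd ℂ) (synth ω d t θ)) (by rw [RCLike.norm_conj]; exact hb hc hcs t θ)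
      (by rw [RCLike.norm_conj]; exact hb hd hds t θ)
    rw [← map_sub, RCLike.norm_conj] at h3
    refine h3.trans (mul_le_mul_of_nonneg_left ?_ (by norm_num))
    have h4 := norm_synth_le hω hcd t θ
    rwa [synth_sub hω hc.summable hd.summable] at h4
  calc _ = ‖(ip (linOp ω Ω (synth ω c)) (e0 ω x) - ip (linOp ω Ω (synth ω d)) (e0 ω x))
        + ω * (ip (nonlin (synth ω c)) (e0 ω x) - ip (nonlin (synth ω d)) (e0 ω x))‖ := by
        congr 1
        ring
    _ ≤ (|lam ω x| + ‖(Ω : ℂ) - Omega0 ω‖ * (2 * x.j)) * ∑' x, |c x - d x|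
        + ω * (5 * (4 * ∑' x, |c x - d x|) * 4) := by
        refine (norm_add_le _ _).trans (add_le_add h1 ?_)
        rw [norm_mul, Complex.norm_real, Real.norm_of_nonneg hω.le]
        exact mul_le_mul_of_nonneg_left h2 hω.le
    _ = _ := by ring

end VortexFilament

end

/-! ### Cauchy estimates, smooth cutoffs and superexponential decay. -/

noncomputable section

namespace VortexFilament

open scoped Topology

/-! ### Cauchy estimates on the real plane -/

/-- The inclusion of the real plane into the complex plane. -/
def incl : ℝ × ℝ →L[ℝ] ℂ × ℂ := Complex.ofRealCLM.prodMap Complex.ofRealCLM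

theorem incl_apply (p : ℝ × ℝ) : incl p = ((p.1 : ℂ), (p.2 : ℂ)) := rfl

theorem norm_incl (p : ℝ × ℝ) : ‖incl p‖ = ‖p‖ := by
  rw [incl_apply, Prod.norm_def, Prod.norm_def, Complex.norm_real, Complex.norm_real]

theorem norm_incl_le : ‖incl‖ ≤ 1 :=
  ContinuousLinearMap.opNorm_le_bound _ zero_le_one fun p => by rw [norm_incl, one_mul]

theorem dist_incl (p q : ℝ × ℝ) : dist (incl p) (incl q) = dist p q := by
  rw [dist_eq_norm, ← map_sub, norm_incl, dist_eq_norm]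

/-- Constants in the Cauchy estimates. -/
def cauchyConst : ℕ → ℝ
  | 0 => 1
  | k + 1 => cauchyConst k * 2 ^ k * 4

theorem cauchyConst_pos : ∀ k, 0 < cauchyConst k
  | 0 => zero_lt_one
  | k + 1 => by
    have := cauchyConst_pos k
    rw [cauchyConst]
    positivity

theorem norm_fderiv_le_of_ball {E F : Type*} [NormedAddCommGroup E] [NormedSpace ℂ E]
    [NormedAddCommGroup F] [NormedSpace ℂ F] {g : E → F} {z : E} {R M : ℝ} (hR : 0 < R)
    (hg : DifferentiableOn ℂ g (Metric.ball z R)) (hM : ∀ y ∈ Metric.ball z R, ‖g y‖ ≤ M) :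
    ‖fderiv ℂ g z‖ ≤ 2 * M / R := by
  refine Complex.norm_fderiv_le_div_of_mapsTo_ball hg (fun y hy => ?_) hR
  rw [Metric.mem_closedBall, dist_eq_norm]
  refine (norm_sub_le _ _).trans ?_
  linarith [hM y hy, hM z (Metric.mem_ball_self hR)]

/-- Induction on `k`: the derivative is holomorphic on the ball of half the radius and bounded there
by `4M/R`, whence the recursion of `cauchyConst`. The target `F` is quantified after `k` because it
changes when one differentiates. -/
theorem norm_iteratedFDeriv_le_of_ball {E : Type} [NormedAddCommGroup E] [NormedSpace ℂ E]
    (k : ℕ) : ∀ {F : Type} [NormedAddCommGroup F] [NormedSpace ℂ F] {g : E → F} {z : E}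
    {R M : ℝ}, 0 < R → ContDiffOn ℂ (⊤ : ℕ∞) g (Metric.ball z R) →
    (∀ y ∈ Metric.ball z R, ‖g y‖ ≤ M) →
    ‖iteratedFDeriv ℂ k g z‖ ≤ cauchyConst k * M / R ^ k := by
  induction k with
  | zero =>
    intro F _ _ g z R M hR hg hM
    simpa [cauchyConst] using hM z (Metric.mem_ball_self hR)
  | succ k ih =>
    intro F _ _ g z R M hR hg hM
    rw [← norm_iteratedFDeriv_fderiv]
    have h2 : 0 < R / 2 := by positivity
    have hsub : Metric.ball z (R / 2) ⊆ Metric.ball z R := Metric.ball_subset_ball (by linarith)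
    have hd : ContDiffOn ℂ (⊤ : ℕ∞) (fderiv ℂ g) (Metric.ball z (R / 2)) :=
      (hg.fderiv_of_isOpen Metric.isOpen_ball (by simp)).mono hsub
    have hb : ∀ y ∈ Metric.ball z (R / 2), ‖fderiv ℂ g y‖ ≤ 4 * M / R := by
      intro y hy
      have hs : Metric.ball y (R / 2) ⊆ Metric.ball z R := by
        refine Metric.ball_subset_ball' ?_
        rw [Metric.mem_ball] at hy
        linarith
      have := norm_fderiv_le_of_ball h2 ((hg.differentiableOn (by simp)).mono hs)
        fun w hw => hM w (hs hw)
      calc _ ≤ _ := this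
        _ = _ := by
          field_simp
          ring
    refine (ih h2 hd hb).trans_eq ?_
    rw [cauchyConst, div_pow]
    field_simp
    ring

/-- The real derivatives are the complex ones with restricted scalars, composed with `incl`, which
has norm at most `1`. -/
theorem norm_iteratedFDeriv_comp_incl_le {F : Type} [NormedAddCommGroup F] [NormedSpace ℂ F]
    {g : ℂ × ℂ → F} {p : ℝ × ℝ} {R M : ℝ} (hR : 0 < R)
    (hg : ContDiffOn ℂ (⊤ : ℕ∞) g (Metric.ball (incl p) R))
    (hM : ∀ y ∈ Metric.ball (incl p) R, ‖g y‖ ≤ M) (k : ℕ) :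
    ‖iteratedFDeriv ℝ k (g ∘ incl) p‖ ≤ cauchyConst k * M / R ^ k := by
  have hmem := Metric.mem_ball_self hR (x := incl p)
  have hmem' : incl p ∈ Metric.ball (incl p) R := hmem
  have hopen : IsOpen (incl ⁻¹' Metric.ball (incl p) R) :=
    Metric.isOpen_ball.preimage incl.continuous
  have h1 := incl.iteratedFDerivWithin_comp_right (hg.restrict_scalars ℝ)
    Metric.isOpen_ball.uniqueDiffOn hopen.uniqueDiffOn hmem' (i := k) (by exact_mod_cast le_top)
  rw [iteratedFDerivWithin_of_isOpen k hopen hmem',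
    iteratedFDerivWithin_of_isOpen k Metric.isOpen_ball hmem'] at h1
  have h2 : ContDiffAt ℂ k g (incl p) :=
    (hg.contDiffAt (Metric.isOpen_ball.mem_nhds hmem')).of_le (by exact_mod_cast le_top)
  rw [h1, ← h2.restrictScalars_iteratedFDeriv (𝕜 := ℝ)]
  refine (ContinuousMultilinearMap.norm_compContinuousLinearMap_le _ _).trans ?_
  calc _ ≤ ‖iteratedFDeriv ℂ k g (incl p)‖ * 1 := by
        refine mul_le_mul ?_ (Finset.prod_le_one (fun _ _ => norm_nonneg _) fun _ _ => norm_incl_le)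
          (Finset.prod_nonneg fun _ _ => norm_nonneg _) (norm_nonneg _)
        rw [Function.comp_apply, ContinuousMultilinearMap.norm_restrictScalars]
    _ ≤ _ := by
        rw [mul_one]
        exact norm_iteratedFDeriv_le_of_ball k hR hg hM

/-! ### Cutoff functions -/

open scoped Convolution in
-- All derivatives fall on the kernel `g`, so the bound is its `L¹` norm and does not see `f` beyond
-- `|f| ≤ 1`.
theorem norm_iteratedFDeriv_convolution_le {G : Type} [NormedAddCommGroup G] [NormedSpace ℝ G]
    [FiniteDimensional ℝ G] [MeasurableSpace G] [BorelSpace G]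
    {μ : MeasureTheory.Measure G} [μ.IsAddHaarMeasure]
    {f : G → ℝ} (hf : MeasureTheory.LocallyIntegrable f μ) (hf1 : ∀ x, |f x| ≤ 1) (k : ℕ) :
    ∀ {E F : Type} [NormedAddCommGroup E] [NormedSpace ℝ E] [NormedAddCommGroup F]
    [NormedSpace ℝ F] (L : E →L[ℝ] ℝ →L[ℝ] F) {g : G → E},
    HasCompactSupport g → ContDiff ℝ (⊤ : ℕ∞) g → ∀ x,
    ‖iteratedFDeriv ℝ k (g ⋆[L, μ] f) x‖ ≤ ‖L‖ * ∫ t, ‖iteratedFDeriv ℝ k g t‖ ∂μ := by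
  induction k with
  | zero =>
    intro E F _ _ _ _ L g hc hg x
    simp only [norm_iteratedFDeriv_zero]
    rw [MeasureTheory.convolution, ← MeasureTheory.integral_const_mul]
    refine MeasureTheory.norm_integral_le_of_norm_le
      ((hg.continuous.integrable_of_hasCompactSupport hc).norm.const_mul _) ?_
    filter_upwards with t
    refine (L.le_opNorm₂ _ _).trans ?_
    exact mul_le_of_le_one_right (by positivity) (hf1 _)
  | succ k ih =>
    intro E F _ _ _ _ L g hc hg x
    rw [← norm_iteratedFDeriv_fderiv]
    have h1 : fderiv ℝ (g ⋆[L, μ] f) = (fderiv ℝ g ⋆[L.precompL G, μ] f) := by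
      funext y
      exact (hc.hasFDerivAt_convolution_left L (hg.of_le (by simp)) hf y).fderiv
    rw [h1]
    refine (ih (L.precompL G) (hc.fderiv ℝ) (hg.fderiv_right (by simp)) x).trans ?_
    simp only [norm_iteratedFDeriv_fderiv]
    refine mul_le_mul_of_nonneg_right (L.norm_precompL_le G) ?_
    exact MeasureTheory.integral_nonneg fun _ => norm_nonneg _

open scoped Convolution in
-- The indicator of the `1/2`-thickening is mollified at radius `1/4`. The result is `1` on `K` and
-- vanishes near every point outside the `1`-thickening. The derivative bounds involve only the
-- mollifier, hence are uniform in `K`.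
theorem exists_unit_cutoff : ∃ C : ℕ → ℝ, ∀ K : Set (ℝ × ℝ), ∃ χ : ℝ × ℝ → ℝ,
    ContDiff ℝ (⊤ : ℕ∞) χ ∧ (∀ p ∈ K, χ p = 1) ∧
    (∀ p ∉ Metric.thickening 1 K, χ =ᶠ[𝓝 p] 0) ∧
    ∀ k p, ‖iteratedFDeriv ℝ k χ p‖ ≤ C k := by
  let φ : ContDiffBump (0 : ℝ × ℝ) := ⟨1 / 8, 1 / 4, by norm_num, by norm_num⟩
  let L := ContinuousLinearMap.lsmul ℝ ℝ (E := ℝ)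
  let μ : MeasureTheory.Measure (ℝ × ℝ) := MeasureTheory.volume
  refine ⟨fun k => ‖L‖ * ∫ t, ‖iteratedFDeriv ℝ k (φ.normed μ) t‖ ∂μ, fun K => ?_⟩
  let f : ℝ × ℝ → ℝ := (Metric.thickening (1 / 2) K).indicator fun _ => 1
  have hf_in : ∀ x ∈ Metric.thickening (1 / 2) K, f x = 1 := fun x hx => Set.indicator_of_mem hx _
  have hf_out : ∀ x ∉ Metric.thickening (1 / 2) K, f x = 0 :=
    fun x hx => Set.indicator_of_notMem hx _
  have hf : MeasureTheory.LocallyIntegrable f μ :=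
    (MeasureTheory.locallyIntegrable_const 1).indicator Metric.isOpen_thickening.measurableSet
  have hf1 : ∀ x, |f x| ≤ 1 := fun x => by
    by_cases hx : x ∈ Metric.thickening (1 / 2) K
    · rw [hf_in x hx, abs_one]
    · rw [hf_out x hx, abs_zero]
      exact zero_le_one
  have hcs : HasCompactSupport (φ.normed μ) := φ.hasCompactSupport_normed
  have hsm : ContDiff ℝ (⊤ : ℕ∞) (φ.normed μ) := φ.contDiff_normed
  refine ⟨φ.normed μ ⋆[L, μ] f, hcs.contDiff_convolution_left L hsm hf, fun p hp => ?_,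
    fun p hp => ?_, fun k p => norm_iteratedFDeriv_convolution_le hf hf1 k L hcs hsm p⟩
  · have hfp : f p = 1 := hf_in p (Metric.self_subset_thickening (by norm_num) K hp)
    rw [φ.normed_convolution_eq_right, hfp]
    intro x hx
    rw [hfp]
    have : x ∈ Metric.thickening (1 / 2) K := by
      rw [Metric.mem_thickening_iff]
      refine ⟨p, hp, (Metric.mem_ball.1 hx).trans ?_⟩
      change (1 / 4 : ℝ) < 1 / 2
      norm_num
    exact hf_in x this
  · have h1 : p ∉ Metric.cthickening (3 / 4) K := fun h =>
      hp (Metric.cthickening_subset_thickening' one_pos (by norm_num) K h)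
    filter_upwards [Metric.isClosed_cthickening.isOpen_compl.mem_nhds h1] with q hq
    have hfq : f q = 0 := hf_out q fun h => hq
      (Metric.thickening_subset_cthickening_of_le (by norm_num) K h)
    rw [φ.normed_convolution_eq_right, hfq]
    · rfl
    intro x hx
    rw [hfq]
    have : x ∉ Metric.thickening (1 / 2) K := by
      intro h
      obtain ⟨z, hz, hxz⟩ := Metric.mem_thickening_iff.1 h
      refine hq (Metric.thickening_subset_cthickening _ _ (Metric.mem_thickening_iff.2 ⟨z, hz, ?_⟩))
      have h2 : dist x q < 1 / 4 := Metric.mem_ball.1 hx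
      rw [dist_comm] at h2
      linarith [dist_triangle q x z]
    exact hf_out x this

/-- Rescaling by `ε` reduces to width one, and each derivative costs a factor `1/ε`. -/
theorem exists_cutoff : ∃ C : ℕ → ℝ, ∀ (K : Set (ℝ × ℝ)) (ε : ℝ), 0 < ε → ∃ χ : ℝ × ℝ → ℝ,
    ContDiff ℝ (⊤ : ℕ∞) χ ∧ (∀ p ∈ K, χ p = 1) ∧
    (∀ p ∉ Metric.thickening ε K, χ =ᶠ[𝓝 p] 0) ∧
    ∀ k p, ‖iteratedFDeriv ℝ k χ p‖ ≤ C k / ε ^ k := by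
  obtain ⟨C, hC⟩ := exists_unit_cutoff
  refine ⟨C, fun K ε hε => ?_⟩
  obtain ⟨χ, h1, h2, h3, h4⟩ := hC ((fun p => ε • p) ⁻¹' K)
  have hinv : ∀ p : ℝ × ℝ, ε • ε⁻¹ • p = p := fun p => by
    rw [smul_smul, mul_inv_cancel₀ hε.ne', one_smul]
  refine ⟨fun p => χ (ε⁻¹ • p), h1.comp (contDiff_const_smul _), fun p hp => h2 _ ?_,
    fun p hp => ?_, fun k p => ?_⟩
  · rwa [Set.mem_preimage, hinv]
  · have hc : Filter.Tendsto (fun p : ℝ × ℝ => ε⁻¹ • p) (𝓝 p) (𝓝 (ε⁻¹ • p)) :=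
      (continuous_const_smul _).tendsto p
    refine hc.eventually (h3 _ fun h => hp ?_)
    obtain ⟨z, hz, hd⟩ := Metric.mem_thickening_iff.1 h
    refine Metric.mem_thickening_iff.2 ⟨ε • z, hz, ?_⟩
    have : dist p (ε • z) = ε * dist (ε⁻¹ • p) z := by
      rw [← hinv p, dist_smul₀, Real.norm_of_nonneg hε.le, hinv]
    rw [this]
    calc _ < ε * 1 := by gcongr
      _ = ε := mul_one _
  · have hk : ContDiff ℝ k χ := h1.of_le (by exact_mod_cast le_top)
    rw [iteratedFDeriv_comp_const_smul _ hk, norm_smul, norm_pow, norm_inv,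
      Real.norm_of_nonneg hε.le, inv_pow, inv_mul_eq_div]
    gcongr
    exact h4 k _

/-- A holomorphic function near a set, cut off to a smooth function on the real plane. -/
theorem exists_cutoff_smooth : ∃ D : ℕ → ℝ, (∀ k, 0 ≤ D k) ∧
    ∀ (K : Set (ℝ × ℝ)) (ε : ℝ), 0 < ε → ∃ χ : ℝ × ℝ → ℝ, (∀ p ∈ K, χ p = 1) ∧
    ∀ (g : ℂ × ℂ → ℂ) (M : ℝ), ContDiffOn ℂ (⊤ : ℕ∞) g (Metric.thickening ε (incl '' K)) →
    (∀ z ∈ Metric.thickening ε (incl '' K), ‖g z‖ ≤ M) → 0 ≤ M →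
    ContDiff ℝ (⊤ : ℕ∞) (fun p => χ p * (g (incl p)).re) ∧
    ∀ k p, ‖iteratedFDeriv ℝ k (fun p => χ p * (g (incl p)).re) p‖ ≤ D k * M / ε ^ k := by
  obtain ⟨C, hC⟩ := exists_cutoff
  have hC0 : ∀ k, 0 ≤ C k := by
    intro k
    obtain ⟨χ, -, -, -, h⟩ := hC ∅ 1 one_pos
    have := (norm_nonneg _).trans (h k 0)
    simpa using this
  refine ⟨fun k => 2 ^ k * ∑ i ∈ Finset.range (k + 1), (k.choose i : ℝ) * C i * cauchyConst (k - i),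
    fun k => ?_, fun K ε hε => ?_⟩
  · refine mul_nonneg (by positivity) (Finset.sum_nonneg fun i _ => ?_)
    exact mul_nonneg (mul_nonneg (Nat.cast_nonneg _) (hC0 i)) (cauchyConst_pos _).le
  have hε2 : 0 < ε / 2 := half_pos hε
  -- The cutoff lives on half the width. Around each point of the `ε/2`-thickening a complex ball of
  -- radius `ε/2` then remains in the domain of `g`, as Cauchy's estimates require.
  obtain ⟨χ, h1, h2, h3, h4⟩ := hC K (ε / 2) hε2
  refine ⟨χ, h2, fun g M hg hM hM0 => ?_⟩
  have hball : ∀ p ∈ Metric.thickening (ε / 2) K,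
      Metric.ball (incl p) (ε / 2) ⊆ Metric.thickening ε (incl '' K) := by
    intro p hp z hz
    obtain ⟨q, hq, hd⟩ := Metric.mem_thickening_iff.1 hp
    refine Metric.mem_thickening_iff.2 ⟨incl q, Set.mem_image_of_mem _ hq, ?_⟩
    rw [← dist_incl] at hd
    have := Metric.mem_ball.1 hz
    linarith [dist_triangle z (incl p) (incl q)]
  have hre : ∀ p ∈ Metric.thickening (ε / 2) K,
      ContDiffAt ℝ (⊤ : ℕ∞) (fun p => (g (incl p)).re) p := by
    intro p hp
    have hgp : ContDiffAt ℂ (⊤ : ℕ∞) g (incl p) := hg.contDiffAt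
      (Metric.isOpen_thickening.mem_nhds (hball p hp (Metric.mem_ball_self hε2)))
    exact Complex.reCLM.contDiff.contDiffAt.comp p
      ((hgp.restrict_scalars ℝ).comp p incl.contDiff.contDiffAt)
  have hzero : ∀ p ∉ Metric.thickening (ε / 2) K,
      (fun p => χ p * (g (incl p)).re) =ᶠ[𝓝 p] fun _ => 0 := by
    intro p hp
    filter_upwards [h3 p hp] with q hq
    rw [hq, Pi.zero_apply, zero_mul]
  refine ⟨contDiff_iff_contDiffAt.2 fun p => ?_, fun k p => ?_⟩
  · by_cases hp : p ∈ Metric.thickening (ε / 2) K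
    · exact h1.contDiffAt.mul (hre p hp)
    · exact contDiffAt_const.congr_of_eventuallyEq (hzero p hp)
  · by_cases hp : p ∈ Metric.thickening (ε / 2) K
    · have hV : IsOpen (Metric.thickening (ε / 2) K) := Metric.isOpen_thickening
      have hb : ∀ i, ‖iteratedFDerivWithin ℝ i (fun p => (g (incl p)).re)
          (Metric.thickening (ε / 2) K) p‖ ≤ cauchyConst i * M / (ε / 2) ^ i := by
        intro i
        rw [iteratedFDerivWithin_of_isOpen i hV hp]
        have hgp : ContDiffAt ℂ (⊤ : ℕ∞) g (incl p) := hg.contDiffAt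
          (Metric.isOpen_thickening.mem_nhds (hball p hp (Metric.mem_ball_self hε2)))
        have hc : ContDiffAt ℝ (⊤ : ℕ∞) (g ∘ incl) p :=
          (hgp.restrict_scalars ℝ).comp p incl.contDiff.contDiffAt
        have h5 : iteratedFDeriv ℝ i (fun p => (g (incl p)).re) p
            = Complex.reCLM.compContinuousMultilinearMap (iteratedFDeriv ℝ i (g ∘ incl) p) :=
          Complex.reCLM.iteratedFDeriv_comp_left hc (by exact_mod_cast le_top)
        rw [h5]
        refine (Complex.reCLM.norm_compContinuousMultilinearMap_le _).trans ?_
        rw [Complex.reCLM_norm, one_mul]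
        exact norm_iteratedFDeriv_comp_incl_le hε2 (hg.mono (hball p hp))
          (fun y hy => hM y (hball p hp hy)) i
      rw [← iteratedFDerivWithin_of_isOpen k hV hp]
      refine (norm_iteratedFDerivWithin_mul_le (N := (⊤ : ℕ∞)) h1.contDiffOn
        (fun q hq => (hre q hq).contDiffWithinAt) hV.uniqueDiffOn hp
        (by exact_mod_cast le_top)).trans ?_
      have hterm : ∀ i ∈ Finset.range (k + 1), (k.choose i : ℝ) *
          ‖iteratedFDerivWithin ℝ i χ (Metric.thickening (ε / 2) K) p‖ *
          ‖iteratedFDerivWithin ℝ (k - i) (fun p => (g (incl p)).re)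
            (Metric.thickening (ε / 2) K) p‖
          ≤ (k.choose i : ℝ) * C i * cauchyConst (k - i) * (2 ^ k * M / ε ^ k) := by
        intro i hi
        have hik : i + (k - i) = k := by
          have := Finset.mem_range.1 hi
          omega
        rw [iteratedFDerivWithin_of_isOpen i hV hp]
        calc _ ≤ (k.choose i : ℝ) * (C i / (ε / 2) ^ i) *
              (cauchyConst (k - i) * M / (ε / 2) ^ (k - i)) := by
              have hCi : 0 ≤ C i / (ε / 2) ^ i := (norm_nonneg _).trans (h4 i p)
              refine mul_le_mul (mul_le_mul_of_nonneg_left (h4 i p) (Nat.cast_nonneg _)) (hb _)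
                (norm_nonneg _) (mul_nonneg (Nat.cast_nonneg _) hCi)
          _ = (k.choose i : ℝ) * C i * cauchyConst (k - i) *
              (M / ((ε / 2) ^ i * (ε / 2) ^ (k - i))) := by
              field_simp
          _ = _ := by
              rw [← pow_add, hik, div_pow]
              field_simp
      refine (Finset.sum_le_sum hterm).trans_eq ?_
      rw [← Finset.sum_mul]
      ring
    · have h5 : iteratedFDeriv ℝ k (fun p => χ p * (g (incl p)).re) p
          = iteratedFDeriv ℝ k (fun _ => (0 : ℝ)) p :=
        ((hzero p hp).iteratedFDeriv ℝ k).eq_of_nhds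
      rw [h5, iteratedFDeriv_fun_zero]
      simp only [Pi.zero_apply, norm_zero]
      refine div_nonneg (mul_nonneg (mul_nonneg (by positivity)
        (Finset.sum_nonneg fun i _ => ?_)) hM0) (by positivity)
      exact mul_nonneg (mul_nonneg (Nat.cast_nonneg _) (hC0 i)) (cauchyConst_pos _).le

/-! ### Superexponential decay -/

/-- The double exponential rate `(4/3)^n` beats any Gaussian loss `exp(D n²)`. Every loss of the
scheme is of at most this size. -/
theorem summable_exp_sq_sub_pow (D : ℝ) {a : ℝ} (ha : 0 < a) :
    Summable fun n : ℕ => Real.exp (D * (n + 1) ^ 2 - a * (4 / 3) ^ n) := by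
  have h1 : Filter.Tendsto (fun n : ℕ => ((n : ℝ) ^ 2) / (4 / 3) ^ n) Filter.atTop (𝓝 0) :=
    tendsto_pow_const_div_const_pow_of_one_lt 2 (by norm_num)
  -- Since `(n+1)² ≤ 4n²` for `n ≥ 1`, this threshold makes the exponent at most `-n²`, hence at
  -- most `-n`.
  have h2 : ∀ᶠ n : ℕ in Filter.atTop, ((n : ℝ) ^ 2) / (4 / 3) ^ n < a / (4 * |D| + 1) :=
    h1.eventually_lt_const (by positivity)
  refine summable_of_isBigO_nat (g := fun n : ℕ => Real.exp (-(n : ℝ))) Real.summable_exp_neg_nat ?_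
  refine Asymptotics.IsBigO.of_bound 1 ?_
  filter_upwards [h2, Filter.eventually_ge_atTop 1] with n hn hn1
  rw [one_mul, Real.norm_of_nonneg (Real.exp_pos _).le, Real.norm_of_nonneg (Real.exp_pos _).le]
  refine Real.exp_le_exp.2 ?_
  rw [div_lt_div_iff₀ (by positivity) (by positivity)] at hn
  have hn1' : (1 : ℝ) ≤ n := by exact_mod_cast hn1
  have h3 : D * ((n : ℝ) + 1) ^ 2 ≤ |D| * (4 * n ^ 2) :=
    mul_le_mul (le_abs_self D) (by nlinarith) (by positivity) (abs_nonneg _)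
  nlinarith

theorem exists_exp_sub_pow_le (D : ℝ) {a : ℝ} (ha : 0 < a) :
    ∃ Z : ℝ, 1 ≤ Z ∧ ∀ n : ℕ, Real.exp (D * (n + 1) - a * (4 / 3) ^ n) ≤ Z := by
  have hs := summable_exp_sq_sub_pow |D| ha
  refine ⟨1 + ∑' n : ℕ, Real.exp (|D| * (n + 1) ^ 2 - a * (4 / 3) ^ n), ?_, fun n => ?_⟩
  · have : 0 ≤ ∑' n : ℕ, Real.exp (|D| * (n + 1) ^ 2 - a * (4 / 3) ^ n) :=
      tsum_nonneg fun n => (Real.exp_pos _).le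
    linarith
  · have h1 := hs.le_tsum n fun m _ => (Real.exp_pos _).le
    have h2 : Real.exp (D * (n + 1) - a * (4 / 3) ^ n)
        ≤ Real.exp (|D| * (n + 1) ^ 2 - a * (4 / 3) ^ n) := by
      refine Real.exp_le_exp.2 (sub_le_sub_right ?_ _)
      have hn : (1 : ℝ) ≤ n + 1 := by linarith [(Nat.cast_nonneg n : (0 : ℝ) ≤ n)]
      exact mul_le_mul (le_abs_self D) (by nlinarith) (by positivity) (abs_nonneg _)
    linarith

end VortexFilament

end

/-! ### Inverse matrices, supports and the complexified Newton step. -/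

noncomputable section

namespace VortexFilament

/-! ### Matrices -/

section Matrices

variable {ι : Type*} [Fintype ι] [DecidableEq ι]

/-- Stability of weighted bounds for the inverse under small perturbations. -/
theorem inverse_perturbation {W : ι → ℝ} (hW : ∀ b, 0 < W b) {H H0 : Matrix ι ι ℂ} {K : ℝ}
    (hK : 0 < K) (hdet : IsUnit H0.det)
    (h0 : ∀ c : ι → ℂ, ∑ b, ‖(H0⁻¹ *ᵥ c) b‖ * W b ≤ K * ∑ b, ‖c b‖ * W b)
    (hD : ∀ c : ι → ℂ, ∑ b, ‖((H - H0) *ᵥ c) b‖ * W b ≤ 1 / (2 * K) * ∑ b, ‖c b‖ * W b) :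
    IsUnit H.det ∧ ∀ c : ι → ℂ, ∑ b, ‖(H⁻¹ *ᵥ c) b‖ * W b ≤ 2 * K * ∑ b, ‖c b‖ * W b := by
  -- A priori bound from `h = H0⁻¹(Hh) - H0⁻¹((H - H0)h)`, whose second term is at most half of `h`.
  -- It gives injectivity, hence invertibility in finite dimension, and then the bound for the
  -- inverse.
  have key : ∀ h : ι → ℂ, ∑ b, ‖h b‖ * W b ≤ 2 * K * ∑ b, ‖(H *ᵥ h) b‖ * W b := by
    intro h
    have e1 : h = H0⁻¹ *ᵥ (H *ᵥ h) - H0⁻¹ *ᵥ ((H - H0) *ᵥ h) := by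
      rw [← Matrix.mulVec_sub, Matrix.sub_mulVec, sub_sub_cancel, Matrix.mulVec_mulVec,
        Matrix.nonsing_inv_mul _ hdet, Matrix.one_mulVec]
    have e2 : ∑ b, ‖h b‖ * W b ≤ ∑ b, ‖(H0⁻¹ *ᵥ (H *ᵥ h)) b‖ * W b
        + ∑ b, ‖(H0⁻¹ *ᵥ ((H - H0) *ᵥ h)) b‖ * W b := by
      rw [← Finset.sum_add_distrib]
      refine Finset.sum_le_sum fun b _ => ?_
      rw [← add_mul]
      refine mul_le_mul_of_nonneg_right ?_ (hW b).le
      have := congrFun e1 b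
      rw [Pi.sub_apply] at this
      nth_rewrite 1 [this]
      exact norm_sub_le _ _
    have e3 := h0 (H *ᵥ h)
    have e4 := h0 ((H - H0) *ᵥ h)
    have e5 := mul_le_mul_of_nonneg_left (hD h) hK.le
    have e6 : K * (1 / (2 * K) * ∑ b, ‖h b‖ * W b) = 1 / 2 * ∑ b, ‖h b‖ * W b := by
      field_simp
    linarith
  have hunit : IsUnit H.det := by
    rw [isUnit_iff_ne_zero]
    intro hz
    obtain ⟨v, hv, hv0⟩ := Matrix.exists_mulVec_eq_zero_iff.2 hz
    have h1 := key v
    rw [hv0] at h1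
    simp only [Pi.zero_apply, norm_zero, zero_mul, Finset.sum_const_zero, mul_zero] at h1
    refine hv (funext fun b => ?_)
    have h2 : ‖v b‖ * W b ≤ 0 := (Finset.single_le_sum (f := fun b => ‖v b‖ * W b)
      (fun b _ => mul_nonneg (norm_nonneg _) (hW b).le) (Finset.mem_univ b)).trans h1
    have h3 : ‖v b‖ ≤ 0 := by
      by_contra h4
      push Not at h4
      have := mul_pos h4 (hW b)
      linarith
    exact norm_le_zero_iff.1 h3
  refine ⟨hunit, fun c => ?_⟩
  have := key (H⁻¹ *ᵥ c)
  rwa [Matrix.mulVec_mulVec, Matrix.mul_nonsing_inv _ hunit, Matrix.one_mulVec] at this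

/-- Both inverses are the adjugate times the inverted determinant, and this also covers singular
matrices, where both sides vanish. No invertibility is needed when real and complex Newton steps are
compared. -/
theorem map_ofReal_inv (A : Matrix ι ι ℝ) :
    (A.map (Complex.ofRealHom : ℝ →+* ℂ))⁻¹ = A⁻¹.map (Complex.ofRealHom : ℝ →+* ℂ) := by
  have h1 : (A.map (Complex.ofRealHom : ℝ →+* ℂ)).det = ((A.det : ℝ) : ℂ) :=
    (RingHom.map_det Complex.ofRealHom A).symm
  have h2 : (A.map (Complex.ofRealHom : ℝ →+* ℂ)).adjugate
      = A.adjugate.map (Complex.ofRealHom : ℝ →+* ℂ) :=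
    (RingHom.map_adjugate Complex.ofRealHom A).symm
  rw [Matrix.inv_def, Matrix.inv_def, h1, h2, Ring.inverse_eq_inv', Ring.inverse_eq_inv']
  ext i j
  simp

variable {E : Type*} [NormedAddCommGroup E] [NormedSpace ℂ E] {n : WithTop ℕ∞} {D : Set E}

theorem contDiffOn_det {A : E → Matrix ι ι ℂ} (hA : ∀ i j, ContDiffOn ℂ n (fun p => A p i j) D) :
    ContDiffOn ℂ n (fun p => (A p).det) D := by
  simp only [Matrix.det_apply]
  exact ContDiffOn.sum fun s _ => (contDiffOn_prod fun i _ => hA _ _).const_smul _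

/-- By Cramer's rule the entries are quotients of determinants with nonvanishing denominator. -/
theorem contDiffOn_inv_mulVec {A : E → Matrix ι ι ℂ} {F : E → ι → ℂ}
    (hA : ∀ i j, ContDiffOn ℂ n (fun p => A p i j) D)
    (hF : ∀ i, ContDiffOn ℂ n (fun p => F p i) D) (hdet : ∀ p ∈ D, IsUnit (A p).det) (i : ι) :
    ContDiffOn ℂ n (fun p => ((A p)⁻¹ *ᵥ F p) i) D := by
  simp only [Matrix.mulVec, dotProduct, Matrix.inv_def, Ring.inverse_eq_inv', Matrix.smul_apply,
    smul_eq_mul]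
  refine ContDiffOn.sum fun j _ => ((ContDiffOn.inv (contDiffOn_det hA)
    fun p hp => (hdet p hp).ne_zero).mul ?_).mul (hF j)
  simp only [Matrix.adjugate_apply]
  refine contDiffOn_det fun k l => ?_
  simp only [Matrix.updateRow_apply]
  split_ifs
  · exact contDiffOn_const
  · exact hA k l

end Matrices

variable {ω : ℝ}

theorem wS_le_wt {s : ℝ} (hs : 0 ≤ s) (σ a b : ℝ) : Real.exp (σ * len a b) ≤ wt s σ a b := by
  rw [wt]
  refine le_mul_of_one_le_right (Real.exp_pos _).le (Real.one_le_rpow ?_ hs)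
  rw [bracket]
  exact Real.one_le_sqrt.2 (by nlinarith [sq_nonneg a, sq_nonneg b])

theorem wS_le_mul {σ : ℝ} (hσ : 0 ≤ σ) (x y : Site) :
    wS σ x ≤ Real.exp (σ * len ((x.j : ℝ) - y.j) ((x.k : ℝ) - y.k)) * wS σ y := by
  rw [wS, wS, ← Real.exp_add, ← mul_add]
  refine Real.exp_le_exp.2 (mul_le_mul_of_nonneg_left ?_ hσ)
  have := len_add_le ((x.j : ℝ) - y.j) ((x.k : ℝ) - y.k) y.j y.k
  simpa using this

/-- The matrix norm bounds the action on weighted summable vectors. -/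
theorem sum_norm_mulVec_le {s σ : ℝ} (hs : 0 ≤ s) (hσ : 0 ≤ σ) {B : Finset Site}
    (G : Matrix B B ℝ) (c : B → ℂ) :
    ∑ x : B, ‖(G.map (Complex.ofRealHom : ℝ →+* ℂ) *ᵥ c) x‖ * wS σ x
      ≤ matNorm s σ G * ∑ x : B, ‖c x‖ * wS σ x := by
  -- Vectors are measured in a weighted `ℓ¹` norm, so only the column sums in `matNorm` enter.
  have hcol : ∀ y : B, ∑ x : B, |G x y| *
      wt s σ ((x.1.j : ℝ) - (y.1.j : ℝ)) ((x.1.k : ℝ) - (y.1.k : ℝ)) ≤ matNorm s σ G := fun y =>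
    (le_ciSup (f := fun y : B => ∑ x : B, |G x y| *
      wt s σ ((x.1.j : ℝ) - (y.1.j : ℝ)) ((x.1.k : ℝ) - (y.1.k : ℝ)))
      (Set.finite_range _).bddAbove y).trans (le_max_right _ _)
  calc _ ≤ ∑ x : B, ∑ y : B, |G x y| *
        wt s σ ((x.1.j : ℝ) - (y.1.j : ℝ)) ((x.1.k : ℝ) - (y.1.k : ℝ)) * (‖c y‖ * wS σ y) := by
        refine Finset.sum_le_sum fun x _ => ?_
        refine (mul_le_mul_of_nonneg_right (norm_sum_le _ _) (wS_pos _ _).le).trans ?_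
        rw [Finset.sum_mul]
        refine Finset.sum_le_sum fun y _ => ?_
        have h1 : ‖G.map (Complex.ofRealHom : ℝ →+* ℂ) x y * c y‖ = |G x y| * ‖c y‖ := by
          rw [norm_mul, Matrix.map_apply, Complex.ofRealHom_eq_coe, Complex.norm_real,
            Real.norm_eq_abs]
        have h2 : wS σ x ≤ wt s σ ((x.1.j : ℝ) - (y.1.j : ℝ)) ((x.1.k : ℝ) - (y.1.k : ℝ))
            * wS σ y := (wS_le_mul hσ x y).trans
          (mul_le_mul_of_nonneg_right (wS_le_wt hs _ _ _) (wS_pos _ _).le)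
        calc _ = |G x y| * ‖c y‖ * wS σ x := by rw [h1]
          _ ≤ |G x y| * ‖c y‖ * (wt s σ ((x.1.j : ℝ) - (y.1.j : ℝ)) ((x.1.k : ℝ) - (y.1.k : ℝ))
            * wS σ y) := mul_le_mul_of_nonneg_left h2 (by positivity)
          _ = _ := by ring
    _ = ∑ y : B, (∑ x : B, |G x y| *
        wt s σ ((x.1.j : ℝ) - (y.1.j : ℝ)) ((x.1.k : ℝ) - (y.1.k : ℝ))) * (‖c y‖ * wS σ y) := by
        rw [Finset.sum_comm]
        exact Finset.sum_congr rfl fun y _ => (Finset.sum_mul _ _ _).symm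
    _ ≤ ∑ y : B, matNorm s σ G * (‖c y‖ * wS σ y) := Finset.sum_le_sum fun y _ =>
        mul_le_mul_of_nonneg_right (hcol y) (mul_nonneg (norm_nonneg _) (wS_pos _ _).le)
    _ = _ := (Finset.mul_sum _ _ _).symm

/-! ### Supports -/

/-- The ball together with the kernel site. -/
def ballN (R : ℝ) : Finset Site := insert siteN (ball R)

theorem siteN_notMem_ball (R : ℝ) : siteN ∉ ball R := fun h => (mem_ball.1 h).1 rfl

theorem ball_subset_ballN (R : ℝ) : ball R ⊆ ballN R := Finset.subset_insert _ _

theorem mem_ballN {R : ℝ} {x : Site} : x ∈ ballN R ↔ x = siteN ∨ x ∈ ball R := Finset.mem_insert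

theorem ball_mono {R R' : ℝ} (h : R ≤ R') : ball R ⊆ ball R' := fun x hx => by
  rw [mem_ball] at hx ⊢
  exact ⟨hx.1, hx.2.trans_le h⟩

theorem ballN_mono {R R' : ℝ} (h : R ≤ R') : ballN R ⊆ ballN R' :=
  Finset.insert_subset_insert _ (ball_mono h)

theorem nrm_eq_of_support {σ : ℝ} {B B' : Finset Site} (hB : B' ⊆ B) {c : Site → ℂ}
    (hc : ∀ x ∉ B', c x = 0) : nrm σ B c = nrm σ B' c :=
  (Finset.sum_subset hB fun x _ hx => by rw [hc x hx, norm_zero, zero_mul]).symm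

theorem Fc_eq_of_support {B B' : Finset Site} (hB : B' ⊆ B) {c : Site → ℂ}
    (hc : ∀ x ∉ B', c x = 0) (Ω : ℂ) (x : Site) : Fc ω B Ω c x = Fc ω B' Ω c x := by
  have h1 : ubar ω B c = ubar ω B' c := by
    funext t θ
    exact (Finset.sum_subset hB fun x _ hx => by rw [hc x hx, zero_mul]).symm
  rw [Fc, Fc, Phi, Phi, h1]
  congr 1
  exact (Finset.sum_subset hB fun y _ hy => by rw [hc y hy, mul_zero]).symm

/-! ### The complexified Newton step -/

/-- The increment of the complexified Newton step. -/
def stepC (ω R : ℝ) (Ω : ℂ) (u : Site → ℂ) : Site → ℂ := fun x =>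
  if h : x ∈ ball R then
    -((Matrix.of fun x y : ball R => Jc ω (ballN R) Ω u x y)⁻¹ *ᵥ
      fun y : ball R => Fc ω (ballN R) Ω u y) ⟨x, h⟩
  else 0

theorem stepC_of_notMem {R : ℝ} (Ω : ℂ) (u : Site → ℂ) {x : Site} (h : x ∉ ball R) :
    stepC ω R Ω u x = 0 := dif_neg h

theorem stepC_of_mem {R : ℝ} (Ω : ℂ) (u : Site → ℂ) (x : ball R) :
    stepC ω R Ω u x = -((Matrix.of fun x y : ball R => Jc ω (ballN R) Ω u x y)⁻¹ *ᵥ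
      fun y : ball R => Fc ω (ballN R) Ω u y) x := dif_pos x.2

/-- The complexified iterates. -/
def uC (ω L0 : ℝ) (u0 : ℂ × ℂ → Site → ℂ) : ℕ → ℂ × ℂ → Site → ℂ
  | 0 => u0
  | n + 1 => fun z => uC ω L0 u0 n z + stepC ω (scale L0 (n + 1)) z.2 (uC ω L0 u0 n z)

theorem sum_ballN_of_zero {M : Type*} [AddCommMonoid M] {R : ℝ} {g : Site → M} (h : g siteN = 0) :
    ∑ y ∈ ballN R, g y = ∑ y : ball R, g y := by
  rw [ballN, Finset.sum_insert (siteN_notMem_ball R), h, zero_add, Finset.sum_coe_sort]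

/-- The Newton step solves the linearized equation. -/
theorem linearized_stepC {R : ℝ} {Ω : ℂ} {u : Site → ℂ}
    (hdet : IsUnit (Matrix.of fun x y : ball R => Jc ω (ballN R) Ω u x y).det) {x : Site}
    (hx : x ∈ ball R) :
    Fc ω (ballN R) Ω u x + ∑ y ∈ ballN R, Jc ω (ballN R) Ω u x y * stepC ω R Ω u y = 0 := by
  rw [sum_ballN_of_zero (by rw [stepC_of_notMem _ _ (siteN_notMem_ball R), mul_zero])]
  have h1 : ∑ y : ball R, Jc ω (ballN R) Ω u x y * stepC ω R Ω u y
      = -((Matrix.of fun x y : ball R => Jc ω (ballN R) Ω u x y) *ᵥ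
        ((Matrix.of fun x y : ball R => Jc ω (ballN R) Ω u x y)⁻¹ *ᵥ
          fun y : ball R => Fc ω (ballN R) Ω u y)) ⟨x, hx⟩ := by
    rw [Matrix.mulVec, dotProduct, ← Finset.sum_neg_distrib]
    refine Finset.sum_congr rfl fun y _ => ?_
    rw [stepC_of_mem, Matrix.of_apply, mul_neg]
  rw [h1, Matrix.mulVec_mulVec, Matrix.mul_nonsing_inv _ hdet, Matrix.one_mulVec, add_neg_cancel]

end VortexFilament

end

/-! ### The induction for the Newton scheme on shrinking complex neighbourhoods. -/

noncomputable section

namespace VortexFilament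

/-! ### The Newton iteration in the complex domain -/

/-- The restricted Jacobian of the complexified equation. -/
abbrev jacN (ω R : ℝ) (Ω : ℂ) (u : Site → ℂ) : Matrix (ball R) (ball R) ℂ :=
  Matrix.of fun x y : ball R => Jc ω (ballN R) Ω u x y

/-- The shrinking complex neighbourhoods of the parameter set. -/
abbrev nbhd (K : Set (ℝ × ℝ)) (ε : ℕ → ℝ) (n : ℕ) : Set (ℂ × ℂ) :=
  Metric.thickening (ε n) (incl '' K)

/-- The data of the iteration: the initial approximation, the bounds for the inverses on the real
parameter set, and the constants. -/
structure NewtonData (ω L0 : ℝ) (K : Set (ℝ × ℝ)) (σ κ τ ζ ε : ℕ → ℝ) (η b : ℝ)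
    (u0 : ℂ × ℂ → Site → ℂ) : Prop where
  hω : 0 < ω
  hL0 : 0 < L0
  supp : ∀ z, ∀ x ∉ ballN L0, u0 z x = 0
  kernel : ∀ z, u0 z siteN = z.1
  smooth : ∀ x, ContDiffOn ℂ (⊤ : ℕ∞) (fun z => u0 z x) (nbhd K ε 0)
  small : ∀ z ∈ nbhd K ε 0, nrm (σ 0) (ballN L0) (u0 z) ≤ η
  eqn : ∀ z ∈ nbhd K ε 0, ∀ x ∈ ball L0, Fc ω (ballN L0) z.2 (u0 z) x = 0
  detuning : ∀ z ∈ nbhd K ε 0,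
    2 * ‖z.2 - (Omega0 ω : ℂ)‖ * ‖z.1‖ * wS (σ 0) siteN ≤ η ^ 2
  sigma_nonneg : ∀ n, 0 ≤ σ n
  sigma_anti : ∀ n, σ (n + 1) ≤ σ n
  -- Here `κ` bounds whatever grows with the scale, `τ` is the relative size of the increments, and
  -- `ζ` is a surplus factor that pays for `κ²` in `quad`.
  one_le_kappa : ∀ n, 1 ≤ κ n
  card_le : ∀ n, ((ballN (scale L0 n)).card : ℝ) ≤ κ n
  index_le : ∀ n, ∀ y ∈ ballN (scale L0 n), (y.j : ℝ) ≤ κ n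
  decay : ∀ n, ∀ x ∉ ball (scale L0 n), x ≠ siteN →
    wS (σ (n + 1)) x ≤ wS (σ n) x * (τ (n + 1) * ζ (n + 1))
  tau_nonneg : ∀ n, 0 ≤ τ n
  zeta_nonneg : ∀ n, 0 ≤ ζ n
  tau_sq_le : ∀ n, τ n ^ 2 ≤ τ (n + 1) * ζ (n + 1)
  sum_tau_le : ∀ n, 1 + ∑ i ∈ Finset.range n, τ (i + 1) ≤ b
  eta_pos : 0 < η
  eta_le : b * η ≤ 1 / 16
  quad : ∀ n, 2 * κ (n + 1) ^ 2 * η * (512 * ω + 1 + 128 * ω * b ^ 2) * ζ (n + 1) ≤ 1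
  eps_pos : ∀ n, 0 < ε n
  eps_le_one : ∀ n, ε n ≤ 1
  eps_anti : ∀ n, ε (n + 1) ≤ ε n
  eps_quot : ∀ n, 4 * (1 + 128 * ω) * κ (n + 1) ^ 3 * ε (n + 1) ≤ ε n
  -- The inverse bound is required only under smallness of the iterates up to `n` on `K`: that
  -- smallness is what identifies the complex Jacobian with the real one, and the induction supplies
  -- it.
  inverse : ∀ n, (∀ m ≤ n, ∀ p ∈ K,
      nrm (σ m) (ballN (scale L0 m)) (uC ω L0 u0 m (incl p)) ≤ 1 / 8) →
    ∀ p ∈ K, IsUnit (jacN ω (scale L0 (n + 1)) (incl p).2 (uC ω L0 u0 n (incl p))).det ∧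
      ∀ c : ball (scale L0 (n + 1)) → ℂ,
        ∑ x, ‖((jacN ω (scale L0 (n + 1)) (incl p).2 (uC ω L0 u0 n (incl p)))⁻¹ *ᵥ c) x‖
            * wS (σ (n + 1)) x
          ≤ κ (n + 1) * ∑ x, ‖c x‖ * wS (σ (n + 1)) x

theorem scale_le_succ {L0 : ℝ} (h : 0 < L0) (n : ℕ) : scale L0 n ≤ scale L0 (n + 1) := by
  rw [scale, scale, pow_succ]
  have : 0 < 2 ^ n * L0 := by positivity
  linarith

theorem scale_zero (L0 : ℝ) : scale L0 0 = L0 := by simp [scale]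

theorem uC_succ_apply {ω L0 : ℝ} (u0 : ℂ × ℂ → Site → ℂ) (n : ℕ) (z : ℂ × ℂ) (x : Site) :
    uC ω L0 u0 (n + 1) z x
      = uC ω L0 u0 n z x + stepC ω (scale L0 (n + 1)) z.2 (uC ω L0 u0 n z) x := rfl

/-- Sites outside a ball are coupled linearly only to the kernel site. -/
theorem Lc_eq_zero {ω R : ℝ} (Ω : ℂ) {x y : Site} (hx : x ∉ ball R) (hxN : x ≠ siteN)
    (hy : y ∈ ball R) : Lc ω Ω x y = 0 := by
  have hyR := (mem_ball.1 hy).2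
  have h1 : x ≠ y := fun h => hx (h ▸ hy)
  have h2 : ¬(x.j = y.j ∧ x.k = y.k) := fun h =>
    hx (mem_ball.2 ⟨hxN, by rw [h.1, h.2]; exact hyR⟩)
  rw [Lc, cpl, if_neg h1, if_neg h2]
  simp

theorem nrm_succ_eq {L0 : ℝ} (hL0 : 0 < L0) (σ : ℝ) (n : ℕ) {c : Site → ℂ}
    (hc : ∀ x ∉ ballN (scale L0 n), c x = 0) :
    nrm σ (ballN (scale L0 (n + 1))) c = nrm σ (ballN (scale L0 n)) c :=
  nrm_eq_of_support (ballN_mono (scale_le_succ hL0 n)) hc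

theorem uC_eq_zero {ω L0 : ℝ} (hL0 : 0 < L0) {u0 : ℂ × ℂ → Site → ℂ} {z : ℂ × ℂ}
    (hu : ∀ x ∉ ballN L0, u0 z x = 0) (n : ℕ) :
    ∀ x ∉ ballN (scale L0 n), uC ω L0 u0 n z x = 0 := by
  induction n with
  | zero => rw [scale_zero]; exact hu
  | succ n ih =>
    intro x hx
    have h1 : x ∉ ballN (scale L0 n) := fun h => hx (ballN_mono (scale_le_succ hL0 n) h)
    have h2 : x ∉ ball (scale L0 (n + 1)) := fun h => hx (ball_subset_ballN _ h)
    rw [uC_succ_apply, ih x h1, stepC_of_notMem _ _ h2, add_zero]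

namespace NewtonData

variable {ω L0 : ℝ} {K : Set (ℝ × ℝ)} {σ κ τ ζ ε : ℕ → ℝ} {η b : ℝ} {u0 : ℂ × ℂ → Site → ℂ}

theorem uC_supp (H : NewtonData ω L0 K σ κ τ ζ ε η b u0) (n : ℕ) (z : ℂ × ℂ) :
    ∀ x ∉ ballN (scale L0 n), uC ω L0 u0 n z x = 0 := uC_eq_zero H.hL0 (H.supp z) n

theorem uC_kernel (H : NewtonData ω L0 K σ κ τ ζ ε η b u0) (n : ℕ) (z : ℂ × ℂ) :
    uC ω L0 u0 n z siteN = z.1 := by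
  induction n with
  | zero => exact H.kernel z
  | succ n ih => rw [uC_succ_apply, ih, stepC_of_notMem _ _ (siteN_notMem_ball _), add_zero]

theorem nbhd_succ_subset (H : NewtonData ω L0 K σ κ τ ζ ε η b u0) (n : ℕ) :
    nbhd K ε (n + 1) ⊆ nbhd K ε n := Metric.thickening_mono (H.eps_anti n) _

theorem nbhd_subset_zero (H : NewtonData ω L0 K σ κ τ ζ ε η b u0) (n : ℕ) :
    nbhd K ε n ⊆ nbhd K ε 0 := by
  induction n with
  | zero => exact subset_rfl
  | succ n ih => exact (H.nbhd_succ_subset n).trans ih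

theorem sigma_le_zero (H : NewtonData ω L0 K σ κ τ ζ ε η b u0) (n : ℕ) : σ n ≤ σ 0 :=
  antitone_nat_of_succ_le H.sigma_anti (Nat.zero_le n)

/-- The bound for the iterates. -/
def bd (τ : ℕ → ℝ) (η : ℝ) (n : ℕ) : ℝ := η * (1 + ∑ i ∈ Finset.range n, τ (i + 1))

theorem bd_le (H : NewtonData ω L0 K σ κ τ ζ ε η b u0) (n : ℕ) : bd τ η n ≤ b * η := by
  rw [bd, mul_comm]
  exact mul_le_mul_of_nonneg_right (H.sum_tau_le n) H.eta_pos.le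

/-- The induction hypothesis. -/
structure Good (ω L0 : ℝ) (K : Set (ℝ × ℝ)) (σ τ ε : ℕ → ℝ) (η : ℝ)
    (u0 : ℂ × ℂ → Site → ℂ) (n : ℕ) : Prop where
  smooth : ∀ x, ContDiffOn ℂ (⊤ : ℕ∞) (fun z => uC ω L0 u0 n z x) (nbhd K ε n)
  small : ∀ z ∈ nbhd K ε n, nrm (σ n) (ballN (scale L0 n)) (uC ω L0 u0 n z) ≤ bd τ η n
  resid : ∀ z ∈ nbhd K ε n, ∀ x ∈ ball (scale L0 n),
    ‖Fc ω (ballN (scale L0 n)) z.2 (uC ω L0 u0 n z) x‖ * wS (σ n) x ≤ 512 * ω * (η * τ n) ^ 2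

theorem Good.le_sixteenth (H : NewtonData ω L0 K σ κ τ ζ ε η b u0) {n : ℕ}
    (G : Good ω L0 K σ τ ε η u0 n) {z : ℂ × ℂ} (hz : z ∈ nbhd K ε n) :
    nrm (σ n) (ballN (scale L0 n)) (uC ω L0 u0 n z) ≤ 1 / 16 :=
  (G.small z hz).trans ((H.bd_le n).trans H.eta_le)

theorem Good.succ_le (H : NewtonData ω L0 K σ κ τ ζ ε η b u0) {n : ℕ}
    (G : Good ω L0 K σ τ ε η u0 n) {z : ℂ × ℂ} (hz : z ∈ nbhd K ε n) :
    nrm (σ (n + 1)) (ballN (scale L0 (n + 1))) (uC ω L0 u0 n z) ≤ bd τ η n := by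
  rw [nrm_succ_eq H.hL0 _ n (H.uC_supp n z)]
  exact (nrm_mono (H.sigma_anti n) _ _).trans (G.small z hz)

theorem good_zero (H : NewtonData ω L0 K σ κ τ ζ ε η b u0) : Good ω L0 K σ τ ε η u0 0 where
  smooth := H.smooth
  small z hz := by
    rw [scale_zero, bd, Finset.sum_range_zero, add_zero, mul_one]
    exact H.small z hz
  resid z hz x hx := by
    rw [scale_zero] at hx ⊢
    have := H.hω
    rw [show uC ω L0 u0 0 z = u0 z from rfl, H.eqn z hz x hx, norm_zero, zero_mul]
    positivity

/-- The residual on the enlarged ball. -/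
theorem resid_succ (H : NewtonData ω L0 K σ κ τ ζ ε η b u0) {n : ℕ}
    (G : Good ω L0 K σ τ ε η u0 n) {z : ℂ × ℂ} (hz : z ∈ nbhd K ε n) {x : Site}
    (hx : x ≠ siteN) :
    ‖Fc ω (ballN (scale L0 (n + 1))) z.2 (uC ω L0 u0 n z) x‖ * wS (σ (n + 1)) x
      ≤ (512 * ω + 1 + 128 * ω * b ^ 2) * η ^ 2 * (τ (n + 1) * ζ (n + 1)) := by
  rw [Fc_eq_of_support (ballN_mono (scale_le_succ H.hL0 n)) (H.uC_supp n z)]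
  have hω := H.hω
  have hτζ : 0 ≤ τ (n + 1) * ζ (n + 1) := mul_nonneg (H.tau_nonneg _) (H.zeta_nonneg _)
  by_cases hxb : x ∈ ball (scale L0 n)
  -- Inside the old ball the residual is already quadratic in the last increment.
  · calc _ ≤ ‖Fc ω (ballN (scale L0 n)) z.2 (uC ω L0 u0 n z) x‖ * wS (σ n) x :=
          mul_le_mul_of_nonneg_left (wS_mono (H.sigma_anti n) x) (norm_nonneg _)
      _ ≤ 512 * ω * (η * τ n) ^ 2 := G.resid z hz x hxb
      _ = 512 * ω * η ^ 2 * τ n ^ 2 := by ring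
      _ ≤ 512 * ω * η ^ 2 * (τ (n + 1) * ζ (n + 1)) :=
          mul_le_mul_of_nonneg_left (H.tau_sq_le n) (by positivity)
      _ ≤ _ := by
          refine mul_le_mul_of_nonneg_right ?_ hτζ
          refine mul_le_mul_of_nonneg_right ?_ (sq_nonneg _)
          have : 0 ≤ 128 * ω * b ^ 2 := by positivity
          linarith
  -- Outside the old ball the linear part reaches `x` only from the kernel site and only through the
  -- detuning `Ω - Ω₀`. This term and the nonlinear one are of order `η²` in the old weight; passing
  -- to the smaller `σ` supplies the factor `τζ`.
  · have hlin : ∑ y ∈ ballN (scale L0 n), Lc ω z.2 x y * uC ω L0 u0 n z y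
        = (z.2 - (Omega0 ω : ℂ)) * cpl ω x siteN * z.1 := by
      rw [ballN, Finset.sum_insert (siteN_notMem_ball _), H.uC_kernel, Lc, if_neg hx, zero_add,
        Finset.sum_eq_zero fun y hy => by rw [Lc_eq_zero _ hxb hx hy, zero_mul], add_zero]
    have h16 : nrm (σ n) (ballN (scale L0 n)) (uC ω L0 u0 n z) ≤ 1 / 8 :=
      (Good.le_sixteenth H G hz).trans (by norm_num)
    have hphi := norm_Phi_le hω (σ := ⟨σ n, H.sigma_nonneg n⟩) h16 x
    have hnb := (G.small z hz).trans (H.bd_le n)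
    have hsq : nrm (σ n) (ballN (scale L0 n)) (uC ω L0 u0 n z) ^ 2 ≤ (b * η) ^ 2 :=
      pow_le_pow_left₀ (nrm_nonneg _ _ _) hnb 2
    have hc := cpl_le hω (σ n) x siteN
    have hw := wS_mono (H.sigma_le_zero n) siteN
    have hj : ((siteN.j : ℕ) : ℝ) = 1 := by norm_num [siteN, Site.j]
    rw [hj] at hc
    have hd := H.detuning z (H.nbhd_subset_zero n hz)
    have h1 : ‖Fc ω (ballN (scale L0 n)) z.2 (uC ω L0 u0 n z) x‖ * wS (σ n) x
        ≤ η ^ 2 + ω * (128 * (b * η) ^ 2) := by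
      rw [Fc, hlin]
      calc _ ≤ (‖(z.2 - (Omega0 ω : ℂ)) * cpl ω x siteN * z.1‖
            + ‖(ω : ℂ) * Phi ω (ballN (scale L0 n)) (uC ω L0 u0 n z) x‖) * wS (σ n) x :=
            mul_le_mul_of_nonneg_right (norm_add_le _ _) (wS_pos _ _).le
        _ = ‖z.2 - (Omega0 ω : ℂ)‖ * ‖z.1‖ * (|cpl ω x siteN| * wS (σ n) x)
            + ω * (‖Phi ω (ballN (scale L0 n)) (uC ω L0 u0 n z) x‖ * wS (σ n) x) := by
            rw [norm_mul, norm_mul, norm_mul, Complex.norm_real, Complex.norm_real,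
              Real.norm_of_nonneg hω.le, Real.norm_eq_abs]
            ring
        _ ≤ ‖z.2 - (Omega0 ω : ℂ)‖ * ‖z.1‖ * (2 * wS (σ 0) siteN)
            + ω * (128 * (b * η) ^ 2) := by
            refine add_le_add ?_ ?_
            · exact mul_le_mul_of_nonneg_left (by linarith) (by positivity)
            · exact mul_le_mul_of_nonneg_left
                (hphi.trans (mul_le_mul_of_nonneg_left hsq (by norm_num))) hω.le
        _ ≤ _ := by linarith
    calc _ ≤ ‖Fc ω (ballN (scale L0 n)) z.2 (uC ω L0 u0 n z) x‖
          * (wS (σ n) x * (τ (n + 1) * ζ (n + 1))) :=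
          mul_le_mul_of_nonneg_left (H.decay n x hxb hx) (norm_nonneg _)
      _ = ‖Fc ω (ballN (scale L0 n)) z.2 (uC ω L0 u0 n z) x‖ * wS (σ n) x
          * (τ (n + 1) * ζ (n + 1)) := by ring
      _ ≤ _ := by
          refine mul_le_mul_of_nonneg_right (h1.trans ?_) hτζ
          have : 0 ≤ 512 * ω * η ^ 2 := by positivity
          linarith

/-- Lipschitz estimate for the iterates near the real parameter set. -/
theorem lipschitz (H : NewtonData ω L0 K σ κ τ ζ ε η b u0) {n : ℕ}
    (G : Good ω L0 K σ τ ε η u0 n) {p : ℝ × ℝ} (hp : p ∈ K) {z : ℂ × ℂ}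
    (hz : dist z (incl p) < ε n) :
    nrm (σ n) (ballN (scale L0 n)) (uC ω L0 u0 n z - uC ω L0 u0 n (incl p))
      ≤ (ballN (scale L0 n)).card * (1 / 4 * (dist z (incl p) / ε n)) := by
  have hε := H.eps_pos n
  have hsub : Metric.ball (incl p) (ε n) ⊆ nbhd K ε n := Metric.ball_subset_thickening
    (Set.mem_image_of_mem _ hp) _
  rw [nrm, ← nsmul_eq_mul]
  refine Finset.sum_le_card_nsmul _ _ _ fun x hx => ?_
  have hw := wS_pos (σ n) x
  have hb : ∀ q ∈ Metric.ball (incl p) (ε n), ‖uC ω L0 u0 n q x‖ * wS (σ n) x ≤ 1 / 16 :=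
    fun q hq => (Finset.single_le_sum (f := fun x => ‖uC ω L0 u0 n q x‖ * wS (σ n) x)
      (fun y _ => mul_nonneg (norm_nonneg _) (wS_pos _ y).le) hx).trans
        (Good.le_sixteenth H G (hsub hq))
  -- Two values of weighted size at most `1/16` differ by less than `1/4`. A Schwarz-type estimate
  -- on the ball of radius `ε n` then gives a weighted Lipschitz constant `(1/4)/ε n` for each
  -- coefficient.
  have hmaps : Set.MapsTo (fun q => uC ω L0 u0 n q x) (Metric.ball (incl p) (ε n))
      (Metric.ball (uC ω L0 u0 n (incl p) x) (1 / 4 / wS (σ n) x)) := by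
    intro q hq
    rw [Metric.mem_ball, dist_eq_norm, lt_div_iff₀ hw]
    have h1 := hb q hq
    have h2 := hb (incl p) (Metric.mem_ball_self hε)
    have h3 := mul_le_mul_of_nonneg_right (norm_sub_le (uC ω L0 u0 n q x)
      (uC ω L0 u0 n (incl p) x)) hw.le
    rw [add_mul] at h3
    linarith
  have hd : DifferentiableOn ℂ (fun q => uC ω L0 u0 n q x) (Metric.ball (incl p) (ε n)) :=
    ((G.smooth x).differentiableOn (by simp)).mono hsub
  have h := Complex.dist_le_div_mul_dist_of_mapsTo_ball hd
    (hmaps.mono_right Metric.ball_subset_closedBall) (Metric.mem_ball.2 hz)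
  rw [dist_eq_norm] at h
  calc _ ≤ 1 / 4 / wS (σ n) x / ε n * dist z (incl p) * wS (σ n) x :=
        mul_le_mul_of_nonneg_right h hw.le
    _ = _ := by field_simp

/-- The inverse bound extends to a complex neighbourhood. -/
theorem inverse_succ (H : NewtonData ω L0 K σ κ τ ζ ε η b u0) {n : ℕ}
    (G : ∀ m ≤ n, Good ω L0 K σ τ ε η u0 m) {z : ℂ × ℂ} (hz : z ∈ nbhd K ε (n + 1)) :
    IsUnit (jacN ω (scale L0 (n + 1)) z.2 (uC ω L0 u0 n z)).det ∧
      ∀ c : ball (scale L0 (n + 1)) → ℂ,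
        ∑ x, ‖((jacN ω (scale L0 (n + 1)) z.2 (uC ω L0 u0 n z))⁻¹ *ᵥ c) x‖ * wS (σ (n + 1)) x
          ≤ 2 * κ (n + 1) * ∑ x, ‖c x‖ * wS (σ (n + 1)) x := by
  obtain ⟨_, ⟨p, hp, rfl⟩, hzp⟩ := Metric.mem_thickening_iff.1 hz
  have hω := H.hω
  have hK : ∀ m, ∀ p ∈ K, incl p ∈ nbhd K ε m := fun m p hp =>
    Metric.self_subset_thickening (H.eps_pos m) _ (Set.mem_image_of_mem _ hp)
  have hκ := H.one_le_kappa (n + 1)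
  have hε := H.eps_pos n
  obtain ⟨hdet, h0⟩ := H.inverse n (fun m hm p hp =>
    (Good.le_sixteenth H (G m hm) (hK m p hp)).trans (by norm_num)) p hp
  refine inverse_perturbation (fun x : ball (scale L0 (n + 1)) => wS_pos (σ (n + 1)) x)
    (lt_of_lt_of_le one_pos hκ) hdet h0 fun c => ?_
  -- The vector is extended by zero because the Lipschitz estimate for the Jacobian sums over the
  -- ball with the kernel site.
  set h : Site → ℂ := fun x => if hx : x ∈ ball (scale L0 (n + 1)) then c ⟨x, hx⟩ else 0 with hh
  have hhN : h siteN = 0 := dif_neg (siteN_notMem_ball _)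
  have hhx : ∀ x : ball (scale L0 (n + 1)), h x = c x := fun x => dif_pos x.2
  have hz' : z ∈ nbhd K ε n := H.nbhd_succ_subset n hz
  have b1 := (Good.succ_le H (G n le_rfl) hz').trans ((H.bd_le n).trans H.eta_le)
  have b2 := (Good.succ_le H (G n le_rfl) (hK n p hp)).trans ((H.bd_le n).trans H.eta_le)
  have hnh : nrm (σ (n + 1)) (ballN (scale L0 (n + 1))) h = ∑ x, ‖c x‖ * wS (σ (n + 1)) x := by
    rw [nrm, sum_ballN_of_zero (by rw [hhN, norm_zero, zero_mul])]
    exact Finset.sum_congr rfl fun x _ => by rw [hhx]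
  have hdiff : nrm (σ (n + 1)) (ballN (scale L0 (n + 1)))
      (uC ω L0 u0 n z - uC ω L0 u0 n (incl p)) ≤ κ (n + 1) * (1 / 4 * (ε (n + 1) / ε n)) := by
    rw [nrm_succ_eq H.hL0 _ n (fun x hx => by
      rw [Pi.sub_apply, H.uC_supp n z x hx, H.uC_supp n _ x hx, sub_zero])]
    refine (nrm_mono (H.sigma_anti n) _ _).trans ((lipschitz H (G n le_rfl) hp
      (hzp.trans_le (H.eps_anti n))).trans ?_)
    refine mul_le_mul (le_trans ?_ (H.card_le (n + 1))) ?_ (by positivity) (by linarith)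
    · exact_mod_cast Finset.card_le_card (ballN_mono (scale_le_succ H.hL0 n))
    · gcongr
  have hterm : ∀ x : ball (scale L0 (n + 1)),
      ‖((jacN ω (scale L0 (n + 1)) z.2 (uC ω L0 u0 n z)
        - jacN ω (scale L0 (n + 1)) (incl p).2 (uC ω L0 u0 n (incl p))) *ᵥ c) x‖
          * wS (σ (n + 1)) x
        ≤ (2 * κ (n + 1) * ε (n + 1) + 1024 * ω * (κ (n + 1) * (1 / 4 * (ε (n + 1) / ε n))))
          * ∑ x, ‖c x‖ * wS (σ (n + 1)) x := by
    intro x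
    have h1 := norm_Jc_sub_le hω (σ := ⟨σ (n + 1), H.sigma_nonneg _⟩)
      (b1.trans (by norm_num)) (b2.trans (by norm_num)) (H.index_le (n + 1)) z.2 (incl p).2 h x
    rw [sum_ballN_of_zero (by rw [hhN, mul_zero])] at h1
    have h2 : ((jacN ω (scale L0 (n + 1)) z.2 (uC ω L0 u0 n z)
        - jacN ω (scale L0 (n + 1)) (incl p).2 (uC ω L0 u0 n (incl p))) *ᵥ c) x
        = ∑ y : ball (scale L0 (n + 1)), (Jc ω (ballN (scale L0 (n + 1))) z.2 (uC ω L0 u0 n z) x y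
          - Jc ω (ballN (scale L0 (n + 1))) (incl p).2 (uC ω L0 u0 n (incl p)) x y) * h y :=
      Finset.sum_congr rfl fun y _ => by rw [hhx]; rfl
    rw [h2]
    refine h1.trans ?_
    rw [hnh]
    refine mul_le_mul_of_nonneg_right ?_
      (Finset.sum_nonneg fun y _ => mul_nonneg (norm_nonneg _) (wS_pos _ _).le)
    have h3 : ‖z.2 - (incl p).2‖ ≤ ε (n + 1) := by
      rw [dist_eq_norm] at hzp
      exact (norm_snd_le (z - incl p)).trans hzp.le
    gcongr
  refine (Finset.sum_le_card_nsmul _ _ _ fun x _ => hterm x).trans ?_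
  rw [nsmul_eq_mul, ← mul_assoc]
  refine mul_le_mul_of_nonneg_right ?_
    (Finset.sum_nonneg fun y _ => mul_nonneg (norm_nonneg _) (wS_pos _ _).le)
  have hcard : ((Finset.univ : Finset (ball (scale L0 (n + 1)))).card : ℝ) ≤ κ (n + 1) := by
    refine le_trans ?_ (H.card_le (n + 1))
    rw [Finset.card_univ, Fintype.card_coe]
    exact_mod_cast Finset.card_le_card (ball_subset_ballN _)
  have hq := H.eps_quot n
  have hε1 := H.eps_pos (n + 1)
  have hle : ε (n + 1) ≤ ε (n + 1) / ε n := by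
    rw [le_div_iff₀ hε]
    exact mul_le_of_le_one_right hε1.le (H.eps_le_one n)
  -- Of the three factors `κ` in `eps_quot`, one counts the rows, one bounds the index or the number
  -- of coefficients in the Lipschitz estimate, and one comes from the required smallness `1/(2κ)`.
  calc _ ≤ κ (n + 1) * (2 * κ (n + 1) * (ε (n + 1) / ε n)
        + 1024 * ω * (κ (n + 1) * (1 / 4 * (ε (n + 1) / ε n)))) := by gcongr
    _ = 4 * (1 + 128 * ω) * κ (n + 1) ^ 3 * ε (n + 1) / ε n * (1 / (2 * κ (n + 1))) := by
        field_simp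
        ring
    _ ≤ 1 * (1 / (2 * κ (n + 1))) := by
        refine mul_le_mul_of_nonneg_right ((div_le_one hε).2 hq) (by positivity)
    _ = _ := one_mul _

/-- The bound for the increment. -/
theorem step_le (H : NewtonData ω L0 K σ κ τ ζ ε η b u0) {n : ℕ}
    (G : ∀ m ≤ n, Good ω L0 K σ τ ε η u0 m) {z : ℂ × ℂ} (hz : z ∈ nbhd K ε (n + 1)) :
    nrm (σ (n + 1)) (ballN (scale L0 (n + 1)))
      (stepC ω (scale L0 (n + 1)) z.2 (uC ω L0 u0 n z)) ≤ η * τ (n + 1) := by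
  have hω := H.hω
  have hκ := H.one_le_kappa (n + 1)
  have hz' := H.nbhd_succ_subset n hz
  rw [nrm, sum_ballN_of_zero (by
    rw [stepC_of_notMem _ _ (siteN_notMem_ball _), norm_zero, zero_mul])]
  have h1 := (H.inverse_succ G hz).2 fun y : ball (scale L0 (n + 1)) =>
    Fc ω (ballN (scale L0 (n + 1))) z.2 (uC ω L0 u0 n z) y
  have hcard : ((Finset.univ : Finset (ball (scale L0 (n + 1)))).card : ℝ) ≤ κ (n + 1) := by
    refine le_trans ?_ (H.card_le (n + 1))
    rw [Finset.card_univ, Fintype.card_coe]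
    exact_mod_cast Finset.card_le_card (ball_subset_ballN _)
  have h2 : ∑ y : ball (scale L0 (n + 1)),
      ‖Fc ω (ballN (scale L0 (n + 1))) z.2 (uC ω L0 u0 n z) y‖ * wS (σ (n + 1)) y
      ≤ κ (n + 1) * ((512 * ω + 1 + 128 * ω * b ^ 2) * η ^ 2 * (τ (n + 1) * ζ (n + 1))) := by
    refine (Finset.sum_le_card_nsmul _ _ _ fun x _ =>
      H.resid_succ (G n le_rfl) hz' (mem_ball.1 x.2).1).trans ?_
    rw [nsmul_eq_mul]
    have := H.tau_nonneg (n + 1)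
    have := H.zeta_nonneg (n + 1)
    exact mul_le_mul_of_nonneg_right hcard (by positivity)
  have h3 : ∀ x : ball (scale L0 (n + 1)),
      ‖stepC ω (scale L0 (n + 1)) z.2 (uC ω L0 u0 n z) x‖ * wS (σ (n + 1)) x
        = ‖((jacN ω (scale L0 (n + 1)) z.2 (uC ω L0 u0 n z))⁻¹ *ᵥ
          fun y : ball (scale L0 (n + 1)) =>
            Fc ω (ballN (scale L0 (n + 1))) z.2 (uC ω L0 u0 n z) y) x‖ * wS (σ (n + 1)) x :=
    fun x => by rw [stepC_of_mem, norm_neg]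
  rw [Finset.sum_congr rfl fun x _ => h3 x]
  have hq := H.quad n
  have hητ := mul_nonneg H.eta_pos.le (H.tau_nonneg (n + 1))
  -- One `κ` is the inverse and one counts the sites of the residual; `quad` removes both at the
  -- expense of `ζ`.
  calc _ ≤ 2 * κ (n + 1) * (κ (n + 1)
        * ((512 * ω + 1 + 128 * ω * b ^ 2) * η ^ 2 * (τ (n + 1) * ζ (n + 1)))) :=
        h1.trans (mul_le_mul_of_nonneg_left h2 (by linarith))
    _ = (2 * κ (n + 1) ^ 2 * η * (512 * ω + 1 + 128 * ω * b ^ 2) * ζ (n + 1))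
        * (η * τ (n + 1)) := by ring
    _ ≤ 1 * (η * τ (n + 1)) := mul_le_mul_of_nonneg_right hq hητ
    _ = _ := one_mul _

/-- The step cancels the linearized equation on the new ball, so the new residual there is a pure
Taylor remainder, quadratic in the increment. Holomorphy follows from Cramer's rule, as the Jacobian
is invertible on the whole complex neighbourhood. -/
theorem good_succ (H : NewtonData ω L0 K σ κ τ ζ ε η b u0) {n : ℕ}
    (G : ∀ m ≤ n, Good ω L0 K σ τ ε η u0 m) : Good ω L0 K σ τ ε η u0 (n + 1) := by
  have hω := H.hω
  have Gn := G n le_rfl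
  have small : ∀ z ∈ nbhd K ε (n + 1), nrm (σ (n + 1)) (ballN (scale L0 (n + 1)))
      (uC ω L0 u0 (n + 1) z) ≤ bd τ η (n + 1) := by
    intro z hz
    have h1 := Good.succ_le H Gn (H.nbhd_succ_subset n hz)
    have h2 := H.step_le G hz
    refine (nrm_add_le _ _ _ _).trans ((add_le_add h1 h2).trans_eq ?_)
    rw [bd, bd, Finset.sum_range_succ]
    ring
  refine ⟨fun x => ?_, small, fun z hz x hx => ?_⟩
  · have hu : ContDiffOn ℂ (⊤ : ℕ∞) (fun z => uC ω L0 u0 n z x) (nbhd K ε (n + 1)) :=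
      (Gn.smooth x).mono (H.nbhd_succ_subset n)
    refine hu.add ?_
    by_cases hx : x ∈ ball (scale L0 (n + 1))
    · have hΩ : ContDiffOn ℂ (⊤ : ℕ∞) (fun z : ℂ × ℂ => z.2) (nbhd K ε (n + 1)) :=
        contDiffOn_snd
      have hc : ∀ y ∈ ballN (scale L0 (n + 1)), ContDiffOn ℂ (⊤ : ℕ∞)
          (fun z => uC ω L0 u0 n z y) (nbhd K ε (n + 1)) := fun y _ =>
        (Gn.smooth y).mono (H.nbhd_succ_subset n)
      have hs : ∀ z ∈ nbhd K ε (n + 1), nrm 0 (ballN (scale L0 (n + 1))) (uC ω L0 u0 n z)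
          ≤ 1 / 8 := fun z hz => (nrm_mono (H.sigma_nonneg (n + 1)) _ _).trans
        ((Good.succ_le H Gn (H.nbhd_succ_subset n hz)).trans
          ((H.bd_le n).trans (H.eta_le.trans (by norm_num))))
      refine (contDiffOn_inv_mulVec
        (A := fun z => jacN ω (scale L0 (n + 1)) z.2 (uC ω L0 u0 n z))
        (F := fun z => fun y : ball (scale L0 (n + 1)) =>
          Fc ω (ballN (scale L0 (n + 1))) z.2 (uC ω L0 u0 n z) y)
        (fun i j => contDiffOn_Jc hω hΩ hc hs i j) (fun i => contDiffOn_Fc hω hΩ hc hs i)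
        (fun z hz => (H.inverse_succ G hz).1) ⟨x, hx⟩).neg.congr fun z _ => ?_
      exact stepC_of_mem _ _ ⟨x, hx⟩
    · exact contDiffOn_const.congr fun z _ => stepC_of_notMem _ _ hx
  · have h1 := (Good.succ_le H Gn (H.nbhd_succ_subset n hz)).trans
      ((H.bd_le n).trans (H.eta_le.trans (by norm_num : (1 : ℝ) / 16 ≤ 1 / 8)))
    have h2 := (small z hz).trans
      ((H.bd_le (n + 1)).trans (H.eta_le.trans (by norm_num : (1 : ℝ) / 16 ≤ 1 / 8)))
    have h3 := norm_Fc_remainder_le hω (σ := ⟨σ (n + 1), H.sigma_nonneg _⟩) h1 h2 z.2 x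
    rw [linearized_stepC (H.inverse_succ G hz).1 hx, sub_zero] at h3
    refine h3.trans (mul_le_mul_of_nonneg_left ?_ (by positivity))
    exact pow_le_pow_left₀ (nrm_nonneg _ _ _) (H.step_le G hz) 2

theorem good (H : NewtonData ω L0 K σ κ τ ζ ε η b u0) (n : ℕ) : Good ω L0 K σ τ ε η u0 n := by
  induction n using Nat.strong_induction_on with
  | _ n ih =>
    cases n with
    | zero => exact H.good_zero
    | succ n => exact H.good_succ fun m hm => ih m (Nat.lt_succ_of_le hm)

end NewtonData

end VortexFilament

end

/-! ### Nonresonance and the solution on the smallest ball. -/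

noncomputable section

namespace VortexFilament

variable {ω : ℝ}

/-! ### The kernel -/

/-- For diophantine `ω` the kernel of `L(Ω₀)` is spanned by the eigenfunction at `siteN`. -/
theorem lam_ne_zero (hω : 0 < ω) (hdio : IsDiophantine ω) {x : Site} (hx : x ≠ siteN) :
    lam ω x ≠ 0 := by
  intro h
  have hmu : mu ω (Omega0 ω) x = -(x.k : ℝ) ^ 2 := by rw [lam] at h; linarith
  have h1 := sq_mu (ω := ω) (Omega0 ω) x
  rw [mul_pow, sq_Omega0 hω, hmu] at h1
  -- The value `μ = -k²` inserted into the characteristic equation, with `Ω₀² = 1 + 2ω`, is an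
  -- integer linear relation for `ω`.
  have h2 : (2 * ((x.j : ℝ) ^ 2 - (x.k : ℝ) ^ 2)) * ω - ((x.k : ℝ) ^ 4 - (x.j : ℝ) ^ 2) = 0 := by
    nlinarith
  have hjk : x.j = x.k := by
    by_contra hne
    obtain ⟨κ, hκ, τ, hτ, hd⟩ := hdio
    have hq : (2 * ((x.j : ℤ) ^ 2 - (x.k : ℤ) ^ 2)) ≠ 0 := by
      intro h0
      have h3 : (x.j : ℤ) ^ 2 = (x.k : ℤ) ^ 2 := by linarith
      have h4 : x.j ^ 2 = x.k ^ 2 := by exact_mod_cast h3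
      exact hne (Nat.pow_left_injective (n := 2) (by norm_num) h4)
    have h5 := hd ((x.k : ℤ) ^ 4 - (x.j : ℤ) ^ 2) _ hq
    push_cast at h5
    rw [h2, abs_zero] at h5
    have h6 : (0 : ℝ) < |2 * ((x.j : ℝ) ^ 2 - (x.k : ℝ) ^ 2)| := by
      rw [abs_pos]
      exact_mod_cast hq
    have h7 := div_pos hκ (Real.rpow_pos_of_pos h6 τ)
    linarith
  -- Now `j = k` and `k⁴ = k²`, so `k` is `0` or `1`. The site `(0,0,1)` has eigenvalue `2ω`, the
  -- site `(1,1,1)` has a positive one, and only the kernel site remains.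
  rw [hjk] at h2
  have h3 : (x.k : ℝ) ^ 4 = (x.k : ℝ) ^ 2 := by linarith
  have h4 : x.k = 0 ∨ x.k = 1 := by
    have h5 : x.k ^ 4 = x.k ^ 2 := by exact_mod_cast h3
    by_contra hcon
    push Not at hcon
    have h6 : 2 ≤ x.k := by omega
    have h7 := Nat.pow_lt_pow_right (a := x.k) (by omega) (show 2 < 4 by norm_num)
    omega
  rcases h4 with h4 | h4
  · have hj : x.j = 0 := hjk.trans h4
    rw [mu, rad_of_j_eq_zero hω _ hj, x.l_of_j_eq_zero hj, h4] at hmu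
    push_cast at hmu
    linarith
  · rcases x.l_eq_one_or with hl | hl
    · rw [mu, hl, h4] at hmu
      have := Real.sqrt_nonneg ((x.j : ℝ) ^ 2 * Omega0 ω ^ 2 + ω ^ 2)
      rw [rad] at hmu
      push_cast at hmu
      linarith
    · exact hx (Site.ext (hjk.trans h4) h4 hl)

/-! ### The equation on the smallest ball -/

/-- The coefficients with value `r` at the kernel site and given values on a ball. -/
def glue (R : ℝ) (r : ℂ) (c : ball R → ℂ) : Site → ℂ := fun x =>
  if h : x ∈ ball R then c ⟨x, h⟩ else if x = siteN then r else 0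

theorem glue_mem {R : ℝ} (r : ℂ) (c : ball R → ℂ) (x : ball R) : glue R r c x = c x := dif_pos x.2

theorem glue_siteN {R : ℝ} (r : ℂ) (c : ball R → ℂ) : glue R r c siteN = r := by
  rw [glue, dif_neg (siteN_notMem_ball R), if_pos rfl]

theorem glue_of_notMem {R : ℝ} (r : ℂ) (c : ball R → ℂ) {x : Site} (hx : x ∉ ballN R) :
    glue R r c x = 0 := by
  rw [mem_ballN, not_or] at hx
  rw [glue, dif_neg hx.2, if_neg hx.1]

theorem glue_add {R : ℝ} (r r' : ℂ) (c c' : ball R → ℂ) :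
    glue R r c + glue R r' c' = glue R (r + r') (c + c') := by
  funext x
  simp only [glue, Pi.add_apply]
  split_ifs <;> simp

theorem wS_zero (x : Site) : wS 0 x = 1 := by simp [wS]

theorem nrm_glue {R : ℝ} (σ : ℝ) (r : ℂ) (c : ball R → ℂ) :
    nrm σ (ballN R) (glue R r c) = ‖r‖ * wS σ siteN + ∑ x, ‖c x‖ * wS σ x := by
  rw [nrm, ballN, Finset.sum_insert (siteN_notMem_ball R), glue_siteN, ← Finset.sum_coe_sort]
  congr 1
  exact Finset.sum_congr rfl fun x _ => by rw [glue_mem]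

theorem nrm_zero_glue_le {R : ℝ} (r : ℂ) (c : ball R → ℂ) :
    nrm 0 (ballN R) (glue R r c) ≤ ‖r‖ + (ball R).card * ‖c‖ := by
  rw [nrm_glue, wS_zero, mul_one]
  gcongr
  refine (Finset.sum_le_card_nsmul _ _ ‖c‖ fun x _ => ?_).trans_eq ?_
  · rw [wS_zero, mul_one]
    exact norm_le_pi_norm c x
  · rw [nsmul_eq_mul, Finset.card_univ, Fintype.card_coe]

theorem Phi_zero (B : Finset Site) (x : Site) : Phi ω B 0 x = 0 := by
  have : (fun t θ => ubar ω B 0 t θ ^ 2 / (1 + ubar ω B 0 t θ)) = fun _ _ => (0 : ℂ) := by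
    funext t θ
    simp [ubar]
  rw [Phi, this]
  simp [ip]

theorem Jphi_zero (B : Finset Site) (x y : Site) : Jphi ω B 0 x y = 0 := by
  have : (fun t θ => (2 * ubar ω B 0 t θ + ubar ω B 0 t θ ^ 2) / (1 + ubar ω B 0 t θ) ^ 2
      * (starRingEnd ℂ) (e0 ω y t θ)) = fun _ _ => (0 : ℂ) := by
    funext t θ
    simp [ubar]
  rw [Jphi, this]
  simp [ip]

theorem Fc_zero (B : Finset Site) (Ω : ℂ) (x : Site) : Fc ω B Ω 0 x = 0 := by
  simp [Fc, Phi_zero]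

/-- The equation is close to its diagonal part at the bifurcation point. -/
theorem norm_Fc_sub_diag_le (hω : 0 < ω) {B : Finset Site} {c h : Site → ℂ}
    (hc : nrm 0 B c ≤ 1 / 8) (hch : nrm 0 B (c + h) ≤ 1 / 8) {J : ℝ}
    (hJ : ∀ y ∈ B, (y.j : ℝ) ≤ J) (Ω : ℂ) {x : Site} (hx : x ∈ B) :
    ‖Fc ω B Ω (c + h) x - Fc ω B Ω c x - lam ω x * h x‖
      ≤ (2 * J * ‖Ω - Omega0 ω‖ + 1024 * ω * nrm 0 B c + 512 * ω * nrm 0 B h) * nrm 0 B h := by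
  have h1 := norm_Fc_remainder_le hω (σ := ⟨0, le_rfl⟩) hc hch Ω x
  have hz : nrm 0 B 0 ≤ 1 / 8 := by simp [nrm]
  have h2 := norm_Jc_sub_le hω (σ := ⟨0, le_rfl⟩) hc hz hJ Ω (Omega0 ω) h x
  -- At `Ω₀` and zero coefficients the nonlinear part of the Jacobian vanishes and the linear part
  -- is diagonal.
  have h3 : ∑ y ∈ B, Jc ω B (Omega0 ω) 0 x y * h y = lam ω x * h x := by
    rw [Finset.sum_eq_single_of_mem x hx]
    · simp [Jc, Jphi_zero, Lc]
    · intro y _ hy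
      simp [Jc, Jphi_zero, Lc, Ne.symm hy]
  rw [wS_zero, mul_one] at h1 h2
  rw [sub_zero] at h2
  have h4 : Fc ω B Ω (c + h) x - Fc ω B Ω c x - lam ω x * h x
      = (Fc ω B Ω (c + h) x - (Fc ω B Ω c x + ∑ y ∈ B, Jc ω B Ω c x y * h y))
        + ∑ y ∈ B, (Jc ω B Ω c x y - Jc ω B (Omega0 ω) 0 x y) * h y := by
    simp only [sub_mul, Finset.sum_sub_distrib]
    rw [h3]
    ring
  rw [h4]
  refine (norm_add_le _ _).trans ((add_le_add h1 h2).trans_eq ?_)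
  ring

/-- Finitely many nonzero eigenvalues are bounded away from zero. The factor with `card + 1` is
prepared for division by the eigenvalue followed by a comparison of `ℓ¹` with the supremum norm,
which leaves a contraction by `1/2`. The constants depend only on `ω` and `L0`. -/
theorem exists_norm_Fc_sub_diag_le (hω : 0 < ω) (hdio : IsDiophantine ω) (L0 : ℝ) :
    ∃ d : ℝ, 0 < d ∧ ∃ U : ℝ, 0 < U ∧ U ≤ 1 / 16 ∧ ∀ Ω : ℂ, ‖Ω - Omega0 ω‖ ≤ d → ∀ c h : Site → ℂ,
      nrm 0 (ballN L0) c ≤ U → nrm 0 (ballN L0) (c + h) ≤ U → ∀ x ∈ ball L0,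
        ‖Fc ω (ballN L0) Ω (c + h) x - Fc ω (ballN L0) Ω c x - lam ω x * h x‖
          ≤ |lam ω x| * (1 / (2 * ((ball L0).card + 1)) * nrm 0 (ballN L0) h) := by
  obtain ⟨m, hm, hmx⟩ : ∃ m > 0, ∀ x ∈ ball L0, m ≤ |lam ω x| := by
    rcases (ball L0).eq_empty_or_nonempty with h | h
    · exact ⟨1, one_pos, by simp [h]⟩
    · obtain ⟨x0, hx0, hmin⟩ := (ball L0).exists_min_image (fun x => |lam ω x|) h
      exact ⟨|lam ω x0|, abs_pos.2 (lam_ne_zero hω hdio (mem_ball.1 hx0).1), hmin⟩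
  obtain ⟨J, hJ1, hJ⟩ : ∃ J : ℝ, 1 ≤ J ∧ ∀ y ∈ ballN L0, (y.j : ℝ) ≤ J := by
    refine ⟨1 + ∑ y ∈ ballN L0, (y.j : ℝ), ?_, fun y hy => ?_⟩
    · have : 0 ≤ ∑ y ∈ ballN L0, (y.j : ℝ) := Finset.sum_nonneg fun _ _ => Nat.cast_nonneg _
      linarith
    · have := Finset.single_le_sum (f := fun y : Site => (y.j : ℝ))
        (fun _ _ => Nat.cast_nonneg _) hy
      linarith
  set N : ℝ := (ball L0).card + 1 with hN
  have hNpos : 0 < N := by positivity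
  -- The three contributions become `m/(4N)`, `m/(8N)` and `m/(8N)`, with sum `m/(2N)`; the last
  -- uses that `h` is a difference of two vectors of size at most `U`.
  refine ⟨m / (8 * J * N), by positivity, min (1 / 16) (m / (8192 * ω * N)), by positivity,
    min_le_left _ _, fun Ω hΩ c h hc hch x hx => ?_⟩
  have hc' := hc.trans (min_le_left _ _)
  have hch' := hch.trans (min_le_left _ _)
  refine (norm_Fc_sub_diag_le hω (by linarith) (by linarith) hJ Ω
    (ball_subset_ballN _ hx)).trans ?_
  have hc2 := hc.trans (min_le_right _ _)
  have hch2 := hch.trans (min_le_right _ _)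
  have hh : nrm 0 (ballN L0) h ≤ 2 * (m / (8192 * ω * N)) := by
    have h1 := nrm_add_le 0 (ballN L0) (c + h) (-c)
    have h2 : nrm 0 (ballN L0) (-c) = nrm 0 (ballN L0) c := by simp [nrm]
    rw [h2, add_neg_cancel_comm] at h1
    linarith
  rw [← mul_assoc]
  refine mul_le_mul_of_nonneg_right ?_ (nrm_nonneg _ _ _)
  calc _ ≤ 2 * J * (m / (8 * J * N)) + 1024 * ω * (m / (8192 * ω * N))
        + 512 * ω * (2 * (m / (8192 * ω * N))) := by gcongr
    _ = m * (1 / (2 * N)) := by field_simp; ring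
    _ ≤ _ := mul_le_mul_of_nonneg_right (hmx x hx) (by positivity)

/-- The equation on the ball, divided by the eigenvalues. -/
def Feq (ω L0 : ℝ) (z : ℂ × ℂ) (c : ball L0 → ℂ) : ball L0 → ℂ := fun x =>
  Fc ω (ballN L0) z.2 (glue L0 z.1 c) x / lam ω x

theorem contDiffOn_Feq (hω : 0 < ω) {L0 R : ℝ} (hR : R * ((ball L0).card + 1) ≤ 1 / 8) :
    ContDiffOn ℂ (⊤ : ℕ∞) (fun q : (ℂ × ℂ) × (ball L0 → ℂ) => Feq ω L0 q.1 q.2)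
      {q | ‖q.1.1‖ < R ∧ ‖q.2‖ < R} := by
  rw [contDiffOn_pi]
  intro x
  refine ContDiffOn.div_const ?_ _
  refine contDiffOn_Fc hω (E := (ℂ × ℂ) × (ball L0 → ℂ))
    (c := fun q => glue L0 q.1.1 q.2) (Ω := fun q => q.1.2) ?_ (fun y hy => ?_) (fun q hq => ?_) x
  · exact (contDiff_snd.comp contDiff_fst).contDiffOn
  · simp only [glue]
    split_ifs with h1 h2
    · exact ((contDiff_apply ℂ ℂ (⟨y, h1⟩ : ball L0)).comp contDiff_snd).contDiffOn
    · exact (contDiff_fst.comp contDiff_fst).contDiffOn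
    · exact contDiffOn_const
  · refine (nrm_zero_glue_le _ _).trans (le_trans ?_ hR)
    have h1 := hq.1.le
    have h2 := mul_le_mul_of_nonneg_left hq.2.le (Nat.cast_nonneg (α := ℝ) (ball L0).card)
    linarith

/-- After division by the eigenvalues the system is the identity up to a small Lipschitz error. The
radius `U / (card + 1)` in the supremum norm keeps the `ℓ¹` size, kernel component included, below
`U`. -/
theorem exists_Feq_contraction (hω : 0 < ω) (hdio : IsDiophantine ω) (L0 : ℝ) :
    ∃ d : ℝ, 0 < d ∧ ∃ R : ℝ, 0 < R ∧ R * ((ball L0).card + 1) ≤ 1 / 16 ∧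
      ∀ z : ℂ × ℂ, ‖z.1‖ ≤ R → ‖z.2 - Omega0 ω‖ ≤ d →
        (∀ c c' : ball L0 → ℂ, ‖c‖ ≤ R → ‖c'‖ ≤ R →
          ‖(c' - Feq ω L0 z c') - (c - Feq ω L0 z c)‖ ≤ 1 / 2 * ‖c' - c‖) ∧
        ‖Feq ω L0 z 0‖ ≤ 1 / 2 * ‖z.1‖ := by
  obtain ⟨d, hd, U, hU, hU16, hF⟩ := exists_norm_Fc_sub_diag_le hω hdio L0
  have hN : (0 : ℝ) < (ball L0).card + 1 := by positivity
  refine ⟨d, hd, U / ((ball L0).card + 1), by positivity, ?_, fun z hz1 hz2 => ?_⟩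
  · rw [div_mul_cancel₀ _ hN.ne']
    exact hU16
  have hb : ∀ r : ℂ, ‖r‖ ≤ U / ((ball L0).card + 1) → ∀ c : ball L0 → ℂ,
      ‖c‖ ≤ U / ((ball L0).card + 1) → nrm 0 (ballN L0) (glue L0 r c) ≤ U := by
    intro r hr c hc
    refine (nrm_zero_glue_le _ _).trans ?_
    have h2 := mul_le_mul_of_nonneg_left hc (Nat.cast_nonneg (α := ℝ) (ball L0).card)
    have h3 : U / ((ball L0).card + 1) + (ball L0).card * (U / ((ball L0).card + 1)) = U := by
      field_simp
      ring
    linarith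
  have hdiv : ∀ (x : ball L0) (a : ℂ) (b : ℝ), ‖a‖ ≤ |lam ω x| * b → ‖a / lam ω x‖ ≤ b := by
    intro x a b h
    have h1 := abs_pos.2 (lam_ne_zero hω hdio (mem_ball.1 x.2).1)
    rw [norm_div, Complex.norm_real, Real.norm_eq_abs, div_le_iff₀ h1, mul_comm]
    exact h
  have hU0 : 0 ≤ U / ((ball L0).card + 1) := by positivity
  refine ⟨fun c c' hc hc' => ?_, ?_⟩
  · refine (pi_norm_le_iff_of_nonneg (by positivity)).2 fun x => ?_
    have h1 : glue L0 z.1 c + glue L0 0 (c' - c) = glue L0 z.1 c' := by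
      rw [glue_add, add_zero, add_sub_cancel]
    have h2 := hF z.2 hz2 (glue L0 z.1 c) (glue L0 0 (c' - c)) (hb _ hz1 _ hc)
      (by rw [h1]; exact hb _ hz1 _ hc') x x.2
    rw [h1, glue_mem] at h2
    have hl : (lam ω x : ℂ) ≠ 0 := by
      exact_mod_cast lam_ne_zero hω hdio (mem_ball.1 x.2).1
    have h3 : ((c' - Feq ω L0 z c') - (c - Feq ω L0 z c)) x
        = -((Fc ω (ballN L0) z.2 (glue L0 z.1 c') x - Fc ω (ballN L0) z.2 (glue L0 z.1 c) x
          - lam ω x * (c' - c) x) / lam ω x) := by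
      simp only [Pi.sub_apply, Feq]
      field_simp
      ring
    rw [h3, norm_neg]
    refine (hdiv x _ _ h2).trans ?_
    have h4 := nrm_zero_glue_le 0 (c' - c)
    rw [norm_zero, zero_add] at h4
    calc _ ≤ 1 / (2 * ((ball L0).card + 1 : ℝ)) * (((ball L0).card + 1) * ‖c' - c‖) := by
          refine mul_le_mul_of_nonneg_left (h4.trans ?_) (by positivity)
          refine mul_le_mul_of_nonneg_right ?_ (norm_nonneg _)
          linarith
      _ = _ := by field_simp
  · refine (pi_norm_le_iff_of_nonneg (by positivity)).2 fun x => ?_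
    have h0 : nrm 0 (ballN L0) 0 ≤ U := by simpa [nrm] using hU.le
    have h2 := hF z.2 hz2 0 (glue L0 z.1 0) h0
      (by rw [zero_add]; exact hb _ hz1 _ (by simpa using hU0)) x x.2
    rw [zero_add, Fc_zero, sub_zero, glue_mem, Pi.zero_apply, mul_zero, sub_zero] at h2
    refine (hdiv x _ _ h2).trans ?_
    have h4 := nrm_zero_glue_le z.1 (0 : ball L0 → ℂ)
    rw [norm_zero, mul_zero, add_zero] at h4
    refine mul_le_mul ?_ h4 (nrm_nonneg _ _ _) (by norm_num)
    refine one_div_le_one_div_of_le (by norm_num) ?_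
    have : (0 : ℝ) ≤ (ball L0).card := Nat.cast_nonneg _
    linarith

/-- Solution of the equation on the smallest ball, with holomorphic dependence on the
parameters. -/
theorem exists_initial (hω : 0 < ω) (hdio : IsDiophantine ω) (L0 : ℝ) :
    ∃ d : ℝ, 0 < d ∧ ∃ R : ℝ, 0 < R ∧ ∃ c0 : ℂ × ℂ → ball L0 → ℂ, R * ((ball L0).card + 1) ≤ 1 / 16 ∧
      (∀ z : ℂ × ℂ, ‖z.1‖ ≤ R → ‖z.2 - Omega0 ω‖ ≤ d → ‖c0 z‖ ≤ ‖z.1‖ ∧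
        (∀ x ∈ ball L0, Fc ω (ballN L0) z.2 (glue L0 z.1 (c0 z)) x = 0) ∧
        ∀ c : ball L0 → ℂ, ‖c‖ ≤ R →
          (∀ x ∈ ball L0, Fc ω (ballN L0) z.2 (glue L0 z.1 c) x = 0) → c = c0 z) ∧
      (∀ z : ℂ × ℂ, ‖z.1‖ ≤ R → ‖z.2 - Omega0 ω‖ ≤ d → ∀ S : Set (ball L0 → ℂ), IsClosed S →
        0 ∈ S → (∀ c ∈ S, ‖c‖ ≤ R → c - Feq ω L0 z c ∈ S) → c0 z ∈ S) ∧
      ContDiffOn ℂ (⊤ : ℕ∞) c0 {z | ‖z.1‖ < R ∧ ‖z.2 - Omega0 ω‖ < d} := by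
  classical
  obtain ⟨d, hd, R, hR, hR16, hF⟩ := exists_Feq_contraction hω hdio L0
  have hiff : ∀ (z : ℂ × ℂ) (c : ball L0 → ℂ), Feq ω L0 z c = 0 ↔
      ∀ x ∈ ball L0, Fc ω (ballN L0) z.2 (glue L0 z.1 c) x = 0 := by
    intro z c
    rw [funext_iff, Subtype.forall]
    refine forall₂_congr fun x hx => ?_
    have hl : (lam ω x : ℂ) ≠ 0 := by exact_mod_cast lam_ne_zero hω hdio (mem_ball.1 hx).1
    simp [Feq, hl]
  -- The fixed point is sought in an arbitrary closed invariant set containing `0`. Taking the real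
  -- vectors for `S` later shows that the solution is real at real parameters.
  have hex : ∀ z : ℂ × ℂ, ‖z.1‖ ≤ R → ‖z.2 - Omega0 ω‖ ≤ d →
      ∀ S : Set (ball L0 → ℂ), IsClosed S → 0 ∈ S →
        (∀ c ∈ S, ‖c‖ ≤ R → c - Feq ω L0 z c ∈ S) →
      ∃ c : ball L0 → ℂ, c ∈ S ∧ ‖c‖ ≤ ‖z.1‖ ∧ Feq ω L0 z c = 0 := by
    intro z h1 h2 S hS hS0 hST
    obtain ⟨hc, h0⟩ := hF z h1 h2
    set T : (ball L0 → ℂ) → ball L0 → ℂ := fun c => c - Feq ω L0 z c with hT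
    have hT0 : ‖T 0‖ ≤ 1 / 2 * ‖z.1‖ := by simpa [hT] using h0
    have hTc : ∀ c, ‖c‖ ≤ R → ‖T c‖ ≤ 1 / 2 * ‖c‖ + 1 / 2 * ‖z.1‖ := by
      intro c hcR
      have h3 := hc 0 c (by simpa using hR.le) hcR
      rw [sub_zero] at h3
      have h4 : T c = (T c - T 0) + T 0 := by abel
      rw [h4]
      exact (norm_add_le _ _).trans (add_le_add h3 hT0)
    have hmaps : Set.MapsTo T (Metric.closedBall 0 R ∩ S) (Metric.closedBall 0 R ∩ S) := by
      rintro c ⟨hcR, hcS⟩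
      rw [mem_closedBall_zero_iff] at hcR
      refine ⟨?_, hST c hcS hcR⟩
      rw [mem_closedBall_zero_iff]
      linarith [hTc c hcR]
    have hcon : ContractingWith (1 / 2 : NNReal) (hmaps.restrict T _ _) := by
      refine ⟨by rw [← NNReal.coe_lt_coe]; norm_num, LipschitzWith.of_dist_le_mul fun a b => ?_⟩
      have h5 := hc b a (mem_closedBall_zero_iff.1 b.2.1) (mem_closedBall_zero_iff.1 a.2.1)
      rw [Subtype.dist_eq, Subtype.dist_eq, dist_eq_norm, dist_eq_norm]
      simpa using h5
    obtain ⟨c, ⟨hcR, hcS⟩, hfix, -⟩ := hcon.exists_fixedPoint'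
      (Metric.isClosed_closedBall.inter hS).isComplete hmaps
      ⟨Metric.mem_closedBall_self hR.le, hS0⟩ (edist_ne_top _ _)
    rw [mem_closedBall_zero_iff] at hcR
    refine ⟨c, hcS, ?_, ?_⟩
    · have h6 := hTc c hcR
      rw [hfix] at h6
      linarith
    · have h7 : c - Feq ω L0 z c = c := hfix
      exact sub_eq_self.1 h7
  have huniq : ∀ z : ℂ × ℂ, ‖z.1‖ ≤ R → ‖z.2 - Omega0 ω‖ ≤ d → ∀ c c' : ball L0 → ℂ,
      ‖c‖ ≤ R → ‖c'‖ ≤ R → Feq ω L0 z c = 0 → Feq ω L0 z c' = 0 → c' = c := by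
    intro z h1 h2 c c' hc hc' h3 h4
    have h5 := (hF z h1 h2).1 c c' hc hc'
    rw [h3, h4, sub_zero, sub_zero] at h5
    have h6 : ‖c' - c‖ ≤ 0 := by linarith [norm_nonneg (c' - c)]
    exact sub_eq_zero.1 (norm_le_zero_iff.1 h6)
  have hex' : ∀ z : ℂ × ℂ, ‖z.1‖ ≤ R → ‖z.2 - Omega0 ω‖ ≤ d →
      ∃ c : ball L0 → ℂ, ‖c‖ ≤ ‖z.1‖ ∧ Feq ω L0 z c = 0 := fun z h1 h2 =>
    let ⟨c, _, h⟩ := hex z h1 h2 Set.univ isClosed_univ trivial fun _ _ _ => trivial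
    ⟨c, h⟩
  choose! c0 hc0 using hex'
  refine ⟨d, hd, R, hR, c0, hR16, fun z h1 h2 => ⟨(hc0 z h1 h2).1,
    (hiff z _).1 (hc0 z h1 h2).2, fun c hc h3 => huniq z h1 h2 _ _
      ((hc0 z h1 h2).1.trans h1) hc (hc0 z h1 h2).2 ((hiff z c).2 h3)⟩,
    fun z h1 h2 S hS hS0 hST => ?_, ?_⟩
  · obtain ⟨c, hcS, g1, g2⟩ := hex z h1 h2 S hS hS0 hST
    rwa [huniq z h1 h2 _ _ (g1.trans h1) ((hc0 z h1 h2).1.trans h1) g2 (hc0 z h1 h2).2]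
  rintro z0 ⟨h1, h2⟩
  obtain ⟨hb, hz⟩ := hc0 z0 h1.le h2.le
  have hopen : IsOpen {q : (ℂ × ℂ) × (ball L0 → ℂ) | ‖q.1.1‖ < R ∧ ‖q.2‖ < R} :=
    (isOpen_lt continuous_fst.fst.norm continuous_const).inter
      (isOpen_lt continuous_snd.norm continuous_const)
  have hu : ContDiffAt ℂ (⊤ : ℕ∞) (fun q : (ℂ × ℂ) × (ball L0 → ℂ) => Feq ω L0 q.1 q.2)
      (z0, c0 z0) := (contDiffOn_Feq hω (hR16.trans (by norm_num))).contDiffAt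
    (hopen.mem_nhds ⟨h1, hb.trans_lt h1⟩)
  have pn : ((⊤ : ℕ∞) : WithTop ℕ∞) ≠ 0 := by simp
  set M := fderiv ℂ (fun q : (ℂ × ℂ) × (ball L0 → ℂ) => Feq ω L0 q.1 q.2) (z0, c0 z0) ∘L
    .inr ℂ (ℂ × ℂ) (ball L0 → ℂ) with hM
  have hMd : HasFDerivAt (fun c => c - Feq ω L0 z0 c)
      (ContinuousLinearMap.id ℂ (ball L0 → ℂ) - M) (c0 z0) := by
    refine (hasFDerivAt_id _).sub ?_
    exact (hu.differentiableAt pn).hasFDerivAt.comp (c0 z0) (hasFDerivAt_prodMk_right z0 (c0 z0))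
  -- The contraction bound passes to the derivative, so the partial derivative `M` in `c` is within
  -- `1/2` of the identity and therefore invertible; the implicit function theorem applies.
  have hlip : ‖ContinuousLinearMap.id ℂ (ball L0 → ℂ) - M‖ ≤ (1 / 2 : NNReal) := by
    refine hMd.le_of_lipschitzOn (s := Metric.ball 0 R)
      (Metric.isOpen_ball.mem_nhds (mem_ball_zero_iff.2 (hb.trans_lt h1))) ?_
    refine LipschitzOnWith.of_dist_le_mul fun a ha b hb => ?_
    have h5 := (hF z0 h1.le h2.le).1 b a (mem_ball_zero_iff.1 hb).le (mem_ball_zero_iff.1 ha).le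
    rw [dist_eq_norm, dist_eq_norm]
    simpa using h5
  have hinj : Function.Injective M := by
    rw [injective_iff_map_eq_zero]
    intro a ha
    have h5 := (ContinuousLinearMap.id ℂ (ball L0 → ℂ) - M).le_of_opNorm_le hlip a
    rw [sub_apply, ha, sub_zero, ContinuousLinearMap.id_apply] at h5
    norm_num at h5
    exact norm_le_zero_iff.1 (by linarith [norm_nonneg a])
  have hinv : M.IsInvertible :=
    ⟨(LinearEquiv.ofInjectiveEndo (M : (ball L0 → ℂ) →ₗ[ℂ] ball L0 → ℂ) hinj).toContinuousLinearEquiv,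
      by ext a : 1; rfl⟩
  have e1 := hu.eventually_apply_implicitFunction pn hinv
  have e2 := hu.contDiffAt_implicitFunction pn hinv
  have e3 := hu.implicitFunction_apply_self pn hinv
  have e4 : ∀ᶠ z in nhds z0, ‖hu.implicitFunction pn hinv z‖ < R := by
    refine e2.continuousAt.norm.eventually_lt continuousAt_const ?_
    rw [e3]
    exact hb.trans_lt h1
  have hopen' : IsOpen {z : ℂ × ℂ | ‖z.1‖ < R ∧ ‖z.2 - Omega0 ω‖ < d} :=
    (isOpen_lt continuous_fst.norm continuous_const).inter
      (isOpen_lt (continuous_snd.sub continuous_const).norm continuous_const)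
  -- Near `z0` the implicit function stays in the ball of uniqueness, so it coincides with `c0`.
  refine (e2.congr_of_eventuallyEq ?_).contDiffWithinAt
  filter_upwards [e1, e4, hopen'.mem_nhds ⟨h1, h2⟩] with z f1 f2 f3
  obtain ⟨g1, g2⟩ := hc0 z f3.1.le f3.2.le
  exact (huniq z f3.1.le f3.2.le _ _ (g1.trans f3.1.le) f2.le g2 (f1.trans hz)).symm

end VortexFilament

end

/-! ### Growth and decay rates along the scales. -/

noncomputable section

namespace VortexFilament

/-! ### The sequences of constants -/

/-- Exponential bounds for quantities that are polynomial in the scale. -/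
def kap (D : ℝ) (n : ℕ) : ℝ := Real.exp (D * (n + 1))

/-- The speed of convergence. -/
def tauS (a : ℝ) (n : ℕ) : ℝ := Real.exp (-(a * (4 / 3) ^ n))

/-- The sizes of the complex neighbourhoods. -/
def epsS (D : ℝ) (n : ℕ) : ℝ := Real.exp (-(D * (n + 1) ^ 2))

theorem one_le_kap {D : ℝ} (hD : 0 ≤ D) (n : ℕ) : 1 ≤ kap D n := Real.one_le_exp (by positivity)

theorem mul_pow_le_kap {A B D : ℝ} (hA : A ≤ Real.exp D) (hB0 : 0 ≤ B)
    (hB : B ≤ Real.exp D) (n : ℕ) : A * B ^ n ≤ kap D n := by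
  rw [kap, mul_add, mul_one, Real.exp_add, mul_comm D, Real.exp_nat_mul, mul_comm (_ ^ n)]
  exact mul_le_mul hA (pow_le_pow_left₀ hB0 hB n) (pow_nonneg hB0 n) (Real.exp_pos D).le

theorem scale_pos {L0 : ℝ} (hL0 : 0 < L0) (n : ℕ) : 0 < scale L0 n := by
  rw [scale]; positivity

theorem le_scale {L0 : ℝ} (hL0 : 0 < L0) (n : ℕ) : L0 ≤ scale L0 n := by
  rw [scale]
  exact le_mul_of_one_le_left hL0.le (one_le_pow₀ (by norm_num))

theorem add_scale_le {L0 A : ℝ} (hA : 0 ≤ A) (n : ℕ) : A + scale L0 n ≤ (A + L0) * 2 ^ n := by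
  rw [scale]
  have : (1 : ℝ) ≤ 2 ^ n := one_le_pow₀ (by norm_num)
  nlinarith

theorem card_ballN_le {R : ℝ} (hR : 0 ≤ R) : ((ballN R).card : ℝ) ≤ 2 * (1 + R) ^ 2 + 1 := by
  have h1 : (ball R).card ≤ ⌈R⌉₊ * (⌈R⌉₊ * 2) := by
    classical
    have h2 : (ball R).image (fun x : Site => (x.1 : ℕ × ℕ × ℤˣ))
        ⊆ Finset.range ⌈R⌉₊ ×ˢ Finset.range ⌈R⌉₊ ×ˢ (Finset.univ : Finset ℤˣ) := by
      intro q hq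
      obtain ⟨x, hx, rfl⟩ := Finset.mem_image.1 hq
      have h3 := (mem_ball.1 hx).2
      have h4 : (0 : ℝ) ≤ (x.j : ℝ) := Nat.cast_nonneg _
      have h5 : (0 : ℝ) ≤ (x.k : ℝ) := Nat.cast_nonneg _
      simp only [Finset.mem_product, Finset.mem_range, Finset.mem_univ, and_true]
      exact ⟨Nat.lt_ceil.2 (show (x.j : ℝ) < R by linarith),
        Nat.lt_ceil.2 (show (x.k : ℝ) < R by linarith)⟩
    have h3 := Finset.card_le_card h2
    rw [Finset.card_image_of_injective _ Subtype.val_injective, Finset.card_product,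
      Finset.card_product, Finset.card_range, Finset.card_univ, Fintype.card_units_int] at h3
    exact h3
  have h2 : ((ballN R).card : ℝ) ≤ (ball R).card + 1 := by
    exact_mod_cast Finset.card_insert_le siteN (ball R)
  have h3 : ((ball R).card : ℝ) ≤ ⌈R⌉₊ * (⌈R⌉₊ * 2) := by exact_mod_cast h1
  have h4 := (Nat.ceil_lt_add_one hR).le
  have h5 : (0 : ℝ) ≤ ⌈R⌉₊ := Nat.cast_nonneg _
  nlinarith

theorem index_le_of_mem_ballN {R : ℝ} (hR : 0 ≤ R) {y : Site} (hy : y ∈ ballN R) :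
    (y.j : ℝ) + y.k ≤ 2 + R := by
  rcases mem_ballN.1 hy with rfl | h
  · simp only [siteN, Site.j, Site.k]
    push_cast
    linarith
  · linarith [(mem_ball.1 h).2]

theorem bracket_le (j k : ℕ) : bracket j k ≤ 1 + j + k := by
  rw [bracket]
  refine Real.sqrt_le_iff.2 ⟨by positivity, ?_⟩
  have : (0 : ℝ) ≤ (j : ℝ) := Nat.cast_nonneg _
  have : (0 : ℝ) ≤ (k : ℝ) := Nat.cast_nonneg _
  nlinarith [mul_nonneg (Nat.cast_nonneg (α := ℝ) j) (Nat.cast_nonneg (α := ℝ) k)]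

theorem half_add_le_len (j k : ℕ) : ((j : ℝ) + k) / 2 ≤ len j k := by
  rw [len]
  refine Real.le_sqrt_of_sq_le ?_
  nlinarith [sq_nonneg ((j : ℝ) - k), sq_nonneg ((j : ℝ) + k)]

section Sigma

variable {σ0 : ℝ} {γ : ℕ → ℝ}

theorem sig_eq (n : ℕ) : sig σ0 γ n = σ0 - ∑ i ∈ Finset.range n, 2 * γ (i + 1) := by
  induction n with
  | zero => simp [sig]
  | succ n ih => rw [sig, ih, Finset.sum_range_succ]; ring

theorem half_le_sig (hγ : ∀ n, 1 ≤ n → 0 < γ n)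
    (hsum : HasSum (fun n : ℕ => 2 * γ (n + 1)) (σ0 / 2)) (n : ℕ) : σ0 / 2 ≤ sig σ0 γ n := by
  rw [sig_eq]
  have := sum_le_hasSum (Finset.range n) (fun i _ => by
    have := hγ (i + 1) (by omega)
    positivity) hsum
  linarith

theorem sig_anti (hγ : ∀ n, 1 ≤ n → 0 < γ n) (n : ℕ) : sig σ0 γ (n + 1) ≤ sig σ0 γ n := by
  rw [sig]
  linarith [hγ (n + 1) (by omega)]

end Sigma

/-- The lower bound for `γ_n` implied by the growth condition. -/
theorem exists_gamma_lower {L0 β ℓ M : ℝ} {γ : ℕ → ℝ} (hL0 : 0 < L0) (hβ : 0 < β)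
    (hγ : ∀ n, 1 ≤ n → 0 < γ n) (hℓ : 0 < ℓ)
    (hM : ∀ n, 1 ≤ n → (γ n ^ 2)⁻¹ * Real.exp (-(γ n * (ℓ * √(scale L0 n)))) / dseq L0 β n ≤ M) :
    ∃ c : ℝ, 0 < c ∧ ∀ n, 1 ≤ n → c ≤ γ n * √(scale L0 n) := by
  set q := L0 * L0 ^ β with hq
  have hq0 : 0 < q := mul_pos hL0 (Real.rpow_pos_of_pos hL0 β)
  -- With `y = γ_n √L_n` the growth condition reads `L_n^{1+β} ≤ M y² e^{ℓy}`, and the left side is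
  -- at least `q`. Hence `y` cannot be small.
  have key : ∀ n, 1 ≤ n →
      q ≤ M * ((γ n * √(scale L0 n)) ^ 2 * Real.exp (ℓ * (γ n * √(scale L0 n)))) := by
    intro n hn
    have hL := scale_pos hL0 n
    have hg := hγ n hn
    have h1 := hM n hn
    rw [dseq, Real.rpow_neg hL.le, div_inv_eq_mul, Real.exp_neg] at h1
    have h2 : γ n * (ℓ * √(scale L0 n)) = ℓ * (γ n * √(scale L0 n)) := by ring
    rw [h2] at h1
    have h3 : (γ n * √(scale L0 n)) ^ 2 = γ n ^ 2 * scale L0 n := by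
      rw [mul_pow, Real.sq_sqrt hL.le]
    set E := Real.exp (ℓ * (γ n * √(scale L0 n))) with hE
    have hE0 : 0 < E := Real.exp_pos _
    have h4 : q ≤ scale L0 n * scale L0 n ^ β :=
      mul_le_mul (le_scale hL0 n) (Real.rpow_le_rpow hL0.le (le_scale hL0 n) hβ.le)
        (Real.rpow_nonneg hL0.le _) hL.le
    calc q ≤ scale L0 n * scale L0 n ^ β := h4
      _ = ((γ n ^ 2)⁻¹ * E⁻¹ * scale L0 n ^ β) * (γ n ^ 2 * scale L0 n * E) := by
          field_simp
      _ ≤ M * (γ n ^ 2 * scale L0 n * E) := mul_le_mul_of_nonneg_right h1 (by positivity)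
      _ = _ := by rw [h3]
  have hM0 : 0 < M := by
    by_contra hneg
    push Not at hneg
    have h1 := key 1 le_rfl
    have h2 : 0 ≤ (γ 1 * √(scale L0 1)) ^ 2 * Real.exp (ℓ * (γ 1 * √(scale L0 1))) := by positivity
    have := mul_nonpos_of_nonpos_of_nonneg hneg h2
    linarith
  -- For `y ≤ 1` the exponential is at most `e^ℓ` and the inequality can be solved for `y`;
  -- otherwise `1` is a lower bound.
  refine ⟨min 1 √(q / (M * Real.exp ℓ)), by positivity, fun n hn => ?_⟩
  by_cases hy : γ n * √(scale L0 n) ≤ 1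
  · refine (min_le_right _ _).trans ?_
    have hy0 : 0 ≤ γ n * √(scale L0 n) := mul_nonneg (hγ n hn).le (Real.sqrt_nonneg _)
    refine Real.sqrt_le_iff.2 ⟨hy0, ?_⟩
    rw [div_le_iff₀ (by positivity)]
    refine (key n hn).trans ?_
    have h1 : Real.exp (ℓ * (γ n * √(scale L0 n))) ≤ Real.exp ℓ :=
      Real.exp_le_exp.2 (mul_le_of_le_one_right hℓ.le hy)
    calc _ ≤ M * ((γ n * √(scale L0 n)) ^ 2 * Real.exp ℓ) := by gcongr
      _ = _ := by ring
  · exact (min_le_left _ _).trans (not_le.1 hy).le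

/-- The constants of the iteration. -/
structure Scales (L0 s β C : ℝ) (γ σ : ℕ → ℝ) (D a : ℝ) : Prop where
  D_nonneg : 0 ≤ D
  a_pos : 0 < a
  card_le : ∀ n, ((ballN (scale L0 n)).card : ℝ) ≤ kap D n
  index_le : ∀ n, ∀ y ∈ ballN (scale L0 n), (y.j : ℝ) ≤ kap D n
  bracket_le : ∀ n, ∀ y ∈ ballN (scale L0 n), bracket y.j y.k ^ s ≤ kap D n
  tame_le : ∀ n, 1 ≤ n → C * ((γ n ^ 2)⁻¹ / dseq L0 β n) ≤ kap D n
  decay : ∀ n, ∀ x ∉ ball (scale L0 n), x ≠ siteN →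
    wS (σ (n + 1)) x ≤ wS (σ n) x * (tauS a (n + 1) * tauS (a / 2) (n + 1))

/-- The lower bound `γ_n √L_n ≥ c` acts twice: it makes the tame constant `C γ_n⁻² / d_n` at most
exponential in `n`, and it makes the gain from the loss of analyticity double exponential. -/
theorem exists_scales {L0 s σ0 β ℓ M C : ℝ} {γ : ℕ → ℝ} (hL0 : 0 < L0) (hs : 0 < s) (hβ : 0 < β)
    (hγ : ∀ n, 1 ≤ n → 0 < γ n) (hℓ : 0 < ℓ)
    (hM : ∀ n, 1 ≤ n → (γ n ^ 2)⁻¹ * Real.exp (-(γ n * (ℓ * √(scale L0 n)))) / dseq L0 β n ≤ M)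
    (hC : 0 < C) : ∃ D a, Scales L0 s β C γ (sig σ0 γ) D a := by
  obtain ⟨c, hc, hcγ⟩ := exists_gamma_lower hL0 hβ hγ hℓ hM
  set A1 := 2 * (1 + L0) ^ 2 + 1 with hA1
  set A2 := 2 + L0 with hA2
  set A3 := (3 + L0) ^ s with hA3
  set A4 := C * (c ^ 2)⁻¹ * (L0 * L0 ^ β) with hA4
  have p1 : 0 < A1 := by positivity
  have p2 : 0 < A2 := by positivity
  have p3 : 0 < A3 := by positivity
  have p4 : 0 < A4 := by positivity
  have q1 : (0 : ℝ) < 2 ^ s := by positivity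
  have q2 : (0 : ℝ) < 2 ^ β := by positivity
  -- Every quantity is at most some `A · B^n` with `A, B ≤ S`, hence at most `S^(n+1)`; so `D = log
  -- S`.
  set S := A1 + A2 + A3 + A4 + 2 ^ s + 2 * 2 ^ β + 4 with hS
  have hSpos : 0 < S := by positivity
  have hexp : Real.exp (Real.log S) = S := Real.exp_log hSpos
  refine ⟨Real.log S, 2 / 3 * (c * √L0 / 2), Real.log_nonneg (by linarith), by positivity,
    fun n => ?_, fun n y hy => ?_, fun n y hy => ?_, fun n hn => ?_, fun n x hx hxN => ?_⟩
  · have h1 := card_ballN_le (scale_pos hL0 n).le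
    have h2 := add_scale_le (L0 := L0) zero_le_one n
    have h3 : (0 : ℝ) ≤ 1 + scale L0 n := by linarith [scale_pos hL0 n]
    have h4 : (1 + scale L0 n) ^ 2 ≤ (1 + L0) ^ 2 * 4 ^ n := by
      refine (pow_le_pow_left₀ h3 h2 2).trans_eq ?_
      rw [mul_pow, ← pow_mul, mul_comm n 2, pow_mul]
      norm_num
    have h5 : (1 : ℝ) ≤ 4 ^ n := one_le_pow₀ (by norm_num)
    refine le_trans ?_ (mul_pow_le_kap (A := A1) (B := 4) (by rw [hexp]; linarith) (by norm_num)
      (by rw [hexp]; linarith) n)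
    rw [hA1, add_mul]
    linarith
  · have h1 := index_le_of_mem_ballN (scale_pos hL0 n).le hy
    have h2 : (0 : ℝ) ≤ y.k := Nat.cast_nonneg _
    refine le_trans ?_ (mul_pow_le_kap (A := A2) (B := 2) (by rw [hexp]; linarith) (by norm_num)
      (by rw [hexp]; linarith) n)
    linarith [add_scale_le (L0 := L0) zero_le_two n]
  · have h1 := index_le_of_mem_ballN (scale_pos hL0 n).le hy
    have h2 : bracket y.j y.k ≤ (3 + L0) * 2 ^ n := by
      linarith [VortexFilament.bracket_le y.j y.k, add_scale_le (L0 := L0) zero_le_three n]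
    refine (Real.rpow_le_rpow (Real.sqrt_nonneg _) h2 hs.le).trans ?_
    rw [Real.mul_rpow (by positivity) (by positivity), ← Real.rpow_natCast, ← Real.rpow_mul
      (by norm_num), mul_comm (n : ℝ), Real.rpow_mul (by norm_num), Real.rpow_natCast]
    exact mul_pow_le_kap (by rw [hexp]; linarith) q1.le (by rw [hexp]; linarith) n
  · have hL := scale_pos hL0 n
    have hg := hγ n hn
    have h1 : c ^ 2 ≤ γ n ^ 2 * scale L0 n := by
      have := pow_le_pow_left₀ hc.le (hcγ n hn) 2
      rwa [mul_pow, Real.sq_sqrt hL.le] at this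
    have h2 : (γ n ^ 2)⁻¹ ≤ (c ^ 2)⁻¹ * scale L0 n := by
      rw [inv_mul_eq_div, le_div_iff₀ (by positivity), inv_mul_le_iff₀ (by positivity)]
      exact h1
    have h3 : scale L0 n ^ β = L0 ^ β * (2 ^ β) ^ n := by
      rw [scale, Real.mul_rpow (by positivity) hL0.le, ← Real.rpow_natCast, ← Real.rpow_mul
        (by norm_num), mul_comm (n : ℝ), Real.rpow_mul (by norm_num), Real.rpow_natCast, mul_comm]
    rw [dseq, Real.rpow_neg hL.le, div_inv_eq_mul]
    calc _ ≤ C * ((c ^ 2)⁻¹ * scale L0 n * scale L0 n ^ β) := by gcongr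
      _ = A4 * (2 * 2 ^ β) ^ n := by
          rw [h3, hA4, mul_pow]
          simp only [scale]
          ring
      _ ≤ _ := mul_pow_le_kap (by rw [hexp]; linarith) (by positivity) (by rw [hexp]; linarith) n
  -- Off the ball `|x| ≥ (j+k)/2 ≥ L_{n+1}/4`, so `2γ_{n+1}|x|` is at least `(c/2)√L_{n+1}`, and
  -- `(4/3)² < 2`. The factor `2/3` in `a` leaves room for the exponents `a` and `a/2` together.
  · have hle : scale L0 n ≤ (x.j : ℝ) + x.k := by
      by_contra h
      exact hx (mem_ball.2 ⟨hxN, not_le.1 h⟩)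
    have h1 := half_add_le_len x.j x.k
    have h2 : scale L0 (n + 1) = 2 * scale L0 n := by rw [scale, scale, pow_succ]; ring
    have hL := scale_pos hL0 (n + 1)
    have hg := hcγ (n + 1) (by omega)
    have hg0 := hγ (n + 1) (by omega)
    have h3 : √(scale L0 (n + 1)) * √(scale L0 (n + 1)) = scale L0 (n + 1) :=
      Real.mul_self_sqrt hL.le
    have h4 : √L0 * (4 / 3) ^ (n + 1) ≤ √(scale L0 (n + 1)) := by
      refine Real.le_sqrt_of_sq_le ?_
      rw [mul_pow, Real.sq_sqrt hL0.le, scale, ← pow_mul, mul_comm (n + 1) 2, pow_mul, mul_comm]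
      refine mul_le_mul_of_nonneg_right (pow_le_pow_left₀ (by norm_num) (by norm_num) _) hL0.le
    have h5 : c * √L0 / 2 * (4 / 3) ^ (n + 1) ≤ 2 * γ (n + 1) * len x.j x.k := by
      calc _ = c / 2 * (√L0 * (4 / 3) ^ (n + 1)) := by ring
        _ ≤ γ (n + 1) * √(scale L0 (n + 1)) / 2 * √(scale L0 (n + 1)) := by gcongr
        _ = γ (n + 1) * (√(scale L0 (n + 1)) * √(scale L0 (n + 1))) / 2 := by ring
        _ = 2 * γ (n + 1) * (scale L0 (n + 1) / 4) := by rw [h3]; ring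
        _ ≤ _ := mul_le_mul_of_nonneg_left (by rw [h2]; linarith) (by positivity)
    rw [wS, wS, tauS, tauS, ← Real.exp_add, ← Real.exp_add, sig]
    refine Real.exp_le_exp.2 ?_
    linarith

theorem tauS_pos (a : ℝ) (n : ℕ) : 0 < tauS a n := Real.exp_pos _

/-- Since `2 · (3/4) = 1 + 1/2`, quadratic convergence leaves over exactly the surplus `tauS (a /
2)`, the choice made for `ζ`. -/
theorem tauS_sq (a : ℝ) (n : ℕ) : tauS a n ^ 2 = tauS a (n + 1) * tauS (a / 2) (n + 1) := by
  rw [tauS, tauS, tauS, ← Real.exp_nat_mul, ← Real.exp_add]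
  congr 1
  push_cast
  ring

theorem summable_tauS {a : ℝ} (ha : 0 < a) : Summable (tauS a) := by
  have := summable_exp_sq_sub_pow 0 ha
  simpa [funext_iff, show tauS a = fun n => tauS a n from rfl, tauS] using this

theorem exists_kap_sq_mul_tauS_le (D : ℝ) {a : ℝ} (ha : 0 < a) :
    ∃ Z : ℝ, 1 ≤ Z ∧ ∀ n, kap D n ^ 2 * tauS a n ≤ Z := by
  obtain ⟨Z, hZ, h⟩ := exists_exp_sub_pow_le (2 * D) ha
  refine ⟨Z, hZ, fun n => le_trans (le_of_eq ?_) (h n)⟩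
  rw [kap, tauS, ← Real.exp_nat_mul, ← Real.exp_add]
  congr 1
  push_cast
  ring

theorem epsS_anti {D : ℝ} (hD : 0 ≤ D) (n : ℕ) : epsS D (n + 1) ≤ epsS D n := by
  rw [epsS, epsS]
  refine Real.exp_le_exp.2 (neg_le_neg (mul_le_mul_of_nonneg_left ?_ hD))
  push_cast
  have : (0 : ℝ) ≤ n := Nat.cast_nonneg _
  nlinarith

theorem epsS_le {D : ℝ} (hD : 0 ≤ D) (n : ℕ) : epsS D n ≤ Real.exp (-D) := by
  rw [epsS]
  refine Real.exp_le_exp.2 (neg_le_neg (le_mul_of_one_le_right hD (one_le_pow₀ ?_)))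
  have : (0 : ℝ) ≤ n := Nat.cast_nonneg _
  linarith

/-- The exponents of consecutive `epsS` differ by `D1 (2n+3)`, linear in `n`, which absorbs the
exponential growth of `kap`. This is why the radii decay like a Gaussian. -/
theorem mul_kap_mul_epsS_le {A D D1 : ℝ} (hA : 0 < A) (hD : 0 ≤ D)
    (hD1 : |Real.log A| + 3 * D ≤ D1) (n : ℕ) :
    A * kap D (n + 1) ^ 3 * epsS D1 (n + 1) ≤ epsS D1 n := by
  rw [kap, epsS, epsS, ← Real.exp_nat_mul, ← Real.exp_log hA, ← Real.exp_add, ← Real.exp_add]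
  refine Real.exp_le_exp.2 ?_
  push_cast
  have h0 : (0 : ℝ) ≤ n := Nat.cast_nonneg _
  have h1 := le_abs_self (Real.log A)
  have h2 := abs_nonneg (Real.log A)
  have h3 := mul_le_mul_of_nonneg_right hD1 (show (0 : ℝ) ≤ 2 * n + 3 by linarith)
  nlinarith [mul_nonneg hD h0, mul_nonneg h2 h0]

end VortexFilament

end

/-! ### Weighted series and smooth extension from the parameter set. -/

noncomputable section

namespace VortexFilament

variable {ω : ℝ}

/-! ### Series of coefficients -/

/-- A series of families that converges absolutely in a weighted `ℓ¹` norm. -/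
theorem tail_bounds {g : ℕ → Site → ℝ} {q : Site → ℝ} (hq : ∀ x, 1 ≤ q x) {b : ℕ → ℝ}
    (hb : Summable b) (hg : ∀ n, Summable fun x => |g n x| * q x)
    (hgb : ∀ n, ∑' x, |g n x| * q x ≤ b n) :
    (∀ x, Summable fun n => g n x) ∧ ∀ n,
      (Summable fun x => |∑' m, g m x - ∑ m ∈ Finset.range n, g m x| * q x) ∧
      ∑' x, |∑' m, g m x - ∑ m ∈ Finset.range n, g m x| * q x ≤ ∑' m, b (m + n) := by
  have hq0 : ∀ x, 0 ≤ q x := fun x => zero_le_one.trans (hq x)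
  have hsx : ∀ x, Summable fun n => |g n x| := by
    intro x
    refine hb.of_nonneg_of_le (fun _ => abs_nonneg _) fun n => ?_
    have h1 := (hg n).le_tsum x fun y _ => mul_nonneg (abs_nonneg _) (hq0 y)
    exact (le_mul_of_one_le_right (abs_nonneg _) (hq x)).trans (h1.trans (hgb n))
  have hsum : ∀ x, Summable fun n => g n x := fun x => (hsx x).of_abs
  refine ⟨hsum, fun n => ?_⟩
  have hbn : Summable fun m => b (m + n) := (summable_nat_add_iff n).2 hb
  have hT : Summable fun m => ∑' x, |g (m + n) x| * q x :=
    hbn.of_nonneg_of_le (fun m => tsum_nonneg fun x => mul_nonneg (abs_nonneg _) (hq0 x))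
      fun m => hgb (m + n)
  have hF : Summable fun r : ℕ × Site => |g (r.1 + n) r.2| * q r.2 :=
    (summable_prod_of_nonneg fun r => mul_nonneg (abs_nonneg _) (hq0 _)).2
      ⟨fun m => hg (m + n), hT⟩
  have hF' : Summable fun r : Site × ℕ => |g (r.2 + n) r.1| * q r.1 := hF.prod_symm
  have hG : Summable fun x => ∑' m, |g (m + n) x| * q x := hF'.prod
  have hle : ∀ x, |∑' m, g m x - ∑ m ∈ Finset.range n, g m x| * q x
      ≤ ∑' m, |g (m + n) x| * q x := by
    intro x
    rw [← (hsum x).sum_add_tsum_nat_add n, add_sub_cancel_left, tsum_mul_right]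
    refine mul_le_mul_of_nonneg_right ?_ (hq0 x)
    have h1 : Summable fun m => ‖g (m + n) x‖ := (summable_nat_add_iff n).2 (hsx x)
    simpa only [Real.norm_eq_abs] using norm_tsum_le_tsum_norm h1
  have hS : Summable fun x => |∑' m, g m x - ∑ m ∈ Finset.range n, g m x| * q x :=
    hG.of_nonneg_of_le (fun x => mul_nonneg (abs_nonneg _) (hq0 x)) hle
  refine ⟨hS, (hS.tsum_le_tsum hle hG).trans ?_⟩
  have hcomm : ∑' x, ∑' m, |g (m + n) x| * q x = ∑' m, ∑' x, |g (m + n) x| * q x :=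
    Summable.tsum_comm (f := fun m x => |g (m + n) x| * q x) hF
  rw [hcomm]
  exact hT.tsum_le_tsum (fun m => hgb (m + n)) hbn

theorem one_le_wt {s σ : ℝ} (hs : 0 ≤ s) (hσ : 0 ≤ σ) (x : Site) : 1 ≤ wt s σ x.j x.k :=
  (one_le_wS hσ x).trans (wS_le_wt hs σ _ _)

/-- Exponential weights dominate polynomial ones. -/
theorem exists_size_sq_le_wt {s σ : ℝ} (hs : 0 ≤ s) (hσ : 0 < σ) :
    ∃ C : ℝ, 0 < C ∧ ∀ x : Site, (1 + (x.j : ℝ) + x.k) ^ 2 ≤ C * wt s σ x.j x.k := by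
  refine ⟨2 * (1 + 8 / σ ^ 2), by positivity, fun x => ?_⟩
  have h0 : (0 : ℝ) ≤ (x.j : ℝ) + x.k := by positivity
  have h1 := half_add_le_len x.j x.k
  have h2 : Real.exp (σ * (((x.j : ℝ) + x.k) / 2)) ≤ wt s σ x.j x.k :=
    (Real.exp_le_exp.2 (mul_le_mul_of_nonneg_left h1 hσ.le)).trans (wS_le_wt hs σ _ _)
  set m := (x.j : ℝ) + x.k with hm
  have h3 := Real.quadratic_le_exp_of_nonneg (show 0 ≤ σ * (m / 2) by positivity)
  have h4 : 1 ≤ wt s σ x.j x.k := one_le_wt hs hσ.le x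
  have h5 : m ^ 2 ≤ 8 / σ ^ 2 * wt s σ x.j x.k := by
    rw [div_mul_eq_mul_div, le_div_iff₀ (by positivity)]
    have : 0 ≤ σ * (m / 2) := by positivity
    nlinarith
  have h6 : (1 + (x.j : ℝ) + x.k) ^ 2 = (1 + m) ^ 2 := by rw [hm]; ring
  rw [h6]
  nlinarith [sq_nonneg (1 - m)]

theorem decay_of_summable_wt {s σ : ℝ} (hs : 0 ≤ s) (hσ : 0 < σ) {c : Site → ℝ}
    (hc : Summable fun x => |c x| * wt s σ x.j x.k) : Decay c := by
  obtain ⟨C, hC, h⟩ := exists_size_sq_le_wt hs hσ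
  refine (hc.mul_right C).of_nonneg_of_le (fun x => by positivity) fun x => ?_
  rw [mul_assoc]
  refine mul_le_mul_of_nonneg_left ?_ (abs_nonneg _)
  rw [mul_comm]
  exact h x

theorem sq_summable_of_summable {a : Site → ℝ} (ha : ∀ x, 0 ≤ a x) (h : Summable a) :
    (Summable fun x => a x ^ 2) ∧ ∑' x, a x ^ 2 ≤ (∑' x, a x) ^ 2 := by
  have hle : ∀ x, a x ^ 2 ≤ (∑' y, a y) * a x := fun x => by
    rw [sq]
    exact mul_le_mul_of_nonneg_right (h.le_tsum x fun y _ => ha y) (ha x)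
  have hs : Summable fun x => a x ^ 2 :=
    (h.mul_left _).of_nonneg_of_le (fun x => sq_nonneg _) hle
  refine ⟨hs, (hs.tsum_le_tsum hle (h.mul_left _)).trans_eq ?_⟩
  rw [tsum_mul_left, sq]

theorem wt_nonneg (s σ a b : ℝ) : 0 ≤ wt s σ a b :=
  mul_nonneg (Real.exp_pos _).le (Real.rpow_nonneg (Real.sqrt_nonneg _) _)

theorem summable_abs_of_summable_wt {s σ : ℝ} (hs : 0 ≤ s) (hσ : 0 ≤ σ) {c : Site → ℝ}
    (hc : Summable fun x => |c x| * wt s σ x.j x.k) : Summable fun x => |c x| :=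
  hc.of_nonneg_of_le (fun _ => abs_nonneg _) fun x =>
    le_mul_of_one_le_right (abs_nonneg _) (one_le_wt hs hσ x)

theorem memH_synth (hω : 0 < ω) {s σ : ℝ} (hs : 0 ≤ s) (hσ : 0 ≤ σ) {c : Site → ℝ}
    (hc : Summable fun x => |c x| * wt s σ x.j x.k) : MemH ω s σ (synth ω c) := by
  have h1 := summable_abs_of_summable_wt hs hσ hc
  refine ⟨isSym_synth hω h1, ?_⟩
  refine ((sq_summable_of_summable (fun x => mul_nonneg (abs_nonneg _) (wt_nonneg _ _ _ _))
    hc).1).congr fun x => ?_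
  rw [coef_synth hω h1, mul_pow, sq_abs]

theorem normH_synth_le (hω : 0 < ω) {s σ : ℝ} (hs : 0 ≤ s) (hσ : 0 ≤ σ) {c : Site → ℝ}
    (hc : Summable fun x => |c x| * wt s σ x.j x.k) :
    normH ω s σ (synth ω c) ≤ ∑' x, |c x| * wt s σ x.j x.k := by
  have h1 := summable_abs_of_summable_wt hs hσ hc
  have h2 := (sq_summable_of_summable (fun x => mul_nonneg (abs_nonneg _) (wt_nonneg _ _ _ _))
    hc).2
  rw [normH]
  refine Real.sqrt_le_iff.2
    ⟨tsum_nonneg fun x => mul_nonneg (abs_nonneg _) (wt_nonneg _ _ _ _), le_trans (le_of_eq ?_) h2⟩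
  refine tsum_congr fun x => ?_
  rw [coef_synth hω h1, mul_pow, sq_abs]

theorem abs_le_normH_synth (hω : 0 < ω) {s σ : ℝ} (hs : 0 ≤ s) (hσ : 0 ≤ σ) {c : Site → ℝ}
    (hc : Summable fun x => |c x| * wt s σ x.j x.k) (x : Site) :
    |c x| ≤ normH ω s σ (synth ω c) := by
  have h1 := summable_abs_of_summable_wt hs hσ hc
  have h2 := (memH_synth hω hs hσ hc).2
  rw [normH]
  refine Real.le_sqrt_of_sq_le ?_
  have h3 := h2.le_tsum x fun y _ => mul_nonneg (sq_nonneg _) (sq_nonneg _)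
  refine le_trans ?_ h3
  rw [coef_synth hω h1, sq_abs]
  exact le_mul_of_one_le_right (sq_nonneg _) (one_le_pow₀ (one_le_wt hs hσ x))

theorem summable_of_support {c : Site → ℝ} {B : Finset Site} (h : ∀ x ∉ B, c x = 0)
    (q : Site → ℝ) : Summable fun x => |c x| * q x :=
  summable_of_ne_finset_zero (s := B) fun x hx => by rw [h x hx, abs_zero, zero_mul]

/-! ### Smooth families of coefficients -/

theorem iteratedFDeriv_sum_smul_le {ι : Type*} (B : Finset ι) {g : ι → ℝ × ℝ → ℝ}
    {F : Type*} [NormedAddCommGroup F] [NormedSpace ℝ F] (b : ι → F)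
    (hb : ∀ i, ‖b i‖ ≤ 1) (hg : ∀ i ∈ B, ContDiff ℝ (⊤ : ℕ∞) (g i)) (k : ℕ) (p : ℝ × ℝ) :
    ‖iteratedFDeriv ℝ k (fun p => ∑ i ∈ B, g i p • b i) p‖
      ≤ ∑ i ∈ B, ‖iteratedFDeriv ℝ k (g i) p‖ := by
  have h1 : ∀ i ∈ B, ContDiff ℝ k (fun p => g i p • b i) := fun i hi =>
    ((hg i hi).of_le (by exact_mod_cast le_top)).smul contDiff_const
  rw [iteratedFDeriv_fun_sum_apply fun i hi => (h1 i hi).contDiffAt]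
  refine (norm_sum_le _ _).trans (Finset.sum_le_sum fun i hi => ?_)
  have h2 : (fun p => g i p • b i)
      = (ContinuousLinearMap.smulRight (1 : ℝ →L[ℝ] ℝ) (b i)) ∘ g i := by
    funext p
    simp
  have h3 := (ContinuousLinearMap.smulRight (1 : ℝ →L[ℝ] ℝ) (b i)).norm_iteratedFDeriv_comp_left
    (((hg i hi).of_le (by exact_mod_cast le_top : (k : WithTop ℕ∞) ≤ (⊤ : ℕ∞))).contDiffAt (x := p))
    le_rfl
  rw [h2]
  refine h3.trans (mul_le_of_le_one_left (norm_nonneg _) ?_)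
  refine (ContinuousLinearMap.norm_smulRight_apply _ _).trans_le ?_
  rw [show ‖(1 : ℝ →L[ℝ] ℝ)‖ = 1 from norm_one, one_mul]
  exact hb i

/-- Whitney smoothness of a series of holomorphic families on shrinking neighbourhoods. -/
theorem exists_smooth_extension {K : Set (ℝ × ℝ)} {B : ℕ → Finset Site} {D1 D a A : ℝ}
    (ha : 0 < a) (hA : 0 ≤ A) {q : Site → ℝ} (hq : ∀ x, 0 < q x)
    {h : ℕ → ℂ × ℂ → Site → ℂ}
    (hsupp : ∀ n z, ∀ x ∉ B n, h n z x = 0) (hcard : ∀ n, ((B n).card : ℝ) ≤ kap D n)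
    (hsm : ∀ n x, ContDiffOn ℂ (⊤ : ℕ∞) (fun z => h n z x) (nbhd K (epsS D1) n))
    (hbd : ∀ n x, ∀ z ∈ nbhd K (epsS D1) n, ‖h n z x‖ * q x ≤ A * kap D n * tauS a n) :
    ∃ W : ℝ × ℝ → lp (fun _ : Site => ℝ) 2, ContDiff ℝ (⊤ : ℕ∞) W ∧
      ∀ p ∈ K, ∀ x, W p x = (∑' n, (h n (incl p) x).re) * q x := by
  obtain ⟨Ck, hC0, hC⟩ := exists_cutoff_smooth
  have hε : ∀ n, 0 < epsS D1 n := fun n => Real.exp_pos _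
  choose χ hχ1 hχ using fun n => hC K (epsS D1 n) (hε n)
  set G : ℕ → ℝ × ℝ → lp (fun _ : Site => ℝ) 2 := fun n p =>
    ∑ x ∈ B n, (χ n p * (h n (incl p) x * (q x : ℂ)).re) • lp.single 2 x (1 : ℝ) with hG
  have key : ∀ n x, ContDiff ℝ (⊤ : ℕ∞) (fun p => χ n p * (h n (incl p) x * (q x : ℂ)).re) ∧
      ∀ k p, ‖iteratedFDeriv ℝ k (fun p => χ n p * (h n (incl p) x * (q x : ℂ)).re) p‖
        ≤ Ck k * (A * kap D n * tauS a n) / epsS D1 n ^ k := fun n x => by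
    refine hχ n (fun z => h n z x * (q x : ℂ)) _ ((hsm n x).mul contDiffOn_const)
      (fun z hz => ?_) (mul_nonneg (mul_nonneg hA (Real.exp_pos _).le) (Real.exp_pos _).le)
    rw [norm_mul, Complex.norm_real, Real.norm_of_nonneg (hq x).le]
    exact hbd n x z hz
  -- Majorant for the `k`-th derivative of the `n`-th term: two factors `kap`, from the number of
  -- sites and the coefficient bound, the Cauchy loss `epsS ^ (-k)`, and the decay `tauS`.
  set vb : ℕ → ℕ → ℝ := fun k n =>
    Ck k * A * Real.exp ((2 * |D| + k * |D1|) * (n + 1) ^ 2 - a * (4 / 3) ^ n) with hvb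
  have hGc : ∀ n, ContDiff ℝ (⊤ : ℕ∞) (G n) := fun n =>
    ContDiff.sum fun x _ => (key n x).1.smul contDiff_const
  have hGb : ∀ (k : ℕ) (n : ℕ) (p : ℝ × ℝ), (k : ℕ∞) ≤ ⊤ →
      ‖iteratedFDeriv ℝ k (G n) p‖ ≤ vb k n := by
    intro k n p _
    have h1 := iteratedFDeriv_sum_smul_le (B n)
      (g := fun x p => χ n p * (h n (incl p) x * (q x : ℂ)).re)
      (fun x => (lp.single 2 x (1 : ℝ) : lp (fun _ : Site => ℝ) 2))
      (fun x => by rw [lp.norm_single (by norm_num)]; simp) (fun x _ => (key n x).1) k p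
    refine h1.trans ((Finset.sum_le_card_nsmul _ _ _ fun x _ => (key n x).2 k p).trans ?_)
    rw [nsmul_eq_mul]
    have hX : 0 ≤ Ck k * (A * kap D n * tauS a n) / epsS D1 n ^ k :=
      div_nonneg (mul_nonneg (hC0 k) (mul_nonneg (mul_nonneg hA (Real.exp_pos _).le)
        (Real.exp_pos _).le)) (pow_nonneg (hε n).le k)
    refine (mul_le_mul_of_nonneg_right (hcard n) hX).trans ?_
    have h2 : kap D n * (Ck k * (A * kap D n * tauS a n) / epsS D1 n ^ k)
        = Ck k * A * Real.exp (2 * D * (n + 1) + k * D1 * (n + 1) ^ 2 - a * (4 / 3) ^ n) := by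
      rw [kap, tauS, epsS, ← Real.exp_nat_mul, div_eq_mul_inv, ← Real.exp_neg]
      have : Real.exp (2 * D * (n + 1) + k * D1 * (n + 1) ^ 2 - a * (4 / 3) ^ n)
          = Real.exp (D * (n + 1)) * Real.exp (D * (n + 1)) * Real.exp (-(a * (4 / 3) ^ n))
            * Real.exp (-(k * -(D1 * (n + 1) ^ 2))) := by
        rw [← Real.exp_add, ← Real.exp_add, ← Real.exp_add]
        congr 1
        ring
      rw [this]
      ring
    rw [h2]
    refine mul_le_mul_of_nonneg_left (Real.exp_le_exp.2 ?_) (mul_nonneg (hC0 k) hA)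
    have hn : (1 : ℝ) ≤ n + 1 := by linarith [(Nat.cast_nonneg n : (0 : ℝ) ≤ n)]
    have h3 : D * ((n : ℝ) + 1) ≤ |D| * ((n : ℝ) + 1) ^ 2 := by
      refine mul_le_mul (le_abs_self D) ?_ (by linarith) (abs_nonneg _)
      nlinarith
    have h4 : k * D1 * ((n : ℝ) + 1) ^ 2 ≤ k * |D1| * ((n : ℝ) + 1) ^ 2 :=
      mul_le_mul_of_nonneg_right (mul_le_mul_of_nonneg_left (le_abs_self D1) (Nat.cast_nonneg k))
        (sq_nonneg _)
    linarith
  have hvs : ∀ k : ℕ, (k : ℕ∞) ≤ ⊤ → Summable (vb k) := fun k _ =>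
    (summable_exp_sq_sub_pow (2 * |D| + k * |D1|) ha).mul_left (Ck k * A)
  refine ⟨fun p => ∑' n, G n p, contDiff_tsum hGc hvs hGb, fun p hp x => ?_⟩
  have hGs : Summable fun n => G n p := by
    refine Summable.of_norm_bounded (hvs 0 le_top) fun n => ?_
    have := hGb 0 n p le_top
    rwa [norm_iteratedFDeriv_zero] at this
  have h1 := (lp.evalCLM ℝ (fun _ : Site => ℝ) 2 x).map_tsum hGs
  change (∑' n, G n p : lp (fun _ : Site => ℝ) 2) x = ∑' n, (G n p) x at h1
  rw [h1, ← tsum_mul_right]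
  refine tsum_congr fun n => ?_
  rw [hG]
  simp only [lp.coeFn_sum, Finset.sum_apply, lp.coeFn_smul, Pi.smul_apply, lp.single_apply,
    smul_eq_mul]
  rw [hχ1 n p hp]
  by_cases hx : x ∈ B n
  · rw [Finset.sum_eq_single_of_mem x hx fun y _ hy => by rw [Pi.single_eq_of_ne (Ne.symm hy), mul_zero]]
    simp
  · rw [hsupp n _ x hx, Finset.sum_eq_zero fun y hy => by
      rw [Pi.single_eq_of_ne (fun hxy : x = y => hx (hxy ▸ hy)), mul_zero]]
    simp

end VortexFilament

end

/-! ### Real parameters: the iterates and the initial approximation. -/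

noncomputable section

namespace VortexFilament

variable {ω : ℝ}

/-! ### Real parameters -/

/-- Real parts of complex coefficients. -/
def reS (c : Site → ℂ) : Site → ℝ := fun x => (c x).re

theorem ofReal_reS {c : Site → ℂ} (h : ∀ x, (c x).im = 0) : (fun x => (reS c x : ℂ)) = c :=
  funext fun x => Complex.ext (Complex.ofReal_re _) (by rw [Complex.ofReal_im, h])

theorem reS_support {B : Finset Site} {c : Site → ℂ} (h : ∀ x ∉ B, c x = 0) :
    ∀ x ∉ B, reS c x = 0 := fun x hx => by rw [reS, h x hx, Complex.zero_re]

theorem synth_single (r : ℝ) : synth ω (Pi.single siteN r) = v ω r := by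
  funext t θ
  rw [synth_eq_sum (B := {siteN}) fun x hx => Pi.single_eq_of_ne (by simpa using hx) _,
    Finset.sum_singleton, Pi.single_eq_same, v]

theorem summable_abs_of_support {c : Site → ℝ} {B : Finset Site} (h : ∀ x ∉ B, c x = 0) :
    Summable fun x => |c x| := (decay_of_support h).summable

theorem summable_abs_single (r : ℝ) : Summable fun x => |(Pi.single siteN r : Site → ℝ) x| :=
  summable_abs_of_support (B := {siteN}) fun x hx => Pi.single_eq_of_ne (by simpa using hx) _

theorem v_add_synth (hω : 0 < ω) {c : Site → ℝ} (hc : Summable fun x => |c x|) (r : ℝ) :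
    v ω r + synth ω c = synth ω (Pi.single siteN r + c) := by
  rw [synth_add hω (summable_abs_single r) hc, synth_single]

/-- The real matrix underlying the complex Jacobian. -/
theorem jacN_eq_map (hω : 0 < ω) {R Ω : ℝ} {c : Site → ℂ} (hre : ∀ x, (c x).im = 0)
    (hc : ∀ x ∉ ballN R, c x = 0) (hs : nrm 0 (ballN R) c ≤ 1 / 8) :
    jacN ω R Ω c = (jac ω Ω (synth ω (reS c)) (ball R)).map (Complex.ofRealHom : ℝ →+* ℂ) := by
  ext x y
  have h := jac_eq_Jc hω Ω (reS_support hc) (by rwa [ofReal_reS hre]) x y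
  rw [ofReal_reS hre] at h
  rw [Matrix.map_apply]
  exact h.symm

theorem Fc_eq_coef (hω : 0 < ω) {R Ω : ℝ} {c : Site → ℂ} (hre : ∀ x, (c x).im = 0)
    (hc : ∀ x ∉ ballN R, c x = 0) (hs : nrm 0 (ballN R) c ≤ 1 / 8) (x : Site) :
    Fc ω (ballN R) Ω c x = coef ω (f ω Ω (synth ω (reS c))) x := by
  have h := coef_f_eq_Fc hω Ω (reS_support hc) (by rwa [ofReal_reS hre]) x
  rw [ofReal_reS hre] at h
  exact h.symm

/-- By induction the complex step at a real parameter is the real Newton step, since Jacobian and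
residual agree while the iterate is small. Only smallness strictly before `n` is assumed, so the
statement can be used inside the induction that proves smallness. -/
theorem iter_eq_synth (hω : 0 < ω) {L0 : ℝ} (hL0 : 0 < L0) {u0 : ℂ × ℂ → Site → ℂ} {p : ℝ × ℝ}
    {w0 : ℝ × ℝ → Fn} (hsupp : ∀ x ∉ ballN L0, u0 (incl p) x = 0)
    (hre : ∀ x, (u0 (incl p) x).im = 0) (hw : v ω p.1 + w0 p = synth ω (reS (u0 (incl p)))) (n : ℕ)
    (h : ∀ m < n, nrm 0 (ballN (scale L0 m)) (uC ω L0 u0 m (incl p)) ≤ 1 / 8) :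
    (∀ x, (uC ω L0 u0 n (incl p) x).im = 0) ∧
      v ω p.1 + iter ω L0 w0 n p = synth ω (reS (uC ω L0 u0 n (incl p))) := by
  induction n with
  | zero => exact ⟨hre, hw⟩
  | succ n ih =>
    obtain ⟨ih1, ih2⟩ := ih fun m hm => h m (hm.trans n.lt_succ_self)
    have hz := uC_eq_zero (ω := ω) hL0 hsupp n
    have hz' : ∀ x ∉ ballN (scale L0 (n + 1)), uC ω L0 u0 n (incl p) x = 0 := fun x hx =>
      hz x fun hx' => hx (ballN_mono (scale_le_succ hL0 n) hx')
    have hs : nrm 0 (ballN (scale L0 (n + 1))) (uC ω L0 u0 n (incl p)) ≤ 1 / 8 := by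
      rw [nrm_succ_eq hL0 0 n hz]
      exact h n n.lt_succ_self
    set c := uC ω L0 u0 n (incl p) with hc
    set A := jac ω p.2 (synth ω (reS c)) (ball (scale L0 (n + 1))) with hA
    set F : ball (scale L0 (n + 1)) → ℝ := fun y =>
      coef ω (f ω p.2 (synth ω (reS c))) y with hF
    have hstep : ∀ x : ball (scale L0 (n + 1)),
        stepC ω (scale L0 (n + 1)) (p.2 : ℂ) c x = ((-(A⁻¹ *ᵥ F) x : ℝ) : ℂ) := by
      intro x
      rw [stepC_of_mem]
      have h1 : (fun y : ball (scale L0 (n + 1)) =>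
          Fc ω (ballN (scale L0 (n + 1))) (p.2 : ℂ) c y) = Complex.ofRealHom ∘ F :=
        funext fun y => Fc_eq_coef hω ih1 hz' hs y
      have h2 := jacN_eq_map hω (Ω := p.2) ih1 hz' hs
      change -((jacN ω (scale L0 (n + 1)) (p.2 : ℂ) c)⁻¹ *ᵥ _) x = _
      rw [h1, h2, map_ofReal_inv, ← RingHom.map_mulVec, Complex.ofReal_neg]
      rfl
    have him : ∀ x, (stepC ω (scale L0 (n + 1)) (p.2 : ℂ) c x).im = 0 := by
      intro x
      by_cases hx : x ∈ ball (scale L0 (n + 1))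
      · rw [hstep ⟨x, hx⟩, Complex.ofReal_im]
      · rw [stepC_of_notMem _ _ hx, Complex.zero_im]
    have hsum : reS (uC ω L0 u0 (n + 1) (incl p))
        = reS c + reS (stepC ω (scale L0 (n + 1)) (p.2 : ℂ) c) :=
      funext fun x => Complex.add_re _ _
    refine ⟨fun x => ?_, ?_⟩
    · rw [uC_succ_apply, Complex.add_im, ih1, zero_add]
      exact him x
    · have hsS : ∀ x ∉ ball (scale L0 (n + 1)),
          reS (stepC ω (scale L0 (n + 1)) (p.2 : ℂ) c) x = 0 :=
        reS_support fun x hx => stepC_of_notMem _ _ hx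
      rw [hsum, synth_add hω (summable_abs_of_support (reS_support hz))
        (summable_abs_of_support hsS), ← ih2]
      have hnew : ∀ t θ, synth ω (reS (stepC ω (scale L0 (n + 1)) (p.2 : ℂ) c)) t θ
          = -∑ x : ball (scale L0 (n + 1)), (((A⁻¹ *ᵥ F) x : ℝ) : ℂ) * e0 ω x t θ := by
        intro t θ
        rw [synth_eq_sum hsS, ← Finset.sum_coe_sort, ← Finset.sum_neg_distrib]
        refine Finset.sum_congr rfl fun x _ => ?_
        rw [reS, hstep x, Complex.ofReal_re, Complex.ofReal_neg, neg_mul]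
      funext t θ
      have hit : iter ω L0 w0 (n + 1) p t θ = iter ω L0 w0 n p t θ
          - ∑ x : ball (scale L0 (n + 1)), ((((jac ω p.2 (v ω p.1 + iter ω L0 w0 n p)
            (ball (scale L0 (n + 1))))⁻¹ *ᵥ fun y : ball (scale L0 (n + 1)) =>
              coef ω (f ω p.2 (v ω p.1 + iter ω L0 w0 n p)) y) x : ℝ) : ℂ) * e0 ω x t θ := rfl
      rw [ih2] at hit
      rw [Pi.add_apply, Pi.add_apply, hit, Pi.add_apply, Pi.add_apply, hnew, ← sub_eq_add_neg,
        ← add_sub_assoc, Pi.add_apply, Pi.add_apply]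

/-! ### The initial approximation -/

theorem proj_eq_synth (A : Finset Site) (u : Fn) [DecidablePred (· ∈ A)] :
    proj ω A u = synth ω fun x => if x ∈ A then coef ω u x else 0 := by
  funext t θ
  rw [synth_eq_sum (B := A) fun x hx => if_neg hx, proj]
  exact Finset.sum_congr rfl fun x hx => by rw [if_pos hx]

theorem coef_zero (x : Site) : coef ω 0 x = 0 := by
  simp [coef, ip]

theorem proj_eq_zero_iff (hω : 0 < ω) (A : Finset Site) (u : Fn) :
    proj ω A u = 0 ↔ ∀ x ∈ A, coef ω u x = 0 := by
  classical
  have hs : ∀ x ∉ A, (fun x => if x ∈ A then coef ω u x else 0) x = 0 := fun x hx => if_neg hx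
  constructor
  · intro h x hx
    rw [proj_eq_synth] at h
    have h1 := coef_synth hω (summable_abs_of_support hs) x
    rw [h, coef_zero] at h1
    simpa [hx] using h1.symm
  · intro h
    funext t θ
    exact Finset.sum_eq_zero fun x hx => by rw [h x hx, Complex.ofReal_zero, zero_mul]

theorem proj_synth (hω : 0 < ω) {A : Finset Site} {c : Site → ℝ} (hc : ∀ x ∉ A, c x = 0) :
    proj ω A (synth ω c) = synth ω c := by
  classical
  rw [proj_eq_synth]
  congr 1
  funext x
  rw [coef_synth hω (summable_abs_of_support hc)]
  split_ifs with hx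
  · rfl
  · exact (hc x hx).symm

theorem glue_im {R r : ℝ} {c : ball R → ℂ} (h : ∀ x, (c x).im = 0) (x : Site) :
    (glue R r c x).im = 0 := by
  rw [glue]
  split_ifs
  · exact h _
  · exact Complex.ofReal_im r
  · exact Complex.zero_im

theorem reS_glue {R r : ℝ} (c : ball R → ℂ) :
    Pi.single siteN r + reS (glue R 0 c) = reS (glue R r c) := by
  funext x
  by_cases hx : x = siteN
  · subst hx
    simp [reS, glue_siteN]
  · rw [Pi.add_apply, Pi.single_eq_of_ne hx, zero_add, reS, reS, glue, glue, if_neg hx, if_neg hx]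

theorem glue_zero_support {R : ℝ} (c : ball R → ℂ) : ∀ x ∉ ball R, glue R 0 c x = 0 := by
  intro x hx
  rw [glue, dif_neg hx]
  split_ifs <;> rfl

/-- The properties of the solution on the smallest ball. -/
structure InitialData (ω L0 d R : ℝ) (c0 : ℂ × ℂ → ball L0 → ℂ) : Prop where
  hω : 0 < ω
  d_pos : 0 < d
  R_pos : 0 < R
  R_le : R * ((ball L0).card + 1) ≤ 1 / 16
  bound : ∀ z : ℂ × ℂ, ‖z.1‖ ≤ R → ‖z.2 - Omega0 ω‖ ≤ d → ‖c0 z‖ ≤ ‖z.1‖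
  eqn : ∀ z : ℂ × ℂ, ‖z.1‖ ≤ R → ‖z.2 - Omega0 ω‖ ≤ d →
    ∀ x ∈ ball L0, Fc ω (ballN L0) z.2 (glue L0 z.1 (c0 z)) x = 0
  unique : ∀ z : ℂ × ℂ, ‖z.1‖ ≤ R → ‖z.2 - Omega0 ω‖ ≤ d → ∀ c : ball L0 → ℂ, ‖c‖ ≤ R →
    (∀ x ∈ ball L0, Fc ω (ballN L0) z.2 (glue L0 z.1 c) x = 0) → c = c0 z
  real : ∀ p : ℝ × ℝ, |p.1| ≤ R → |p.2 - Omega0 ω| ≤ d → ∀ x, (c0 (incl p) x).im = 0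
  smooth : ContDiffOn ℂ (⊤ : ℕ∞) c0 {z | ‖z.1‖ < R ∧ ‖z.2 - Omega0 ω‖ < d}

theorem nrm_glue_le_eighth {L0 R : ℝ} (hR : R * ((ball L0).card + 1) ≤ 1 / 16) {r : ℂ}
    {c : ball L0 → ℂ} (hr : ‖r‖ ≤ R) (hc : ‖c‖ ≤ R) :
    nrm 0 (ballN L0) (glue L0 r c) ≤ 1 / 8 := by
  refine (nrm_zero_glue_le _ _).trans ?_
  have h2 := mul_le_mul_of_nonneg_left hc (Nat.cast_nonneg (α := ℝ) (ball L0).card)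
  linarith

theorem norm_incl_sub (p : ℝ × ℝ) (a : ℝ) : ‖(incl p).2 - (a : ℂ)‖ = |p.2 - a| := by
  rw [incl_apply, ← Complex.ofReal_sub, Complex.norm_real, Real.norm_eq_abs]

theorem norm_incl_fst (p : ℝ × ℝ) : ‖(incl p).1‖ = |p.1| := by
  rw [incl_apply, Complex.norm_real, Real.norm_eq_abs]

/-- Reality comes from the invariant set of real vectors: at real parameters the equation takes real
values on them. -/
theorem exists_initialData (hω : 0 < ω) (hdio : IsDiophantine ω) (L0 : ℝ) :
    ∃ d R c0, InitialData ω L0 d R c0 := by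
  obtain ⟨d, hd, R, hR, c0, hR16, h1, h2, h3⟩ := exists_initial hω hdio L0
  refine ⟨d, R, c0, hω, hd, hR, hR16, fun z a b => (h1 z a b).1, fun z a b => (h1 z a b).2.1,
    fun z a b => (h1 z a b).2.2, fun p hp1 hp2 => ?_, h3⟩
  rw [← norm_incl_fst] at hp1
  rw [← norm_incl_sub] at hp2
  refine h2 (incl p) hp1 hp2 {c | ∀ x, (c x).im = 0} ?_ (fun x => Complex.zero_im) ?_
  · rw [Set.ofPred_forall]
    exact isClosed_iInter fun x => isClosed_eq
      (Complex.continuous_im.comp (continuous_apply x)) continuous_const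
  · intro c hc hcR x
    have h4 := Fc_eq_coef hω (Ω := p.2) (glue_im (r := p.1) hc)
      (fun x hx => glue_of_notMem _ _ hx) (nrm_glue_le_eighth hR16 hp1 hcR) x
    have h5 : Feq ω L0 (incl p) c x
        = ((coef ω (f ω p.2 (synth ω (reS (glue L0 p.1 c)))) x / lam ω x : ℝ) : ℂ) := by
      rw [Complex.ofReal_div, ← h4]
      rfl
    rw [Pi.sub_apply, Complex.sub_im, hc, h5, Complex.ofReal_im, sub_zero]

namespace InitialData

variable {L0 d R : ℝ} {c0 : ℂ × ℂ → ball L0 → ℂ}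

/-- The complexified initial approximation. -/
def u0 (L0 : ℝ) (c0 : ℂ × ℂ → ball L0 → ℂ) (z : ℂ × ℂ) : Site → ℂ := glue L0 z.1 (c0 z)

theorem v_add_synth_glue (hω : 0 < ω) (r : ℝ) (c : ball L0 → ℂ) :
    v ω r + synth ω (reS (glue L0 0 c)) = synth ω (reS (glue L0 r c)) := by
  rw [v_add_synth hω (summable_abs_of_support (reS_support (glue_zero_support c))), reS_glue]

/-- A function in the range of the projection is determined by its coefficients. They are bounded by
the norm, hence lie in the ball where the complex solution is unique. -/
theorem eq_synth_of_isInitial (H : InitialData ω L0 d R c0) {s σ0 ρ : ℝ} (hs : 0 ≤ s)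
    (hσ0 : 0 ≤ σ0) (hρ : ρ ≤ R) {p : ℝ × ℝ} (hp1 : |p.1| ≤ R) (hp2 : |p.2 - Omega0 ω| ≤ d) {w : Fn}
    (hw : IsInitial ω L0 s σ0 ρ p w) : w = synth ω (reS (glue L0 0 (c0 (incl p)))) := by
  classical
  have hω := H.hω
  set c : ball L0 → ℂ := fun x => (coef ω w x : ℂ) with hc
  have hcim : ∀ x, (c x).im = 0 := fun x => Complex.ofReal_im _
  have hsupp := reS_support (glue_zero_support c)
  have hwc : w = synth ω (reS (glue L0 0 c)) := by
    rw [← hw.range, proj_eq_synth]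
    congr 1
    funext x
    rw [reS, glue]
    by_cases hx : x ∈ ball L0
    · rw [if_pos hx, dif_pos hx, hc, Complex.ofReal_re]
    · rw [if_neg hx, dif_neg hx]
      split_ifs <;> simp
  have hsm := summable_of_support hsupp fun x => wt s σ0 x.j x.k
  have hcR : ‖c‖ ≤ R := by
    refine (pi_norm_le_iff_of_nonneg H.R_pos.le).2 fun x => ?_
    have h1 := abs_le_normH_synth hω hs hσ0 hsm x
    rw [← hwc, reS, glue_mem] at h1
    rw [hc, Complex.norm_real, Real.norm_eq_abs]
    rw [hc, Complex.ofReal_re] at h1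
    exact h1.trans (hw.small.le.trans hρ)
  have heq : c = c0 (incl p) := by
    rw [← norm_incl_fst] at hp1
    rw [← norm_incl_sub] at hp2
    refine H.unique _ hp1 hp2 c hcR fun x hx => ?_
    have h2 := Fc_eq_coef hω (Ω := p.2) (glue_im (r := p.1) hcim)
      (fun x hx => glue_of_notMem _ _ hx) (nrm_glue_le_eighth H.R_le hp1 hcR) x
    have h3 := (proj_eq_zero_iff hω _ _).1 hw.eqn x hx
    rw [hwc, v_add_synth_glue hω] at h3
    rw [h3, Complex.ofReal_zero] at h2
    exact h2
  rw [hwc, heq]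

theorem isInitial_synth (H : InitialData ω L0 d R c0) {s σ0 ρ : ℝ} (hs : 0 ≤ s)
    (hσ0 : 0 ≤ σ0) {p : ℝ × ℝ} (hp1 : |p.1| ≤ R) (hp2 : |p.2 - Omega0 ω| ≤ d)
    (hρ : |p.1| * ∑ x ∈ ball L0, wt s σ0 x.j x.k < ρ) :
    IsInitial ω L0 s σ0 ρ p (synth ω (reS (glue L0 0 (c0 (incl p))))) := by
  have hω := H.hω
  have hsupp := reS_support (glue_zero_support (c0 (incl p)))
  have him := H.real p hp1 hp2
  rw [← norm_incl_fst] at hp1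
  rw [← norm_incl_sub] at hp2
  have hb := H.bound _ hp1 hp2
  refine ⟨proj_synth hω hsupp, ?_, ?_⟩
  · refine lt_of_le_of_lt ?_ hρ
    refine (normH_synth_le hω hs hσ0 (summable_of_support hsupp _)).trans ?_
    rw [tsum_eq_sum (s := ball L0) fun x hx => by rw [hsupp x hx, abs_zero, zero_mul],
      Finset.mul_sum]
    refine Finset.sum_le_sum fun x hx => mul_le_mul_of_nonneg_right ?_ (wt_nonneg _ _ _ _)
    rw [reS, glue_mem 0 _ ⟨x, hx⟩, ← norm_incl_fst]
    exact (Complex.abs_re_le_norm _).trans ((norm_le_pi_norm _ _).trans hb)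
  · rw [proj_eq_zero_iff hω]
    intro x hx
    have h2 := Fc_eq_coef hω (Ω := p.2) (glue_im (r := p.1) him)
      (fun x hx => glue_of_notMem _ _ hx) (nrm_glue_le_eighth H.R_le hp1 (hb.trans hp1)) x
    have h3 := H.eqn _ hp1 hp2 x hx
    change Fc ω (ballN L0) (p.2 : ℂ) (glue L0 p.1 (c0 (incl p))) x = 0 at h3
    rw [v_add_synth_glue hω]
    rw [h3] at h2
    exact_mod_cast h2.symm

end InitialData

end VortexFilament

end

/-! ### Passage to the limit. -/

noncomputable section

namespace VortexFilament

variable {ω : ℝ}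

/-! ### The limit of the iteration -/

/-- The increments of the iteration, without the kernel component. -/
def incr (ω L0 : ℝ) (u0 : ℂ × ℂ → Site → ℂ) : ℕ → ℂ × ℂ → Site → ℂ
  | 0 => fun z x => if x = siteN then 0 else u0 z x
  | n + 1 => fun z => stepC ω (scale L0 (n + 1)) z.2 (uC ω L0 u0 n z)

theorem sum_incr (L0 : ℝ) (u0 : ℂ × ℂ → Site → ℂ) (n : ℕ) (z : ℂ × ℂ) (x : Site) :
    ∑ m ∈ Finset.range (n + 1), incr ω L0 u0 m z x
      = if x = siteN then 0 else uC ω L0 u0 n z x := by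
  induction n with
  | zero => simp [incr, uC]
  | succ n ih =>
    rw [Finset.sum_range_succ, ih]
    split_ifs with h
    · rw [h, zero_add]
      exact stepC_of_notMem _ _ (siteN_notMem_ball _)
    · rfl

theorem summable_kap_mul_tauS (D A : ℝ) {a : ℝ} (ha : 0 < a) :
    Summable fun n => A * kap D n * tauS a n := by
  have h : Summable fun n => kap D n * tauS a n := by
    refine (summable_exp_sq_sub_pow |D| ha).of_nonneg_of_le
      (fun n => mul_nonneg (Real.exp_pos _).le (Real.exp_pos _).le) fun n => ?_
    rw [kap, tauS, ← Real.exp_add]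
    refine Real.exp_le_exp.2 ?_
    have hn : (1 : ℝ) ≤ n + 1 := by linarith [(Nat.cast_nonneg n : (0 : ℝ) ≤ n)]
    have h3 : D * ((n : ℝ) + 1) ≤ |D| * ((n : ℝ) + 1) ^ 2 :=
      mul_le_mul (le_abs_self D) (by nlinarith) (by linarith) (abs_nonneg _)
    linarith
  simpa only [mul_assoc] using h.mul_left A

theorem exists_mem_ball {L0 : ℝ} (hL0 : 0 < L0) {x : Site} (hx : x ≠ siteN) :
    ∀ᶠ n in Filter.atTop, x ∈ ball (scale L0 n) := by
  have h : Filter.Tendsto (fun n => scale L0 n) Filter.atTop Filter.atTop :=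
    (tendsto_pow_atTop_atTop_of_one_lt one_lt_two).atTop_mul_const hL0
  filter_upwards [h.eventually_gt_atTop ((x.j : ℝ) + x.k)] with n hn
  exact mem_ball.2 ⟨hx, hn⟩

namespace NewtonData

variable {L0 s β C : ℝ} {K : Set (ℝ × ℝ)} {γ σ : ℕ → ℝ} {D a D1 η b σ1 : ℝ}
  {u0 : ℂ × ℂ → Site → ℂ}

theorem incr_supp (H : NewtonData ω L0 K σ (kap D) (tauS a) (tauS (a / 2)) (epsS D1) η b u0)
    (n : ℕ) (z : ℂ × ℂ) : ∀ x ∉ ball (scale L0 n), incr ω L0 u0 n z x = 0 := by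
  intro x hx
  cases n with
  | zero =>
    rw [scale_zero] at hx
    change (if x = siteN then 0 else u0 z x) = 0
    split_ifs with h
    · rfl
    · exact H.supp z x fun h' => (mem_ballN.1 h').elim h hx
  | succ n => exact stepC_of_notMem _ _ hx

theorem incr_smooth (H : NewtonData ω L0 K σ (kap D) (tauS a) (tauS (a / 2)) (epsS D1) η b u0)
    (n : ℕ) (x : Site) :
    ContDiffOn ℂ (⊤ : ℕ∞) (fun z => incr ω L0 u0 n z x) (nbhd K (epsS D1) n) := by
  cases n with
  | zero =>
    simp only [incr]
    split_ifs with h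
    · exact contDiffOn_const
    · exact H.smooth x
  | succ n =>
    refine (((H.good (n + 1)).smooth x).sub
      (((H.good n).smooth x).mono (H.nbhd_succ_subset n))).congr fun z _ => ?_
    rw [uC_succ_apply, add_sub_cancel_left]
    rfl

/-- The factor `e^a` only makes the bound valid at `n = 0`, where `tauS a 0 = e^{-a}`. -/
theorem nrm_incr_le (H : NewtonData ω L0 K σ (kap D) (tauS a) (tauS (a / 2)) (epsS D1) η b u0)
    (ha : 0 < a) (n : ℕ) {z : ℂ × ℂ} (hz : z ∈ nbhd K (epsS D1) n) :
    nrm (σ n) (ballN (scale L0 n)) (incr ω L0 u0 n z) ≤ η * Real.exp a * tauS a n := by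
  cases n with
  | zero =>
    have h1 : nrm (σ 0) (ballN (scale L0 0)) (incr ω L0 u0 0 z)
        ≤ nrm (σ 0) (ballN (scale L0 0)) (u0 z) := by
      refine Finset.sum_le_sum fun x _ => mul_le_mul_of_nonneg_right ?_ (wS_pos _ _).le
      change ‖if x = siteN then 0 else u0 z x‖ ≤ _
      split_ifs
      · rw [norm_zero]; exact norm_nonneg _
      · exact le_rfl
    have h2 := H.small z hz
    rw [scale_zero] at h1 ⊢
    have h3 : Real.exp a * tauS a 0 = 1 := by
      rw [tauS, ← Real.exp_add]
      simp
    rw [mul_assoc, h3, mul_one]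
    exact h1.trans h2
  | succ n =>
    refine (H.step_le (fun m _ => H.good m) hz).trans ?_
    refine mul_le_mul_of_nonneg_right ?_ (tauS_pos a _).le
    exact le_mul_of_one_le_right H.eta_pos.le (Real.one_le_exp ha.le)

theorem wt_le (S : Scales L0 s β C γ σ D a) (hσ : ∀ n, σ1 ≤ σ n) (n : ℕ) {x : Site}
    (hx : x ∈ ballN (scale L0 n)) : wt s σ1 x.j x.k ≤ kap D n * wS (σ n) x := by
  rw [wt, mul_comm]
  exact mul_le_mul (S.bracket_le n x hx) (wS_mono (hσ n) x) (Real.exp_pos _).le (Real.exp_pos _).le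

/-- The polynomial weight `⟨x⟩^s` costs one factor `kap` on the support of the increment; the
exponential weight at `σ1` is below the one at `σ n`. -/
theorem sum_incr_wt_le
    (H : NewtonData ω L0 K σ (kap D) (tauS a) (tauS (a / 2)) (epsS D1) η b u0)
    (S : Scales L0 s β C γ σ D a) (hσ : ∀ n, σ1 ≤ σ n) (n : ℕ) {z : ℂ × ℂ}
    (hz : z ∈ nbhd K (epsS D1) n) :
    ∑ x ∈ ballN (scale L0 n), ‖incr ω L0 u0 n z x‖ * wt s σ1 x.j x.k
      ≤ η * Real.exp a * kap D n * tauS a n := by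
  calc _ ≤ ∑ x ∈ ballN (scale L0 n), kap D n * (‖incr ω L0 u0 n z x‖ * wS (σ n) x) := by
        refine Finset.sum_le_sum fun x hx => ?_
        calc _ ≤ ‖incr ω L0 u0 n z x‖ * (kap D n * wS (σ n) x) :=
              mul_le_mul_of_nonneg_left (wt_le S hσ n hx) (norm_nonneg _)
          _ = _ := by ring
    _ = kap D n * nrm (σ n) (ballN (scale L0 n)) (incr ω L0 u0 n z) := by
        rw [nrm, Finset.mul_sum]
    _ ≤ kap D n * (η * Real.exp a * tauS a n) :=
        mul_le_mul_of_nonneg_left (H.nrm_incr_le S.a_pos n hz) (Real.exp_pos _).le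
    _ = _ := by ring

/-- Convergence of the iteration, the range equation for the limit, and Whitney smoothness. -/
theorem conclusion
    (H : NewtonData ω L0 K σ (kap D) (tauS a) (tauS (a / 2)) (epsS D1) η b u0)
    (S : Scales L0 s β C γ σ D a) (hs : 0 ≤ s) (hσ1 : 0 < σ1) (hσ : ∀ n, σ1 ≤ σ n)
    {w0 : ℝ × ℝ → Fn}
    (hiter : ∀ p ∈ K, ∀ n, (∀ x, (uC ω L0 u0 n (incl p) x).im = 0) ∧
      v ω p.1 + iter ω L0 w0 n p = synth ω (reS (uC ω L0 u0 n (incl p)))) :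
    ∃ w : ℝ × ℝ → Fn,
      (∀ p ∈ K, MemH ω s σ1 (w p) ∧ (∀ n, MemH ω s σ1 (iter ω L0 w0 n p)) ∧
        Filter.Tendsto (fun n => normH ω s σ1 (iter ω L0 w0 n p - w p)) Filter.atTop (nhds 0) ∧
        (∀ t θ, ‖(v ω p.1 + w p) t θ‖ < 1) ∧ coef ω (w p) siteN = 0 ∧ RangeEquation ω p (w p)) ∧
      WhitneySmoothOn ω s σ1 K w := by
  have hω := H.hω
  set A := η * Real.exp a with hA
  have hA0 : 0 ≤ A := mul_nonneg H.eta_pos.le (Real.exp_pos _).le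
  set q : Site → ℝ := fun x => wt s σ1 x.j x.k with hq
  have hq1 : ∀ x, 1 ≤ q x := fun x => one_le_wt hs hσ1.le x
  set bb : ℕ → ℝ := fun n => A * kap D n * tauS a n with hbb
  have hbbs : Summable bb := summable_kap_mul_tauS D A S.a_pos
  have hKn : ∀ n, ∀ p ∈ K, incl p ∈ nbhd K (epsS D1) n := fun n p hp =>
    Metric.self_subset_thickening (H.eps_pos n) _ (Set.mem_image_of_mem _ hp)
  set g : ℝ × ℝ → ℕ → Site → ℝ := fun p n x => (incr ω L0 u0 n (incl p) x).re with hg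
  have hgsupp : ∀ p n, ∀ x ∉ ballN (scale L0 n), g p n x = 0 := fun p n x hx => by
    rw [hg]
    simp only
    rw [H.incr_supp n _ x fun h => hx (ball_subset_ballN _ h), Complex.zero_re]
  have hgs : ∀ p n, Summable fun x => |g p n x| * q x := fun p n =>
    summable_of_support (hgsupp p n) q
  have hgb : ∀ p ∈ K, ∀ n, ∑' x, |g p n x| * q x ≤ bb n := by
    intro p hp n
    rw [tsum_eq_sum (s := ballN (scale L0 n)) fun x hx => by
      rw [hgsupp p n x hx, abs_zero, zero_mul]]
    refine le_trans (Finset.sum_le_sum fun x _ => ?_) (H.sum_incr_wt_le S hσ n (hKn n p hp))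
    exact mul_le_mul_of_nonneg_right (Complex.abs_re_le_norm _) (wt_nonneg _ _ _ _)
  set G : ℝ × ℝ → Site → ℝ := fun p x => ∑' n, g p n x with hG
  set c : ℝ × ℝ → ℕ → Site → ℝ := fun p n x => ∑ m ∈ Finset.range (n + 1), g p m x with hc
  have htail : ∀ p ∈ K, ∀ n, (Summable fun x => |(c p n - G p) x| * q x) ∧
      ∑' x, |(c p n - G p) x| * q x ≤ ∑' m, bb (m + (n + 1)) := by
    intro p hp n
    have h := (tail_bounds hq1 hbbs (hgs p) (hgb p hp)).2 (n + 1)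
    have e : ∀ x, |∑' m, g p m x - ∑ m ∈ Finset.range (n + 1), g p m x| = |(c p n - G p) x| :=
      fun x => abs_sub_comm _ _
    simp only [e] at h
    exact h
  have hGs : ∀ p ∈ K, Summable fun x => |G p x| * q x := by
    intro p hp
    have h := ((tail_bounds hq1 hbbs (hgs p) (hgb p hp)).2 0).1
    simpa only [Finset.range_zero, Finset.sum_empty, sub_zero] using h
  have htend : Filter.Tendsto (fun n => ∑' m, bb (m + (n + 1))) Filter.atTop (nhds 0) :=
    (tendsto_sum_nat_add bb).comp (Filter.tendsto_add_atTop_nat 1)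
  have hcsupp : ∀ p n, ∀ x ∉ ballN (scale L0 n), c p n x = 0 := by
    intro p n x hx
    refine Finset.sum_eq_zero fun m hm => hgsupp p m x fun h => hx (ballN_mono ?_ h)
    exact monotone_nat_of_le_succ (scale_le_succ H.hL0) (Nat.lt_succ_iff.1 (Finset.mem_range.1 hm))
  have hcu : ∀ p n, Pi.single siteN p.1 + c p n = reS (uC ω L0 u0 n (incl p)) := by
    intro p n
    funext x
    have h1 : c p n x = (∑ m ∈ Finset.range (n + 1), incr ω L0 u0 m (incl p) x).re := by
      rw [Complex.re_sum]
    rw [Pi.add_apply, h1, sum_incr, reS]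
    by_cases hx : x = siteN
    · subst hx
      rw [if_pos rfl, Pi.single_eq_same, H.uC_kernel]
      simp [incl_apply]
    · rw [if_neg hx, Pi.single_eq_of_ne hx, zero_add]
  have hiter' : ∀ p ∈ K, ∀ n, iter ω L0 w0 n p = synth ω (c p n) := by
    intro p hp n
    have h1 := (hiter p hp n).2
    rw [← hcu, ← v_add_synth hω (summable_abs_of_support (hcsupp p n))] at h1
    exact add_left_cancel h1
  have habs : ∀ {d : Site → ℝ}, (Summable fun x => |d x| * q x) → Summable fun x => |d x| :=
    fun h => summable_abs_of_summable_wt hs hσ1.le h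
  have habs_le : ∀ {d : Site → ℝ}, (Summable fun x => |d x| * q x) →
      ∑' x, |d x| ≤ ∑' x, |d x| * q x := fun h =>
    (habs h).tsum_le_tsum (fun x => le_mul_of_one_le_right (abs_nonneg _) (hq1 x)) h
  have hdecay : ∀ {d : Site → ℝ}, (Summable fun x => |d x| * q x) → Decay d :=
    fun h => decay_of_summable_wt hs hσ1 h
  have hsingle : ∀ r : ℝ, Summable fun x => |(Pi.single siteN r : Site → ℝ) x| * q x := fun r =>
    summable_of_support (B := {siteN}) (fun x hx => Pi.single_eq_of_ne (by simpa using hx) _) q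
  have hnrm0 : ∀ p ∈ K, ∀ n, nrm 0 (ballN (scale L0 n)) (uC ω L0 u0 n (incl p)) ≤ 1 / 16 :=
    fun p hp n => (nrm_mono (H.sigma_nonneg n) _ _).trans
      (Good.le_sixteenth H (H.good n) (hKn n p hp))
  have huabs : ∀ p ∈ K, ∀ n, ∑' x, |((Pi.single siteN p.1 : Site → ℝ) + c p n) x| ≤ 1 / 16 := by
    intro p hp n
    rw [hcu, tsum_eq_sum (s := ballN (scale L0 n)) fun x hx => by
      rw [reS_support (H.uC_supp n _) x hx, abs_zero], ← nrm_zero_eq,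
      ofReal_reS (hiter p hp n).1]
    exact hnrm0 p hp n
  have hus : ∀ p ∈ K, ∀ n, Summable fun x => |((Pi.single siteN p.1 : Site → ℝ) + c p n) x| * q x := by
    intro p hp n
    rw [hcu]
    exact summable_of_support (reS_support (H.uC_supp n _)) q
  have hinf : ∀ p ∈ K, (Summable fun x => |((Pi.single siteN p.1 : Site → ℝ) + G p) x| * q x) := by
    intro p hp
    refine ((hsingle p.1).add (hGs p hp)).of_nonneg_of_le
      (fun x => mul_nonneg (abs_nonneg _) (wt_nonneg _ _ _ _)) fun x => ?_
    rw [← add_mul]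
    exact mul_le_mul_of_nonneg_right (abs_add_le _ _) (wt_nonneg _ _ _ _)
  have hinf8 : ∀ p ∈ K, ∑' x, |((Pi.single siteN p.1 : Site → ℝ) + G p) x| ≤ 1 / 8 := by
    intro p hp
    -- An iterate has `ℓ¹` size at most `1/16`. A tail below `1/16` then keeps the limit within
    -- `1/8`, the threshold for the nonlinearity.
    obtain ⟨n, hn⟩ := (htend.eventually_le_const (show (0 : ℝ) < 1 / 16 by norm_num)).exists
    have h1 := (htail p hp n)
    have h2 : ∑' x, |((Pi.single siteN p.1 : Site → ℝ) + G p) x|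
        ≤ ∑' x, (|((Pi.single siteN p.1 : Site → ℝ) + c p n) x| + |(c p n - G p) x|) := by
      refine (habs (hinf p hp)).tsum_le_tsum (fun x => ?_) ((habs (hus p hp n)).add (habs h1.1))
      have : ((Pi.single siteN p.1 : Site → ℝ) + G p) x
          = ((Pi.single siteN p.1 : Site → ℝ) + c p n) x - (c p n - G p) x := by
        simp only [Pi.add_apply, Pi.sub_apply]
        ring
      rw [this]
      exact abs_sub _ _
    rw [(habs (hus p hp n)).tsum_add (habs h1.1)] at h2
    have h3 := habs_le h1.1
    linarith [huabs p hp n, h1.2]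
  have hvw : ∀ p ∈ K, v ω p.1 + synth ω (G p) = synth ω ((Pi.single siteN p.1 : Site → ℝ) + G p) :=
    fun p hp => v_add_synth hω (habs (hGs p hp)) p.1
  refine ⟨fun p => synth ω (G p), fun p hp => ⟨memH_synth hω hs hσ1.le (hGs p hp), fun n => ?_,
    ?_, fun t θ => ?_, ?_, fun x hx => ?_⟩, ?_⟩
  · rw [hiter' p hp n]
    exact memH_synth hω hs hσ1.le (summable_of_support (hcsupp p n) q)
  · refine squeeze_zero (fun n => Real.sqrt_nonneg _) (fun n => ?_) htend
    rw [hiter' p hp n, ← synth_sub hω (summable_abs_of_support (hcsupp p n)) (habs (hGs p hp))]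
    exact (normH_synth_le hω hs hσ1.le (htail p hp n).1).trans (htail p hp n).2
  · rw [hvw p hp]
    have := norm_synth_le hω (habs (hinf p hp)) t θ
    linarith [hinf8 p hp]
  · rw [coef_synth hω (habs (hGs p hp)), hG]
    refine (tsum_congr fun n => ?_).trans tsum_zero
    rw [hg]
    simp only
    rw [H.incr_supp n _ _ (siteN_notMem_ball _), Complex.zero_re]
  · rw [hvw p hp]
    obtain ⟨Kx, hKx⟩ := exists_abs_coef_f_sub_le hω p.2 x
    -- The coefficient of the limit is bounded by that of the `n`-th iterate, a residual once `x`
    -- lies in the ball, plus the Lipschitz constant at `x` times the tail; both tend to zero.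
    have hlim : Filter.Tendsto (fun n => |Kx| * ∑' m, bb (m + (n + 1))
        + 512 * ω * (η * tauS a n) ^ 2) Filter.atTop (nhds 0) := by
      have h1 := (((summable_tauS S.a_pos).tendsto_atTop_zero.const_mul η).pow 2).const_mul (512 * ω)
      have h2 := (htend.const_mul |Kx|).add h1
      simpa using h2
    have hle : |coef ω (f ω p.2 (synth ω ((Pi.single siteN p.1 : Site → ℝ) + G p))) x| ≤ 0 := by
      refine ge_of_tendsto hlim ?_
      filter_upwards [exists_mem_ball H.hL0 hx] with n hn
      have h1 := hKx _ _ (hdecay (hus p hp n)) (hdecay (hinf p hp))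
        (by linarith [huabs p hp n]) (by linarith [hinf8 p hp])
      have h2 : ∑' y, |((Pi.single siteN p.1 : Site → ℝ) + c p n) y - ((Pi.single siteN p.1 : Site → ℝ) + G p) y|
          = ∑' y, |(c p n - G p) y| := tsum_congr fun y => by
        simp only [Pi.add_apply, Pi.sub_apply, add_sub_add_left_eq_sub]
      rw [h2] at h1
      have h3 : ∑' y, |(c p n - G p) y| ≤ ∑' m, bb (m + (n + 1)) :=
        (habs_le (htail p hp n).1).trans (htail p hp n).2
      have h4 : Kx * ∑' y, |(c p n - G p) y| ≤ |Kx| * ∑' m, bb (m + (n + 1)) :=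
        mul_le_mul (le_abs_self _) h3 (tsum_nonneg fun _ => abs_nonneg _) (abs_nonneg _)
      have h5 := (H.good n).resid (incl p) (hKn n p hp) x hn
      have h6 := Fc_eq_coef hω (Ω := p.2) (hiter p hp n).1 (H.uC_supp n _)
        ((hnrm0 p hp n).trans (by norm_num)) x
      change ‖Fc ω (ballN (scale L0 n)) (p.2 : ℂ) (uC ω L0 u0 n (incl p)) x‖ * _ ≤ _ at h5
      rw [h6, Complex.norm_real, Real.norm_eq_abs, ← hcu] at h5
      have h7 := (le_mul_of_one_le_right (abs_nonneg _) (one_le_wS (H.sigma_nonneg n) x)).trans h5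
      have h8 := abs_sub_abs_le_abs_sub
        (coef ω (f ω p.2 (synth ω ((Pi.single siteN p.1 : Site → ℝ) + G p))) x)
        (coef ω (f ω p.2 (synth ω ((Pi.single siteN p.1 : Site → ℝ) + c p n))) x)
      rw [abs_sub_comm] at h1
      linarith
    exact abs_nonpos_iff.1 hle
  · have hbd : ∀ n x, ∀ z ∈ nbhd K (epsS D1) n,
        ‖incr ω L0 u0 n z x‖ * q x ≤ A * kap D n * tauS a n := by
      intro n x z hz
      by_cases hx : x ∈ ballN (scale L0 n)
      · exact (Finset.single_le_sum (f := fun x => ‖incr ω L0 u0 n z x‖ * wt s σ1 x.j x.k)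
          (fun y _ => mul_nonneg (norm_nonneg _) (wt_nonneg _ _ _ _)) hx).trans
          (H.sum_incr_wt_le S hσ n hz)
      · rw [H.incr_supp n z x fun h => hx (ball_subset_ballN _ h), norm_zero, zero_mul]
        exact mul_nonneg (mul_nonneg hA0 (Real.exp_pos _).le) (Real.exp_pos _).le
    have hcard : ∀ n, ((ball (scale L0 n)).card : ℝ) ≤ kap D n := fun n =>
      le_trans (by exact_mod_cast Finset.card_le_card (ball_subset_ballN _)) (S.card_le n)
    obtain ⟨W, hW, hWp⟩ := exists_smooth_extension S.a_pos hA0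
      (fun x => zero_lt_one.trans_le (hq1 x)) H.incr_supp hcard H.incr_smooth hbd
    refine ⟨W, hW, fun p hp x => ?_⟩
    rw [hWp p hp x, coef_synth hω (habs (hGs p hp))]

end NewtonData

end VortexFilament

end

/-! ### Choice of the smallness parameters. -/

noncomputable section

namespace VortexFilament

variable {ω : ℝ}

/-! ### Choice of the constants -/

theorem exists_pos_le_four {A B E F : ℝ} (hA : 0 < A) (hB : 0 < B) (hE : 0 < E) (hF : 0 < F) :
    ∃ r : ℝ, 0 < r ∧ r ≤ A ∧ r ≤ B ∧ r ≤ E ∧ r ≤ F :=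
  ⟨min (min A B) (min E F), by positivity, (min_le_left _ _).trans (min_le_left _ _),
    (min_le_left _ _).trans (min_le_right _ _), (min_le_right _ _).trans (min_le_left _ _),
    (min_le_right _ _).trans (min_le_right _ _)⟩

namespace InitialData

variable {L0 d R s σ0 β C D a : ℝ} {γ : ℕ → ℝ} {c0 : ℂ × ℂ → ball L0 → ℂ}

theorem u0_supp (L0 : ℝ) (c0 : ℂ × ℂ → ball L0 → ℂ) (z : ℂ × ℂ) :
    ∀ x ∉ ballN L0, u0 L0 c0 z x = 0 := fun _ hx => glue_of_notMem _ _ hx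

theorem u0_smooth (H : InitialData ω L0 d R c0) (x : Site) :
    ContDiffOn ℂ (⊤ : ℕ∞) (fun z => u0 L0 c0 z x) {z | ‖z.1‖ < R ∧ ‖z.2 - Omega0 ω‖ < d} := by
  simp only [u0, glue]
  split_ifs with h1 h2
  · exact (contDiffOn_pi.1 H.smooth) ⟨x, h1⟩
  · exact contDiffOn_fst
  · exact contDiffOn_const

theorem nrm_u0_le (H : InitialData ω L0 d R c0) (σ : ℝ) {z : ℂ × ℂ} (h1 : ‖z.1‖ ≤ R)
    (h2 : ‖z.2 - Omega0 ω‖ ≤ d) :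
    nrm σ (ballN L0) (u0 L0 c0 z) ≤ ‖z.1‖ * ∑ x ∈ ballN L0, wS σ x := by
  rw [u0, nrm_glue, ballN, Finset.sum_insert (siteN_notMem_ball _), mul_add,
    ← Finset.sum_coe_sort (ball L0), Finset.mul_sum]
  refine add_le_add le_rfl (Finset.sum_le_sum fun x _ => ?_)
  have h3 : ‖c0 z x‖ ≤ ‖z.1‖ := (norm_le_pi_norm (c0 z) x).trans (H.bound z h1 h2)
  exact mul_le_mul_of_nonneg_right h3 (wS_pos _ _).le

/-- The inverse bounds on the real parameter set, transported to the complexified equation. -/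
theorem inverse_bound (H : InitialData ω L0 d R c0) (hL0 : 0 < L0) (hs : 0 ≤ s) {σ : ℕ → ℝ}
    (hσ : ∀ n, 0 ≤ σ n) (hsig : σ = sig σ0 γ) {κ : ℝ} {w0 : ℝ × ℝ → Fn} {p : ℝ × ℝ}
    (hp1 : |p.1| ≤ R) (hp2 : |p.2 - Omega0 ω| ≤ d)
    (hw : w0 p = synth ω (reS (glue L0 0 (c0 (incl p))))) (n : ℕ)
    (hκ : C * ((γ (n + 1) ^ 2)⁻¹ / dseq L0 β (n + 1)) ≤ κ)
    (ht : TameInverse ω L0 s σ0 β C γ w0 (n + 1) p)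
    (hn : ∀ m ≤ n, nrm (σ m) (ballN (scale L0 m)) (uC ω L0 (u0 L0 c0) m (incl p)) ≤ 1 / 8) :
    IsUnit (jacN ω (scale L0 (n + 1)) (incl p).2 (uC ω L0 (u0 L0 c0) n (incl p))).det ∧
      ∀ c : ball (scale L0 (n + 1)) → ℂ,
        ∑ x, ‖((jacN ω (scale L0 (n + 1)) (incl p).2 (uC ω L0 (u0 L0 c0) n (incl p)))⁻¹ *ᵥ c) x‖
            * wS (σ (n + 1)) x
          ≤ κ * ∑ x, ‖c x‖ * wS (σ (n + 1)) x := by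
  have hω := H.hω
  have hn0 : ∀ m ≤ n, nrm 0 (ballN (scale L0 m)) (uC ω L0 (u0 L0 c0) m (incl p)) ≤ 1 / 8 :=
    fun m hm => (nrm_mono (hσ m) _ _).trans (hn m hm)
  obtain ⟨h1, h2⟩ := iter_eq_synth hω hL0 (u0 := u0 L0 c0) (w0 := w0) (u0_supp L0 c0 (incl p))
    (glue_im (H.real p hp1 hp2)) (by rw [hw, v_add_synth_glue hω]; rfl) n
    fun m hm => hn0 m hm.le
  have hz := uC_eq_zero (ω := ω) hL0 (u0_supp L0 c0 (incl p)) n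
  have hz' : ∀ x ∉ ballN (scale L0 (n + 1)), uC ω L0 (u0 L0 c0) n (incl p) x = 0 := fun x hx =>
    hz x fun hx' => hx (ballN_mono (scale_le_succ hL0 n) hx')
  have h3 := jacN_eq_map hω (Ω := p.2) h1 hz' (by
    rw [nrm_succ_eq hL0 0 n hz]
    exact hn0 n le_rfl)
  obtain ⟨t1, t2⟩ := ht
  rw [Nat.add_sub_cancel, h2] at t1 t2
  change IsUnit (jacN ω (scale L0 (n + 1)) (p.2 : ℂ) _).det ∧ ∀ c, ∑ x, ‖((jacN ω
    (scale L0 (n + 1)) (p.2 : ℂ) _)⁻¹ *ᵥ c) x‖ * _ ≤ _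
  rw [h3]
  refine ⟨?_, fun c => ?_⟩
  · have := t1.map (Complex.ofRealHom : ℝ →+* ℂ)
    rwa [RingHom.map_det] at this
  · rw [map_ofReal_inv, hsig]
    refine (sum_norm_mulVec_le hs (hsig ▸ hσ (n + 1)) _ c).trans ?_
    exact mul_le_mul_of_nonneg_right (t2.trans hκ)
      (Finset.sum_nonneg fun x _ => mul_nonneg (norm_nonneg _) (wS_pos _ _).le)

/-- The order of choice matters: `D` and `a` come from the scales, then `η` is small in terms of
these, `r0` small in terms of `η`, and finally `D1` large in terms of `r0`. None of them depends on
the parameter set `K`. -/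
theorem exists_newtonData (H : InitialData ω L0 d R c0) (hL0 : 0 < L0) (hs : 0 ≤ s) (hσ0 : 0 < σ0)
    (hγ : ∀ n, 1 ≤ n → 0 < γ n) (hsum : HasSum (fun n : ℕ => 2 * γ (n + 1)) (σ0 / 2))
    (S : Scales L0 s β C γ (sig σ0 γ) D a) :
    ∃ η b D1 r0 : ℝ, 0 < r0 ∧ r0 ≤ R ∧ r0 * ∑ x ∈ ball L0, wt s σ0 x.j x.k < R ∧
      ∀ K ⊆ params ω r0 (d / 2), ∀ w0 : ℝ × ℝ → Fn,
        (∀ p ∈ K, w0 p = synth ω (reS (glue L0 0 (c0 (incl p))))) →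
        (∀ n, 1 ≤ n → ∀ p ∈ K, TameInverse ω L0 s σ0 β C γ w0 n p) →
        NewtonData ω L0 K (sig σ0 γ) (kap D) (tauS a) (tauS (a / 2)) (epsS D1) η b
          (u0 L0 c0) := by
  have hω := H.hω
  have hd := H.d_pos
  have hR := H.R_pos
  have hτs : Summable fun n => tauS a (n + 1) := (summable_nat_add_iff 1).2 (summable_tauS S.a_pos)
  set b : ℝ := 1 + ∑' n, tauS a (n + 1) with hb
  have hb1 : 1 ≤ b := by
    have : 0 ≤ ∑' n, tauS a (n + 1) := tsum_nonneg fun n => (tauS_pos a _).le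
    linarith
  obtain ⟨Z, hZ1, hZ⟩ := exists_kap_sq_mul_tauS_le D (half_pos S.a_pos)
  set C3 : ℝ := 512 * ω + 1 + 128 * ω * b ^ 2 with hC3
  have hC3p : 0 < C3 := by positivity
  -- The first bound keeps all iterates below `1/16`; the second compensates `κ² ζ ≤ Z` in the
  -- quadratic step.
  set η : ℝ := min (1 / (16 * b)) (1 / (2 * Z * C3)) with hη
  have hηp : 0 < η := by positivity
  have hη1 : η ≤ 1 / (16 * b) := min_le_left _ _
  have hη2 : η ≤ 1 / (2 * Z * C3) := min_le_right _ _
  set W := ∑ x ∈ ballN L0, wS σ0 x with hW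
  have hWp : 0 < W := Finset.sum_pos (fun x _ => wS_pos _ _) ⟨siteN, Finset.mem_insert_self _ _⟩
  set Wt := ∑ x ∈ ball L0, wt s σ0 x.j x.k with hWt
  have hWtp : 0 ≤ Wt := Finset.sum_nonneg fun x _ => wt_nonneg _ _ _ _
  have hwN := wS_pos σ0 siteN
  clear_value η
  -- The four bounds keep complex `r`, of size below `2 r0`, inside the domain of `c0`, make the
  -- initial solution smaller than `ρ = R`, make the initial coefficients at most `η`, and make the
  -- detuning term at most `η²`.
  obtain ⟨r0, hr0p, hr1, hr2, hr3, hr4⟩ : ∃ r0 : ℝ, 0 < r0 ∧ r0 ≤ R / 3 ∧ r0 ≤ R / (1 + Wt) ∧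
      r0 ≤ η / (2 * W) ∧ r0 ≤ η ^ 2 / (4 * d * wS σ0 siteN) :=
    exists_pos_le_four (by linarith) (div_pos hR (by linarith))
      (div_pos hηp (mul_pos two_pos hWp))
      (div_pos (pow_pos hηp 2) (mul_pos (mul_pos four_pos hd) hwN))
  replace hr2 := (le_div_iff₀ (by linarith : 0 < 1 + Wt)).1 hr2
  replace hr3 := (le_div_iff₀ (mul_pos two_pos hWp)).1 hr3
  replace hr4 := (le_div_iff₀ (mul_pos (mul_pos four_pos hd) hwN)).1 hr4
  -- The first two summands give the ratio condition on the radii; the last two put all radii below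
  -- `r0` and `d/3`.
  set D1 : ℝ := |Real.log (4 * (1 + 128 * ω))| + 3 * D + |Real.log r0| + |Real.log (d / 3)| with hD1
  have hDn := S.D_nonneg
  have hD1n : 0 ≤ D1 := by positivity
  have hexp : ∀ t : ℝ, 0 < t → |Real.log t| ≤ D1 → Real.exp (-D1) ≤ t := by
    intro t ht h
    rw [← Real.exp_log ht, Real.exp_le_exp]
    linarith [neg_abs_le (Real.log t)]
  have hε1 : ∀ n, epsS D1 n ≤ r0 := fun n => (epsS_le hD1n n).trans (hexp _ hr0p (by
    rw [hD1]
    have := abs_nonneg (Real.log (4 * (1 + 128 * ω)))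
    have := abs_nonneg (Real.log (d / 3))
    linarith))
  have hε2 : ∀ n, epsS D1 n ≤ d / 3 := fun n => (epsS_le hD1n n).trans
    (hexp _ (by positivity) (by
      rw [hD1]
      have := abs_nonneg (Real.log (4 * (1 + 128 * ω)))
      have := abs_nonneg (Real.log r0)
      linarith))
  refine ⟨η, b, D1, r0, hr0p, by linarith, by linarith, fun K hK w0 hw ht => ?_⟩
  have hKp : ∀ p ∈ K, |p.1| ≤ r0 ∧ |p.2 - Omega0 ω| ≤ d / 2 := fun p hp => by
    obtain ⟨h1, h2, h3⟩ := hK hp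
    exact ⟨by rw [abs_of_nonneg h1]; exact h2.le, h3.le⟩
  have hz : ∀ z ∈ nbhd K (epsS D1) 0, ‖z.1‖ < 2 * r0 ∧ ‖z.2 - Omega0 ω‖ < d := by
    intro z hz
    obtain ⟨_, ⟨p, hp, rfl⟩, hzp⟩ := Metric.mem_thickening_iff.1 hz
    obtain ⟨h1, h2⟩ := hKp p hp
    rw [dist_eq_norm] at hzp
    rw [← norm_incl_fst] at h1
    rw [← norm_incl_sub] at h2
    have h3 := norm_fst_le (z - incl p)
    have h4 := norm_snd_le (z - incl p)
    have h5 : ‖z.1‖ ≤ ‖(z - incl p).1‖ + ‖(incl p).1‖ := by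
      refine le_trans (le_of_eq ?_) (norm_add_le _ _)
      rw [Prod.fst_sub, sub_add_cancel]
    have h6 : ‖z.2 - Omega0 ω‖ ≤ ‖(z - incl p).2‖ + ‖(incl p).2 - Omega0 ω‖ := by
      refine le_trans (le_of_eq ?_) (norm_add_le _ _)
      rw [Prod.snd_sub, sub_add_sub_cancel]
    exact ⟨by linarith [hε1 0], by linarith [hε2 0]⟩
  have hσn : ∀ n, 0 ≤ sig σ0 γ n := fun n => by linarith [half_le_sig hγ hsum n]
  refine ⟨hω, hL0, fun z => u0_supp L0 c0 z, fun z => glue_siteN _ _, fun x => ?_, fun z h => ?_,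
    fun z h => ?_, fun z h => ?_, hσn, sig_anti hγ, one_le_kap hDn, S.card_le, S.index_le, S.decay,
    fun n => (tauS_pos _ _).le, fun n => (tauS_pos _ _).le, fun n => (tauS_sq a n).le, fun n => ?_,
    hηp, ?_, fun n => ?_, fun n => Real.exp_pos _, fun n => ?_, epsS_anti hD1n, fun n => ?_,
    fun n hn p hp => ?_⟩
  · exact (H.u0_smooth x).mono fun z h => ⟨by linarith [(hz z h).1], (hz z h).2⟩
  · obtain ⟨h1, h2⟩ := hz z h
    refine (H.nrm_u0_le _ (by linarith) h2.le).trans ?_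
    calc ‖z.1‖ * W ≤ 2 * r0 * W := mul_le_mul_of_nonneg_right h1.le hWp.le
      _ ≤ η := by linarith
  · obtain ⟨h1, h2⟩ := hz z h
    exact H.eqn z (by linarith) h2.le
  · obtain ⟨h1, h2⟩ := hz z h
    calc 2 * ‖z.2 - Omega0 ω‖ * ‖z.1‖ * wS σ0 siteN ≤ 2 * d * (2 * r0) * wS σ0 siteN := by
          gcongr
      _ ≤ η ^ 2 := by linarith
  · rw [hb]
    have := hτs.sum_le_tsum (Finset.range n) fun i _ => (tauS_pos a (i + 1)).le
    linarith
  · calc b * η ≤ b * (1 / (16 * b)) := mul_le_mul_of_nonneg_left hη1 (by linarith)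
      _ = 1 / 16 := by field_simp
  · calc 2 * kap D (n + 1) ^ 2 * η * C3 * tauS (a / 2) (n + 1)
        = 2 * η * C3 * (kap D (n + 1) ^ 2 * tauS (a / 2) (n + 1)) := by ring
      _ ≤ 2 * (1 / (2 * Z * C3)) * C3 * Z := by
          exact mul_le_mul (by gcongr) (hZ (n + 1))
            (mul_nonneg (sq_nonneg _) (tauS_pos _ _).le) (by positivity)
      _ = 1 := by field_simp
  · exact (epsS_le hD1n n).trans (Real.exp_le_one_iff.2 (by linarith))
  · refine mul_kap_mul_epsS_le (by positivity) hDn ?_ n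
    rw [hD1]
    have := abs_nonneg (Real.log r0)
    have := abs_nonneg (Real.log (d / 3))
    linarith
  · obtain ⟨h1, h2⟩ := hKp p hp
    exact H.inverse_bound hL0 hs hσn rfl (by linarith) (by linarith) (hw p hp) n
      (S.tame_le (n + 1) (by omega)) (ht (n + 1) (by omega) p hp) fun m hm => hn m hm p hp

end InitialData

end VortexFilament

end

/-! ### The main theorem. -/

open scoped Matrix
open VortexFilament in
theorem mainTheorem7 (ω : ℝ) (hω : 0 < ω) (hdio : VortexFilament.IsDiophantine ω)
    (L0 : ℝ) (hL0 : 0 < L0) :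
    ∃ δ : ℝ, 0 < δ ∧
    ∀ (s σ0 β : ℝ), 1 < s → 0 < σ0 → 3 / 2 < β →
    ∀ γ : ℕ → ℝ, (∀ n, 1 ≤ n → 0 < γ n) →
    HasSum (fun n : ℕ => 2 * γ (n + 1)) (σ0 / 2) →
    ∀ ℓ M : ℝ, 0 < ℓ →
    (∀ n, 1 ≤ n →
      (γ n ^ 2)⁻¹ * Real.exp (-(γ n * (ℓ * √(VortexFilament.scale L0 n))))
        / VortexFilament.dseq L0 β n ≤ M) →
    ∀ C : ℝ, 0 < C →
    ∃ ρ r0 : ℝ, 0 < ρ ∧ 0 < r0 ∧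
      (∀ p ∈ VortexFilament.params ω r0 δ,
        ∃! w : VortexFilament.Fn, VortexFilament.IsInitial ω L0 s σ0 ρ p w) ∧
      ∀ w0 : ℝ × ℝ → VortexFilament.Fn,
        (∀ p ∈ VortexFilament.params ω r0 δ, VortexFilament.IsInitial ω L0 s σ0 ρ p (w0 p)) →
      ∀ 𝒩 : ℕ → Set (ℝ × ℝ),
        (∀ n, 1 ≤ n → 𝒩 n ⊆ VortexFilament.params ω r0 δ) →
        (∀ n, 1 ≤ n → ∀ p ∈ 𝒩 n, VortexFilament.TameInverse ω L0 s σ0 β C γ w0 n p) →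
        ∃ w : ℝ × ℝ → VortexFilament.Fn,
          (∀ p ∈ ⋂ n ∈ Set.Ici 1, 𝒩 n,
            VortexFilament.MemH ω s (σ0 / 2) (w p) ∧
            (∀ n, VortexFilament.MemH ω s (σ0 / 2) (VortexFilament.iter ω L0 w0 n p)) ∧
            Filter.Tendsto (fun n => VortexFilament.normH ω s (σ0 / 2)
              (VortexFilament.iter ω L0 w0 n p - w p)) Filter.atTop (nhds 0) ∧
            (∀ t θ, ‖(VortexFilament.v ω p.1 + w p) t θ‖ < 1) ∧
            VortexFilament.coef ω (w p) VortexFilament.siteN = 0 ∧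
            VortexFilament.RangeEquation ω p (w p)) ∧
          VortexFilament.WhitneySmoothOn ω s (σ0 / 2) (⋂ n ∈ Set.Ici 1, 𝒩 n) w := by
  obtain ⟨d, R, c0, H⟩ := exists_initialData hω hdio L0
  have hd := H.d_pos
  -- Here `d` stems from the equation on the smallest ball and depends only on `ω` and `L0`. Halving
  -- it leaves room for complex neighbourhoods of the real parameters.
  refine ⟨d / 2, half_pos hd, fun s σ0 β hs hσ0 hβ γ hγ hsum ℓ M hℓ hM C hC => ?_⟩
  have hs0 : 0 ≤ s := by linarith
  obtain ⟨D, a, S⟩ := exists_scales (σ0 := σ0) (s := s) hL0 (by linarith) (by linarith) hγ hℓ hM hC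
  obtain ⟨η, b, D1, r0, hr0, hr0R, hr0W, hN⟩ :=
    H.exists_newtonData hL0 hs0 hσ0 hγ hsum S
  have hp : ∀ p ∈ params ω r0 (d / 2), |p.1| ≤ r0 ∧ |p.1| ≤ R ∧ |p.2 - Omega0 ω| ≤ d := by
    rintro p ⟨h1, h2, h3⟩
    rw [abs_of_nonneg h1]
    exact ⟨h2.le, h2.le.trans hr0R, by linarith⟩
  have huniq : ∀ p ∈ params ω r0 (d / 2), ∀ w, IsInitial ω L0 s σ0 R p w →
      w = synth ω (reS (glue L0 0 (c0 (incl p)))) := fun p hpp w hw =>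
    H.eq_synth_of_isInitial hs0 hσ0.le le_rfl (hp p hpp).2.1 (hp p hpp).2.2 hw
  -- The radius of uniqueness of the contraction serves as `ρ`, since each coefficient is bounded by
  -- `‖w‖_{σ₀}`.
  refine ⟨R, r0, H.R_pos, hr0, fun p hpp => ⟨_, ?_, huniq p hpp⟩, fun w0 hw0 𝒩 h𝒩 ht => ?_⟩
  · refine H.isInitial_synth hs0 hσ0.le (hp p hpp).2.1 (hp p hpp).2.2 (lt_of_le_of_lt ?_ hr0W)
    exact mul_le_mul_of_nonneg_right (hp p hpp).1 (Finset.sum_nonneg fun x _ => wt_nonneg _ _ _ _)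
  · have hK : ∀ n, 1 ≤ n → ∀ p ∈ ⋂ n ∈ Set.Ici 1, 𝒩 n, p ∈ 𝒩 n := fun n hn p hpK =>
      Set.mem_iInter₂.1 hpK n hn
    have hKp : (⋂ n ∈ Set.Ici 1, 𝒩 n) ⊆ params ω r0 (d / 2) := fun p hpK =>
      h𝒩 1 le_rfl (hK 1 le_rfl p hpK)
    have hw : ∀ p ∈ ⋂ n ∈ Set.Ici 1, 𝒩 n, w0 p = synth ω (reS (glue L0 0 (c0 (incl p)))) :=
      fun p hpK => huniq p (hKp hpK) _ (hw0 p (hKp hpK))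
    have HN := hN _ hKp w0 hw fun n hn p hpK => ht n hn p (hK n hn p hpK)
    refine HN.conclusion S hs0 (half_pos hσ0) (half_le_sig hγ hsum) fun p hpK n => ?_
    refine iter_eq_synth hω hL0 (InitialData.u0_supp L0 c0 (incl p))
      (glue_im (H.real p (hp p (hKp hpK)).2.1 (hp p (hKp hpK)).2.2)) ?_ n fun m _ => ?_
    · rw [hw p hpK, InitialData.v_add_synth_glue hω]
      rfl
    · refine (nrm_mono (HN.sigma_nonneg m) _ _).trans ((NewtonData.Good.le_sixteenth HN (HN.good m)
        (Metric.self_subset_thickening (HN.eps_pos m) _ (Set.mem_image_of_mem _ hpK))).trans ?_)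
      norm_num
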